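/- Let $n\ge 0$, $G=GL(n,\mathbb C)$, $p\ge 1$. **Setting.** Let $NG(r)=G^r\ni(h_1,\dots,h_r)$, with faces $\varepsilon_i:NG(r)\to NG(r-1)$, $\varepsilon_0(h)=(h_2,\dots,h_r)$, $\varepsilon_i(h)=(h_1,\dots,h_ih_{i+1},\dots,h_r)$ for $0<i<r$, $\varepsilon_r(h)=(h_1,\dots,h_{r-1})$. Let $\Omega^{r,s}=\Omega^s(NG(r))$ be the smooth complex-valued $s$-forms, $d'=\sum_i(-1)^i\varepsilon_i^*$, $d''=(-1)^r d$ on $\Omega^{r,*}$; $\Omega^*(NG)$ is the total complex with differential $d'+d''$. Let $\Delta^m$ have barycentric coordinates $t_0,\dots,t_m$ and faces $\varepsilon^i$. A simplicial $N$-form on $NG$ is a sequence of smooth $N$-forms $\phi^{(m)}$ on $\Delta^m\times NG(m)$ with $(\varepsilon^i\times\mathrm{id})^*\phi^{(m)}=(\mathrm{id}\times\varepsilon_i)^*\phi^{(m-1)}$, and $I_\Delta(\phi)\in\Omega^N(NG)$ has the components $\int_{\Delta^r}\phi^{(r)}$, with $\int_{\Delta^r}dt_1\wedge\dots\wedge dt_r\wedge\eta:=\int_{\Delta^r}\eta\,dt_1\cdots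 dt_r$. Put $N\bar G(m)=G^{m+1}\ni(g_0,\dots,g_m)$ and $\gamma(g_0,\dots,g_m)=(g_0g_1^{-1},\dots,g_{m-1}g_m^{-1})$. On $\Delta^m\times N\bar G(m)$ let $\theta=\sum_i t_i\,g_i^{-1}dg_i$ and $\Omega=d\theta+\tfrac12[\theta,\theta]$. The $p$-th Chern character $\mathrm{ch}_p\in H^{2p}(\Omega^*(NG))$ $(\cong H^{2p}(BG;\mathbb C))$ is the class $[I_\Delta(\phi)]$, where $\phi$ is the simplicial $2p$-form on $NG$ with $\gamma^*\phi=\frac1{p!}\mathrm{tr}\big((-\Omega/2\pi i)^p\big)$. **Formula.** For $0\le q\le p-1$, on $NG(p-q)$ put $$\varphi_s=h_1\cdots h_{s-1}\,dh_s\,h_s^{-1}\cdots h_1^{-1},\qquad R_{ij}=(\varphi_i+\varphi_{i+1}+\dots+\varphi_{j-1})^2\quad(1\le i<j\le p-q+1),$$ $$S_{p-q}=\sum_{\sigma\in\mathfrak S_{p-q-1}}\mathrm{sgn}(\sigma)\,\varphi_{\sigma(1)+1}\cdots\varphi_{\sigma(p-q-1)+1},$$ with products taken in the algebra of matrix-valued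 forms. For each $\sigma$, let $\mathcal H_q(\sigma)$ be the set of all words obtained from the word $\varphi_{\sigma(1)+1}\cdots\varphi_{\sigma(p-q-1)+1}$ by inserting $q$ letters $R_{ij}$ at arbitrary places (before the first letter, between letters, after the last letter; several at one place are allowed). For such a word $w$ let $a_{ij}(w)$ be the number of its letters $R_{ij}$. Define $\omega_{p-q}\in\Omega^{p+q}(NG(p-q))$ by $$\omega_{p-q}=\frac{1}{(p-1)!}\Big(\frac1{2\pi i}\Big)^p(-1)^{(p-q)(p-q-1)/2}\;\mathrm{tr}\sum_{\sigma\in\mathfrak S_{p-q-1}}\mathrm{sgn}(\sigma)\sum_{w\in\mathcal H_q(\sigma)}\Big(\int_{\Delta^{p-q}}\prod_{i<j}(t_{i-1}t_{j-1})^{a_{ij}(w)}dt_1\cdots dt_{p-q}\Big)\,\varphi_1\wedge w .$$ **Theorem.** There is exactly one simplicial $2p$-form $\phi$ on $NG$ with $\gamma^*\phi=\frac1{p!}\mathrm{tr}\big((-\Omega/2\pi i)^p\big)$. The cochain $\omega_1+\dots+\omega_p\in\Omega^{2p}(NG)$, with component $\omega_{p-q}$ in $\Omega^{p+q}(NG(p-q))$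 for $0\le q\le p-1$ and all other components zero, equals $I_\Delta(\phi)$; it is a cocycle of the total complex, and its cohomology class is the $p$-th Chern character $\mathrm{ch}_p$. -/

import Mathlib

open scoped ContDiff

noncomputable section

namespace BSS

/-! ### The exterior algebra of alternating forms with values in an algebra -/

section Pointwise

variable {V : Type*} [NormedAddCommGroup V] [NormedSpace ℝ V]
variable {A : Type*} [NormedRing A] [NormedAlgebra ℝ A]

/-- The multilinear map `(v₀, …, v_{m-1}) ↦ α (v₀, …, v_{k-1}) * β (v_k, …, v_{m-1})`,
where `m = k + l`. -/
def mulMultilinear {k l m : ℕ} (h : k + l = m) (α : V [⋀^Fin k]→L[ℝ] A)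
    (β : V [⋀^Fin l]→L[ℝ] A) : ContinuousMultilinearMap ℝ (fun _ : Fin m => V) A where
  toMultilinearMap :=
    ((LinearMap.mul' ℝ A).compMultilinearMap
      (MultilinearMap.domCoprod α.toMultilinearMap β.toMultilinearMap)).domDomCongr
        (finSumFinEquiv.trans (finCongr h))
  cont := by
    have : Continuous fun v : Fin m → V =>
        α (fun i => v (finCongr h (Fin.castAdd l i))) *
          β (fun j => v (finCongr h (Fin.natAdd k j))) := by
      fun_prop
    exact this

theorem mulMultilinear_apply {k l m : ℕ} (h : k + l = m) (α : V [⋀^Fin k]→L[ℝ] A)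
    (β : V [⋀^Fin l]→L[ℝ] A) (v : Fin m → V) :
    mulMultilinear h α β v =
      α (fun i => v (Fin.cast h (Fin.castAdd l i))) *
        β (fun j => v (Fin.cast h (Fin.natAdd k j))) := rfl

/-- The wedge product of an `A`-valued `k`-form and an `A`-valued `l`-form, in degree `m = k + l`
(and `0` in any other degree):
`(α ∧ β) (v) = 1 / (k! l!) ∑_σ sgn σ α (v_{σ 0}, …, v_{σ (k-1)}) β (v_{σ k}, …, v_{σ (m-1)})`. -/
def wedge (m : ℕ) {k l : ℕ} (α : V [⋀^Fin k]→L[ℝ] A) (β : V [⋀^Fin l]→L[ℝ] A) :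
    V [⋀^Fin m]→L[ℝ] A :=
  if h : k + l = m then
    ((k.factorial * l.factorial : ℝ)⁻¹) •
      ContinuousMultilinearMap.alternatization (mulMultilinear h α β)
  else 0

/-- Inhomogeneous `A`-valued alternating forms on `V`: the degree-`k` component for every `k`. -/
abbrev FormAlg (V : Type*) [NormedAddCommGroup V] [NormedSpace ℝ V]
    (A : Type*) [NormedRing A] [NormedAlgebra ℝ A] : Type _ :=
  ∀ k : ℕ, V [⋀^Fin k]→L[ℝ] A

namespace FormAlg

/-- The form of degree `k` regarded as an inhomogeneous form. -/
def of {k : ℕ} (w : V [⋀^Fin k]→L[ℝ] A) : FormAlg V A := Pi.single k w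

/-- A linear map `V → A` regarded as a `1`-form. -/
def ofLin (a : V →L[ℝ] A) : FormAlg V A :=
  of (ContinuousAlternatingMap.ofSubsingleton ℝ V A (0 : Fin 1) a)

/-- The constant `0`-form `1`. -/
def one : FormAlg V A := of (ContinuousAlternatingMap.constOfIsEmpty ℝ V (Fin 0) (1 : A))

/-- The wedge product of inhomogeneous forms. -/
def mul (α β : FormAlg V A) : FormAlg V A := fun m =>
  ∑ ij ∈ Finset.HasAntidiagonal.antidiagonal m, wedge m (α ij.1) (β ij.2)

/-- Wedge powers. -/
def pow (α : FormAlg V A) : ℕ → FormAlg V A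
  | 0 => one
  | p + 1 => mul (pow α p) α

/-- The wedge product of a list of forms, in the order of the list. -/
def prod (l : List (FormAlg V A)) : FormAlg V A := l.foldr mul one

end FormAlg

end Pointwise

/-! ### Complex-valued differential forms on subsets of normed spaces -/

section Forms

variable {V : Type*} [NormedAddCommGroup V] [NormedSpace ℝ V]
variable {W : Type*} [NormedAddCommGroup W] [NormedSpace ℝ W]

/-- `Ω^k(S)`: the smooth complex-valued differential `k`-forms on `S ⊆ V`, each represented by its
extension by zero to `V` (so that two forms are equal iff they agree on `S`). It is used for open
sets `S` and for products of a closed simplex with an open set. -/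
def forms (S : Set V) (k : ℕ) : Submodule ℂ (V → V [⋀^Fin k]→L[ℝ] ℂ) where
  carrier := {w | ContDiffOn ℝ ∞ w S ∧ ∀ x, x ∉ S → w x = 0}
  add_mem' := by
    rintro a b ⟨ha, ha'⟩ ⟨hb, hb'⟩
    exact ⟨ha.add hb, fun x hx => by simp [ha' x hx, hb' x hx]⟩
  zero_mem' := ⟨contDiffOn_const, fun _ _ => rfl⟩
  smul_mem' := by
    rintro c a ⟨ha, ha'⟩
    exact ⟨ha.const_smul c, fun x hx => by simp [ha' x hx]⟩

/-- The exterior derivative `d : Ω^k(S) → Ω^{k+1}(S)`. -/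
def extD (S : Set V) (hS : UniqueDiffOn ℝ S) (k : ℕ) : forms S k →ₗ[ℂ] forms S (k + 1) where
  toFun w := ⟨S.indicator (extDerivWithin (w : V → V [⋀^Fin k]→L[ℝ] ℂ) S), by
    refine ⟨?_, fun x hx => Set.indicator_of_notMem hx _⟩
    have h1 : ContDiffOn ℝ ∞ (extDerivWithin (w : V → V [⋀^Fin k]→L[ℝ] ℂ) S) S :=
      (ContinuousAlternatingMap.alternatizeUncurryFinCLM ℝ V ℂ).contDiff.comp_contDiffOn
        (w.2.1.fderivWithin hS (by simp))
    exact h1.congr fun x hx => Set.indicator_of_mem hx _⟩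
  map_add' a b := by
    ext1
    funext x
    by_cases hx : x ∈ S
    · simp only [Submodule.coe_add, Pi.add_apply, Set.indicator_of_mem hx]
      exact extDerivWithin_add (hS x hx) ((a.2.1 x hx).differentiableWithinAt (by simp))
        ((b.2.1 x hx).differentiableWithinAt (by simp))
    · simp [Set.indicator_of_notMem hx]
  map_smul' c a := by
    ext1
    funext x
    by_cases hx : x ∈ S
    · have : fderivWithin ℝ (c • (a : V → V [⋀^Fin k]→L[ℝ] ℂ)) S x
          = c • fderivWithin ℝ (a : V → V [⋀^Fin k]→L[ℝ] ℂ) S x :=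
        fderivWithin_const_smul (hS x hx) ((a.2.1 x hx).differentiableWithinAt (by simp)) c
      simp only [RingHom.id_apply, Submodule.coe_smul, Pi.smul_apply, Set.indicator_of_mem hx,
        extDerivWithin, this]
      ext v
      simp [ContinuousAlternatingMap.alternatizeUncurryFin_apply, Finset.mul_sum]
    · simp only [Set.indicator_of_notMem hx, Submodule.coe_smul, Pi.smul_apply, RingHom.id_apply]
      exact (smul_zero (A := V [⋀^Fin _]→L[ℝ] ℂ) c).symm

/-- The pullback `f^* w` of a form along a map `f`, as a form on `S` (extended by zero). -/
def pullback (S : Set V) (f : V → W) (k : ℕ) :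
    (W → W [⋀^Fin k]→L[ℝ] ℂ) →ₗ[ℂ] (V → V [⋀^Fin k]→L[ℝ] ℂ) where
  toFun w := S.indicator fun x => (w (f x)).compContinuousLinearMap (fderiv ℝ f x)
  map_add' a b := by
    funext x
    by_cases hx : x ∈ S
    · simp only [Pi.add_apply, Set.indicator_of_mem hx]
      rfl
    · simp [Set.indicator_of_notMem hx]
  map_smul' c a := by
    funext x
    by_cases hx : x ∈ S
    · simp only [Pi.smul_apply, Set.indicator_of_mem hx]
      rfl
    · simp only [Pi.smul_apply, Set.indicator_of_notMem hx]
      exact (smul_zero (A := V [⋀^Fin _]→L[ℝ] ℂ) c).symm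

theorem exists_leftInverse_toContinuousMultilinearMap [FiniteDimensional ℝ V] (k : ℕ) :
    ∃ L : ContinuousMultilinearMap ℝ (fun _ : Fin k => V) ℂ →L[ℝ] V [⋀^Fin k]→L[ℝ] ℂ,
      ∀ w : V [⋀^Fin k]→L[ℝ] ℂ, L w.toContinuousMultilinearMap = w := by
  have : FiniteDimensional ℝ (ContinuousMultilinearMap ℝ (fun _ : Fin k => V) ℂ) :=
    Module.Finite.of_injective
      (ContinuousMultilinearMap.toMultilinearMapLinear :
        ContinuousMultilinearMap ℝ (fun _ : Fin k => V) ℂ →ₗ[ℝ] _)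
      ContinuousMultilinearMap.toMultilinearMap_injective
  have hinj : Function.Injective
      (ContinuousAlternatingMap.toContinuousMultilinearMapLinear :
        (V [⋀^Fin k]→L[ℝ] ℂ) →ₗ[ℝ] ContinuousMultilinearMap ℝ (fun _ : Fin k => V) ℂ) := ContinuousAlternatingMap.toContinuousMultilinearMap_injective
  obtain ⟨L, hL⟩ := LinearMap.exists_leftInverse_of_injective _ (LinearMap.ker_eq_bot.2 hinj)
  exact ⟨LinearMap.toContinuousLinearMap L, fun w => LinearMap.congr_fun hL w⟩

theorem pullback_apply (S : Set V) (f : V → W) (k : ℕ) (w : W → W [⋀^Fin k]→L[ℝ] ℂ) :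
    pullback S f k w =
      S.indicator fun x => (w (f x)).compContinuousLinearMap (fderiv ℝ f x) := rfl

theorem pullback_mem [FiniteDimensional ℝ V] {S : Set V} {T : Set W} {f : V → W} {k : ℕ}
    (hf : ContDiff ℝ ∞ f) (hST : Set.MapsTo f S T) {w : W → W [⋀^Fin k]→L[ℝ] ℂ}
    (hw : w ∈ forms T k) : pullback S f k w ∈ forms S k := by
  rw [pullback_apply]
  refine ⟨?_, fun x hx => Set.indicator_of_notMem hx _⟩
  suffices h : ContDiffOn ℝ ∞
      (fun x => (w (f x)).compContinuousLinearMap (fderiv ℝ f x)) S from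
    h.congr fun x hx => Set.indicator_of_mem hx _
  obtain ⟨L, hL⟩ := exists_leftInverse_toContinuousMultilinearMap (V := V) k
  have h1 : ContDiffOn ℝ ∞ (fun x => ContinuousAlternatingMap.toContinuousMultilinearMapCLM
      (𝕜 := ℝ) (E := W) (F := ℂ) (ι := Fin k) ℝ (w (f x))) S :=
    (ContinuousLinearMap.contDiff _).comp_contDiffOn
      (hw.1.comp hf.contDiffOn hST)
  have h2 : ContDiff ℝ ∞ (fun x =>
      ContinuousMultilinearMap.compContinuousLinearMapContinuousMultilinear ℝ
        (fun _ : Fin k => V) (fun _ => W) ℂ (fun _ => fderiv ℝ f x)) :=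
    (ContinuousMultilinearMap.contDiff _).comp
      (contDiff_pi.2 fun _ => hf.fderiv_right (by simp))
  have h3 := L.contDiff.comp_contDiffOn (h2.contDiffOn.clm_apply h1)
  refine h3.congr fun x _ => ?_
  exact (hL _).symm

/-- The pullback `f^* : Ω^k(T) → Ω^k(S)` along a smooth map `f` with `f(S) ⊆ T`. -/
def pullbackForms [FiniteDimensional ℝ V] (S : Set V) (T : Set W) (f : V → W)
    (hf : ContDiff ℝ ∞ f) (hST : Set.MapsTo f S T) (k : ℕ) : forms T k →ₗ[ℂ] forms S k :=
  (pullback S f k).restrict fun _ hw => pullback_mem hf hST hw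

end Forms

/-! ### The simplicial manifold `NG` for `G = GL(n, ℂ)` and its de Rham double complex -/

section Nerve

/-- The algebra of complex `n × n` matrices, with the operator norm for the sup norm on `ℂⁿ`
(the choice of the norm does not matter). -/
def Mat (n : ℕ) : Type := Matrix (Fin n) (Fin n) ℂ

instance Mat.instNormedRing (n : ℕ) : NormedRing (Mat n) :=
  Matrix.linftyOpNormedRing (n := Fin n) (α := ℂ)

instance (n : ℕ) : NormedAlgebra ℂ (Mat n) :=
  Matrix.linftyOpNormedAlgebra (n := Fin n) (α := ℂ) (R := ℂ)

instance (n : ℕ) : FiniteDimensional ℂ (Mat n) :=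
  inferInstanceAs (Module.Finite ℂ (Matrix (Fin n) (Fin n) ℂ))

instance (n : ℕ) : CompleteSpace (Mat n) := FiniteDimensional.complete ℂ (Mat n)

/-- The trace of a matrix. -/
def tr (n : ℕ) : Mat n →L[ℂ] ℂ :=
  LinearMap.toContinuousLinearMap
    { toFun := fun a => Matrix.trace (show Matrix (Fin n) (Fin n) ℂ from a)
      map_add' := fun a b => Matrix.trace_add (R := ℂ) (n := Fin n) a b
      map_smul' := fun c a => Matrix.trace_smul (R := ℂ) (n := Fin n) c a }

theorem tr_apply {n : ℕ} (a : Mat n) : tr n a = ∑ i, (a : Matrix (Fin n) (Fin n) ℂ) i i := rfl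

theorem tr_mul_comm {n : ℕ} (a b : Mat n) : tr n (a * b) = tr n (b * a) :=
  Matrix.trace_mul_comm (R := ℂ) (m := Fin n) (n := Fin n) a b

attribute [irreducible] Mat.instNormedRing

/-- `G^r` for `G = GL(n, ℂ)`, as an open subset of the vector space of `r`-tuples of matrices.
The manifold `NG(r)` is `G^r`, and the manifold `N\bar{G}(r)` is `G^{r+1}`. -/
def GPow (n r : ℕ) : Set (Fin r → Mat n) := {h | ∀ i, IsUnit (h i)}

theorem isOpen_GPow (n r : ℕ) : IsOpen (GPow n r) := by
  have : GPow n r = Set.pi Set.univ fun _ => {a : Mat n | IsUnit a} := by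
    ext h; simp [GPow]
  rw [this]
  exact isOpen_set_pi Set.finite_univ fun _ _ => Units.isOpen

/-- The face operators `ε_i : NG(r+1) → NG(r)`, `0 ≤ i ≤ r+1`:
`ε_0 (h_1, …, h_{r+1}) = (h_2, …, h_{r+1})`, `ε_{r+1} (h_1, …, h_{r+1}) = (h_1, …, h_r)`, and
`ε_i (h_1, …, h_{r+1}) = (h_1, …, h_i h_{i+1}, …, h_{r+1})` otherwise.
(The entry `h_j` is `h (j - 1)` in the code.) -/
def face (n : ℕ) {r : ℕ} (i : Fin (r + 2)) (h : Fin (r + 1) → Mat n) : Fin r → Mat n := fun j =>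
  if (j : ℕ) + 1 < i then h j.castSucc
  else if (j : ℕ) + 1 = i then h j.castSucc * h j.succ
  else h j.succ

theorem contDiff_face (n : ℕ) {r : ℕ} (i : Fin (r + 2)) : ContDiff ℝ ∞ (face n i) := by
  refine contDiff_pi.2 fun j => ?_
  unfold face
  split_ifs
  · exact contDiff_apply ℝ (Mat n) _
  · exact (contDiff_apply ℝ (Mat n) _).mul (contDiff_apply ℝ (Mat n) _)
  · exact contDiff_apply ℝ (Mat n) _

theorem mapsTo_face (n : ℕ) {r : ℕ} (i : Fin (r + 2)) :
    Set.MapsTo (face n i) (GPow n (r + 1)) (GPow n r) := by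
  intro h hh j
  unfold face
  split_ifs
  · exact hh _
  · exact (hh _).mul (hh _)
  · exact hh _

/-- The double complex `Ω^{r,s}(NG) = Ω^s(NG(r))`, all bidegrees together. -/
def DoubleComplex (n : ℕ) : Type := ∀ r s : ℕ, forms (GPow n r) s

instance (n : ℕ) : AddCommGroup (DoubleComplex n) :=
  inferInstanceAs (AddCommGroup (∀ r s : ℕ, forms (GPow n r) s))

instance (n : ℕ) : Module ℂ (DoubleComplex n) :=
  inferInstanceAs (Module ℂ (∀ r s : ℕ, forms (GPow n r) s))

/-- The component of a cochain in `Ω^s(NG(r))`. -/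
def proj (n r s : ℕ) : DoubleComplex n →ₗ[ℂ] forms (GPow n r) s where
  toFun c := c r s
  map_add' _ _ := rfl
  map_smul' _ _ := rfl

/-- The component in bidegree `(r, s)` of `d' = ∑_i (-1)^i ε_i^*`. -/
def dPrime (n : ℕ) : ∀ r s : ℕ, DoubleComplex n →ₗ[ℂ] forms (GPow n r) s
  | 0, _ => 0
  | r + 1, s => ∑ i : Fin (r + 2), (-1 : ℂ) ^ (i : ℕ) •
      (pullbackForms (GPow n (r + 1)) (GPow n r) (face n i) (contDiff_face n i) (mapsTo_face n i) s ∘ₗ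
        proj n r s)

/-- The component in bidegree `(r, s)` of `d'' = (-1)^r d`. -/
def dDoublePrime (n : ℕ) : ∀ r s : ℕ, DoubleComplex n →ₗ[ℂ] forms (GPow n r) s
  | _, 0 => 0
  | r, s + 1 => (-1 : ℂ) ^ r •
      (extD (GPow n r) (isOpen_GPow n r).uniqueDiffOn s ∘ₗ proj n r s)

/-- The total differential `d' + d''`. -/
def totalD (n : ℕ) : DoubleComplex n →ₗ[ℂ] DoubleComplex n :=
  { toFun := fun c r s => dPrime n r s c + dDoublePrime n r s c
    map_add' := fun a b => by
      funext r s
      rw [map_add, map_add]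
      exact add_add_add_comm _ _ _ _
    map_smul' := fun z a => by
      funext r s
      rw [map_smul, map_smul]
      exact (smul_add z _ _).symm }

/-- `Ω^N(NG) = ⨁_{r+s=N} Ω^s(NG(r))`: the cochains of total degree `N`. -/
def totalDegree (n N : ℕ) : Submodule ℂ (DoubleComplex n) :=
  ⨅ (r : ℕ) (s : ℕ) (_ : r + s ≠ N), LinearMap.ker (proj n r s)

theorem mem_totalDegree {n N : ℕ} {c : DoubleComplex n} :
    c ∈ totalDegree n N ↔ ∀ r s, r + s ≠ N → c r s = 0 := by
  simp only [totalDegree, Submodule.mem_iInf, LinearMap.mem_ker]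
  rfl

/-- The cocycles of degree `N` of the total complex `Ω^*(NG)`. -/
def cocycles (n N : ℕ) : Submodule ℂ (DoubleComplex n) :=
  totalDegree n N ⊓ LinearMap.ker (totalD n)

/-- The coboundaries of degree `N` of the total complex `Ω^*(NG)`. -/
def coboundaries (n : ℕ) : ℕ → Submodule ℂ (DoubleComplex n)
  | 0 => ⊥
  | N + 1 => (totalDegree n N).map (totalD n)

/-- The cohomology `H^N(Ω^*(NG))`, which is `H^N(BG; ℂ)`. -/
abbrev Cohomology (n N : ℕ) : Type :=
  cocycles n N ⧸ (coboundaries n N).submoduleOf (cocycles n N)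

/-- The class of a cocycle in `H^N(Ω^*(NG))`. -/
def cohomologyClass (n N : ℕ) (c : cocycles n N) : Cohomology n N :=
  Submodule.Quotient.mk c

end Nerve

/-! ### Simplicial forms, integration over the simplex -/

section Simplicial

/-- The standard simplex `Δ^r`, in the coordinates `(t_1, …, t_r)`. -/
def simplex (r : ℕ) : Set (Fin r → ℝ) := {t | (∀ i, 0 ≤ t i) ∧ ∑ i, t i ≤ 1}

/-- The barycentric coordinates `(t_0, t_1, …, t_r)`, where `t_0 = 1 - t_1 - ⋯ - t_r`. -/
def bary {r : ℕ} (t : Fin r → ℝ) : Fin (r + 1) → ℝ :=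
  Fin.cons (α := fun _ => ℝ) (1 - ∑ i, t i) t

/-- The face maps `ε^i : Δ^r → Δ^{r+1}`: insert `0` as the `i`-th barycentric coordinate. -/
def coface {r : ℕ} (i : Fin (r + 2)) (t : Fin r → ℝ) : Fin (r + 1) → ℝ :=
  Fin.tail (α := fun _ => ℝ) (Fin.insertNth (α := fun _ => ℝ) i 0 (bary t))

/-- The ambient vector space of `Δ^m × G^r`. -/
abbrev Ambient (n m r : ℕ) : Type := (Fin m → ℝ) × (Fin r → Mat n)

/-- `Δ^m × G^r`. -/
def simplexTimes (n m r : ℕ) : Set (Ambient n m r) := simplex m ×ˢ GPow n r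

/-- A sequence `φ^{(m)}` of (not necessarily smooth) `N`-forms on `Δ^m × NG(m)`. -/
abbrev FormSeq (n N : ℕ) : Type :=
  ∀ m : ℕ, Ambient n m m → Ambient n m m [⋀^Fin N]→L[ℝ] ℂ

/-- `φ` is a simplicial `N`-form on `NG`: each `φ^{(m)}` is a smooth `N`-form on `Δ^m × NG(m)`, and
`(ε^i × id)^* φ^{(m+1)} = (id × ε_i)^* φ^{(m)}` on `Δ^m × NG(m+1)`. -/
def IsSimplicialForm (n N : ℕ) (φ : FormSeq n N) : Prop :=
  (∀ m, φ m ∈ forms (simplexTimes n m m) N) ∧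
  ∀ (m : ℕ) (i : Fin (m + 2)),
    pullback (simplexTimes n m (m + 1))
        (fun x : Ambient n m (m + 1) => ((coface i x.1, x.2) : Ambient n (m + 1) (m + 1))) N
        (φ (m + 1)) =
      pullback (simplexTimes n m (m + 1))
        (fun x : Ambient n m (m + 1) => ((x.1, face n i x.2) : Ambient n m m)) N (φ m)

theorem contract_aux {n r k s N : ℕ} (h : r + s = N) [DecidableEq (Fin s)]
    (v : Fin s → Fin k → Mat n) (i : Fin s) (x : Fin k → Mat n) :
    (fun a : Fin N => Fin.append (fun i : Fin r => ((Pi.single i 1, 0) : Ambient n r k))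
      (fun j : Fin s => ((0, Function.update v i x j) : Ambient n r k)) (Fin.cast h.symm a)) =
    Function.update (fun a : Fin N => Fin.append
      (fun i : Fin r => ((Pi.single i 1, 0) : Ambient n r k))
      (fun j : Fin s => ((0, v j) : Ambient n r k)) (Fin.cast h.symm a))
      (Fin.cast h (Fin.natAdd r i)) (0, x) := by
  subst h
  funext a
  refine Fin.addCases (fun b => ?_) (fun b => ?_) a
  · rw [Function.update_of_ne]
    · simp
    · simp only [Fin.cast_eq_self, ne_eq, Fin.ext_iff, Fin.val_castAdd, Fin.val_natAdd]
      omega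
  · by_cases hb : b = i
    · subst hb
      simp
    · rw [Function.update_of_ne]
      · simp [Function.update_of_ne hb]
      · simpa [Fin.ext_iff] using hb

/-- The contraction of an `N`-form, `N = r + s`, with the coordinate vector fields
`∂/∂t_1, …, ∂/∂t_r` of the simplex (in the first `r` slots), restricted to vectors tangent to the
second factor. -/
def contract {n r k s N : ℕ} (h : r + s = N) (w : Ambient n r k [⋀^Fin N]→L[ℝ] ℂ) :
    (Fin k → Mat n) [⋀^Fin s]→L[ℝ] ℂ :=
  { toFun := fun v => w fun a => Fin.append
      (fun i : Fin r => ((Pi.single i 1, 0) : Ambient n r k))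
      (fun j : Fin s => ((0, v j) : Ambient n r k)) (Fin.cast h.symm a)
    map_update_add' := by
      intro inst v i x y
      rw [contract_aux h v i (x + y), contract_aux h v i x, contract_aux h v i y, ← w.map_update_add]
      simp
    map_update_smul' := by
      intro inst v i c x
      rw [contract_aux h v i (c • x), contract_aux h v i x, ← w.map_update_smul]
      simp
    map_eq_zero_of_eq' := by
      intro v i j hv hij
      refine w.map_eq_zero_of_eq (i := Fin.cast h (Fin.natAdd r i))
        (j := Fin.cast h (Fin.natAdd r j)) _ ?_ ?_
      · simp [hv]
      · simpa [Fin.ext_iff] using hij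
    cont := by
      refine w.toContinuousMultilinearMap.cont.comp (continuous_pi fun a => ?_)
      generalize Fin.cast h.symm a = b
      refine Fin.addCases (fun i => ?_) (fun j => ?_) b
      · simpa only [Fin.append_left] using
          (continuous_const : Continuous fun _ : Fin s → Fin k → Mat n =>
            ((Pi.single i 1, 0) : Ambient n r k))
      · simp only [Fin.append_right]
        fun_prop }

/-- Integration along `Δ^r` of an `N`-form on `Δ^r × G^k`: in degree `s`, where `r + s = N`,
`dt_1 ∧ ⋯ ∧ dt_r ∧ η ↦ ∫_{Δ^r} η dt_1 ⋯ dt_r`, and `0` in all other degrees. -/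
def fiberIntegral {n r k N : ℕ} (s : ℕ) (w : Ambient n r k → Ambient n r k [⋀^Fin N]→L[ℝ] ℂ)
    (h : Fin k → Mat n) : (Fin k → Mat n) [⋀^Fin s]→L[ℝ] ℂ :=
  if e : r + s = N then ∫ t in simplex r, contract e (w (t, h)) else 0

/-- `c = I_Δ(φ)`. -/
def IsIntegralOf {n N : ℕ} (c : DoubleComplex n) (φ : FormSeq n N) : Prop :=
  ∀ r s, (c r s : (Fin r → Mat n) → (Fin r → Mat n) [⋀^Fin s]→L[ℝ] ℂ) = fiberIntegral s (φ r)

end Simplicial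

/-! ### The canonical connection and the Chern character form -/

section ChernWeil

/-- The map `γ : N\bar{G}(m) → NG(m)`,
`γ(g_0, …, g_m) = (g_0 g_1⁻¹, …, g_{m-1} g_m⁻¹)`. -/
def gamma (n : ℕ) {m : ℕ} (g : Fin (m + 1) → Mat n) : Fin m → Mat n := fun j =>
  g j.castSucc * Ring.inverse (g j.succ)

/-- The form `θ_i` on `Δ^m × N\bar{G}(m)`: the pullback of the Maurer-Cartan form `g⁻¹ dg` under
the projection to the `i`-th factor of `N\bar{G}(m) = G^{m+1}`. -/
def maurerCartan (n m : ℕ) (i : Fin (m + 1)) (x : Ambient n m (m + 1)) :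
    Ambient n m (m + 1) →L[ℝ] Mat n :=
  ContinuousLinearMap.mul ℝ (Mat n) (Ring.inverse (x.2 i)) ∘L ContinuousLinearMap.proj i ∘L
    ContinuousLinearMap.snd ℝ (Fin m → ℝ) (Fin (m + 1) → Mat n)

/-- Dupont's connection form `θ = t_0 θ_0 + ⋯ + t_m θ_m` on `Δ^m × N\bar{G}(m)`. -/
def connection (n m : ℕ) (x : Ambient n m (m + 1)) : Ambient n m (m + 1) [⋀^Fin 1]→L[ℝ] Mat n :=
  ContinuousAlternatingMap.ofSubsingleton ℝ (Ambient n m (m + 1)) (Mat n) (0 : Fin 1)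
    (∑ i, bary x.1 i • maurerCartan n m i x)

/-- The bracket of matrix-valued `1`-forms, `[α, β] = α ∧ β + β ∧ α`. -/
def bracket {V : Type*} [NormedAddCommGroup V] [NormedSpace ℝ V] {n : ℕ}
    (α β : V [⋀^Fin 1]→L[ℝ] Mat n) : V [⋀^Fin 2]→L[ℝ] Mat n :=
  wedge 2 α β + wedge 2 β α

/-- The exterior derivative `dθ`. -/
def dConnection (n m : ℕ) (x : Ambient n m (m + 1)) : Ambient n m (m + 1) [⋀^Fin 2]→L[ℝ] Mat n :=
  extDerivWithin (connection n m) (simplexTimes n m (m + 1)) x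

/-- The curvature `Ω = dθ + 1/2 [θ, θ]`. -/
def curvature (n m : ℕ) (x : Ambient n m (m + 1)) : Ambient n m (m + 1) [⋀^Fin 2]→L[ℝ] Mat n :=
  dConnection n m x + (1 / 2 : ℝ) • bracket (connection n m x) (connection n m x)

/-- The trace, as a map from matrix-valued to complex-valued alternating forms. -/
def traceForm {V : Type*} [NormedAddCommGroup V] [NormedSpace ℝ V] {n k : ℕ}
    (w : V [⋀^Fin k]→L[ℝ] Mat n) : V [⋀^Fin k]→L[ℝ] ℂ :=
  ((tr n).restrictScalars ℝ).compContinuousAlternatingMap w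

/-- The `p`-th Chern character form `(1 / p!) tr ((-Ω / 2πi)^p)` on `Δ^m × N\bar{G}(m)`. -/
def chernForm (n p m : ℕ) :
    Ambient n m (m + 1) → Ambient n m (m + 1) [⋀^Fin (2 * p)]→L[ℝ] ℂ :=
  (simplexTimes n m (m + 1)).indicator fun x =>
    (1 / (p.factorial : ℂ)) •
      traceForm (FormAlg.pow
        (FormAlg.of ((-(1 / (2 * Real.pi * Complex.I)) : ℂ) • curvature n m x)) p (2 * p))

/-- `φ` is the simplicial `2p`-form on `NG` defined by the Chern character form: it is a simplicial
form with `γ^* φ = (1 / p!) tr ((-Ω / 2πi)^p)`. -/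
def IsChernCharacterForm (n p : ℕ) (φ : FormSeq n (2 * p)) : Prop :=
  IsSimplicialForm n (2 * p) φ ∧
  ∀ m, pullback (simplexTimes n m (m + 1))
    (fun x : Ambient n m (m + 1) => ((x.1, gamma n x.2) : Ambient n m m)) (2 * p) (φ m) =
      chernForm n p m

/-- `x` is the `p`-th Chern character `ch_p ∈ H^{2p}(Ω^*(NG))`: the image `[I_Δ(P(Ω))]` of the
invariant polynomial `P(X) = (1 / p!) tr ((-X / 2πi)^p)` under the universal Chern-Weil
homomorphism. -/
def IsChernCharacter (n p : ℕ) (x : Cohomology n (2 * p)) : Prop :=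
  ∃ (φ : FormSeq n (2 * p)) (c : cocycles n (2 * p)),
    IsChernCharacterForm n p φ ∧ IsIntegralOf (c : DoubleComplex n) φ ∧
      x = cohomologyClass n (2 * p) c

end ChernWeil

/-! ### The explicit formula -/

section Formula

/-- The form `φ_s = h_1 ⋯ h_{s-1} dh_s h_s⁻¹ ⋯ h_1⁻¹` at the point `h` of `NG(r)`.
(The index `s = 1, …, r` is `s - 1` in the code.) -/
def phi {n r : ℕ} (h : Fin r → Mat n) (s : Fin r) : (Fin r → Mat n) →L[ℝ] Mat n :=
  ContinuousLinearMap.mulLeftRight ℝ (Mat n)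
      ((List.ofFn h).take (s : ℕ)).prod (Ring.inverse ((List.ofFn h).take ((s : ℕ) + 1)).prod) ∘L
    ContinuousLinearMap.proj s

/-- The index pairs `i < j` of the forms `R_{ij}`, `1 ≤ i < j ≤ k + 2` (shifted by one in the
code). -/
abbrev Pair (k : ℕ) : Type := {ij : Fin (k + 2) × Fin (k + 2) // ij.1 < ij.2}

/-- The form `R_{ij} = (φ_i + φ_{i+1} + ⋯ + φ_{j-1})²` at the point `h` of `NG(k+1)`. -/
def R {n k : ℕ} (h : Fin (k + 1) → Mat n) (ij : Pair k) : FormAlg (Fin (k + 1) → Mat n) (Mat n) :=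
  FormAlg.pow (FormAlg.ofLin
    (∑ s : Fin (k + 1) with ij.1.1 ≤ s.castSucc ∧ s.castSucc < ij.1.2, phi h s)) 2

/-- The letters of the words below: `Sum.inl a`, `a = 0, …, k - 1`, stands for the form
`φ_{a+2}`, and `Sum.inr ij` for the form `R_{ij}`. -/
abbrev Letter (k : ℕ) : Type := Fin k ⊕ Pair k

/-- The form that a letter stands for. -/
def letterForm {n k : ℕ} (h : Fin (k + 1) → Mat n) :
    Letter k → FormAlg (Fin (k + 1) → Mat n) (Mat n)
  | Sum.inl a => FormAlg.ofLin (phi h a.succ)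
  | Sum.inr ij => R h ij

/-- The words obtained from `φ_{σ(1)+1} ⋯ φ_{σ(k)+1}` by inserting `q` letters `R_{ij}` at arbitrary
places, possibly several at the same place: the words of length `k + q` from which
`φ_{σ(1)+1} ⋯ φ_{σ(k)+1}` remains when all letters `R_{ij}` are erased. -/
def insertions {k : ℕ} (q : ℕ) (σ : Equiv.Perm (Fin k)) : Finset (Fin (k + q) → Letter k) :=
  Finset.univ.filter fun u => (List.ofFn u).filterMap Sum.getLeft? = List.ofFn σ

/-- `a_{ij}`: the number of letters `R_{ij}` in a word. -/
def count {k l : ℕ} (u : Fin l → Letter k) (ij : Pair k) : ℕ :=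
  (Finset.univ.filter fun b => u b = Sum.inr ij).card

/-- The coefficient `∫_{Δ^{k+1}} ∏_{i<j} (t_{i-1} t_{j-1})^{a_{ij}} dt_1 ⋯ dt_{k+1}` of a word. -/
def coefficient {k l : ℕ} (u : Fin l → Letter k) : ℝ :=
  ∫ t in simplex (k + 1), ∏ ij : Pair k, (bary t ij.1.1 * bary t ij.1.2) ^ count u ij

/-- The form of degree `p + q` on `NG(k+1)`, where `k + 1 = p - q`,
`1/(p-1)! (1/2πi)^p (-1)^{(p-q)(p-q-1)/2} tr ∑ (φ_1 ∧ H_q(S_{p-q}) ∫ ∏ (t_{i-1} t_{j-1})^{a_{ij}})`,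
the sum being over all terms of `S_{p-q}` (with their signs) and all insertions of `q` of the forms
`R_{ij}` in them. -/
def component (n p q k : ℕ) :
    (Fin (k + 1) → Mat n) → (Fin (k + 1) → Mat n) [⋀^Fin (p + q)]→L[ℝ] ℂ :=
  (GPow n (k + 1)).indicator fun h =>
    ((1 / ((p - 1).factorial : ℂ)) * (1 / (2 * Real.pi * Complex.I)) ^ p *
        (-1) ^ ((k + 1) * k / 2)) •
      traceForm (∑ σ : Equiv.Perm (Fin k), ∑ u ∈ insertions q σ,
        ((((Equiv.Perm.sign σ : ℤ) : ℝ) * coefficient u) •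
          FormAlg.mul (FormAlg.ofLin (phi h 0))
            (FormAlg.prod ((List.ofFn u).map (letterForm h)))) (p + q))

end Formula

end BSS

end

open scoped ContDiff

noncomputable section

namespace BSS

set_option linter.unusedSectionVars false

/-! ### Wedge products of algebra-valued alternating forms. -/

section WedgeAlgebra

variable {V : Type*} [NormedAddCommGroup V] [NormedSpace ℝ V]
variable {W : Type*} [NormedAddCommGroup W] [NormedSpace ℝ W]
variable {A : Type*} [NormedRing A] [NormedAlgebra ℝ A]
variable {B : Type*} [NormedRing B] [NormedAlgebra ℝ B]

/-! On NG(m) put v_j = h_1⋯h_j, with v_0 = 1, and ψ_j = dv_j v_j⁻¹, so that dψ_j = ψ_j². The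
connection -∑ t_j ψ_j on Δ^m × NG(m) has curvature K = -∑ dt_j ψ_j - ∑ t_j ψ_j² + (∑ t_j ψ_j)², and
the simplicial form φ is (1/p!)(-1/2πi)^p tr K^p at every level. A gauge change ψ_j ↦ u ψ_j u⁻¹ + a
with u and a independent of j leaves tr K^p unchanged, because ∑ t_j = 1 and ∑ dt_j = 0
(`curv_add_const`, `map_trR_curv_gauge`). This is used twice. Along γ the product v_j becomes g_0
g_j⁻¹, so K pulls back to a gauge transform of Ω (`pullback_gamma_nerveChernForm`). Along ε_i the
vertex v_i is dropped and the others acquire a common left factor, while t_i = 0 drops the same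
index on the simplex side (`nerveChernForm_simplicial`). Uniqueness of φ holds because γ has a
smooth section (`pullback_gamma_injective`).

The formula comes from rewriting K. Since ∑ t_j = 1, the part of K without dt is -∑_{i<j} t_i t_j
(ψ_j - ψ_i)², and ψ_j - ψ_i is a sum of consecutive φ_s, so these squares are the R's
(`curv_eq_neg_sum_pairs`, `psi_sub`). Summation by parts turns ∑ dt_j ψ_j into ∑ dτ_s φ_s with dτ_s
= dt_s + ⋯ + dt_m (`sum_scal_mul_lin_psi`). Hence K = -(D + B), where D = dτ_1 φ_1 and B is the sum
of all other letters. Since dτ_1² = 0 and the letters are cyclic under the trace, tr (D + B)^p = tr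
B^p + p tr (D B^{p-1}) (`map_add_pow`). The first term contains no dt_1 and does not survive
integration over the simplex. In the second, B^{p-1} is expanded into words: moving the dτ's to the
front costs the sign (-1)^{(p-q)(p-q-1)/2}, their determinant on the coordinate fields is sgn σ or
zero (`pairing_dtau`), and p/p! = 1/(p-1)!. This is `contract_nerveForm`; integrating the monomials
in t gives the coefficients.

For the cocycle property, the Bianchi identity makes tr K^p closed (`dd_map_curv_pow`). Closedness
is evaluated on the coordinate fields of the simplex together with tangent vectors of the group and
integrated over the simplex. The derivatives along the simplex become face integrals by Stokes,
hence d' by the simplicial identities; the remaining derivatives give d'' (`sum_faces_eq`,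
`totalD_integralCochain`). As φ is unique, so is the resulting class. -/

open Equiv.Perm in
/-- The signed sum of a function of `m` vectors over all permutations of its arguments. -/
def altSum {X M : Type*} [AddCommGroup M] {m : ℕ} (F : (Fin m → X) → M) (v : Fin m → X) : M :=
  ∑ σ : Equiv.Perm (Fin m), (sign σ : ℤ) • F (v ∘ σ)

section AltSum

variable {X M : Type*} [AddCommGroup M] {m : ℕ}

theorem altSum_comp_perm (F : (Fin m → X) → M) (τ : Equiv.Perm (Fin m)) (v : Fin m → X) :
    altSum (fun w => F (w ∘ τ)) v = (Equiv.Perm.sign τ : ℤ) • altSum F v := by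
  unfold altSum
  rw [Finset.smul_sum, ← Equiv.sum_comp (Equiv.mulRight τ)
    (fun σ => (Equiv.Perm.sign τ : ℤ) • (Equiv.Perm.sign σ : ℤ) • F (v ∘ σ))]
  refine Finset.sum_congr rfl fun σ _ => ?_
  have h : (Equiv.Perm.sign τ : ℤ) * (Equiv.Perm.sign τ : ℤ) = 1 := by
    rw [← Units.val_mul, Int.units_mul_self, Units.val_one]
  rw [smul_smul]
  congr 1
  simp only [Equiv.coe_mulRight, Equiv.Perm.sign_mul, Units.val_mul]
  rw [mul_comm, mul_assoc, h, mul_one]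

/-- Every `τ` contributes the same amount: absorbing `j τ` into the outer sum costs its sign, which
cancels the sign in front. Applied to the permutations of one block of arguments, this collapses a
nested alternation to a single one times a factorial. -/
theorem altSum_sum_perm {ι : Type*} [Fintype ι] [DecidableEq ι] (F : (Fin m → X) → M)
    (j : Equiv.Perm ι → Equiv.Perm (Fin m))
    (hj : ∀ τ, Equiv.Perm.sign (j τ) = Equiv.Perm.sign τ) (v : Fin m → X) :
    altSum (fun w => ∑ τ : Equiv.Perm ι, (Equiv.Perm.sign τ : ℤ) • F (w ∘ j τ)) v =
      (Fintype.card ι).factorial • altSum F v := by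
  have h1 : altSum (fun w => ∑ τ : Equiv.Perm ι, (Equiv.Perm.sign τ : ℤ) • F (w ∘ j τ)) v =
      ∑ τ : Equiv.Perm ι, (Equiv.Perm.sign τ : ℤ) • altSum (fun w => F (w ∘ j τ)) v := by
    unfold altSum
    simp only [Finset.smul_sum]
    rw [Finset.sum_comm]
    refine Finset.sum_congr rfl fun σ _ => Finset.sum_congr rfl fun τ _ => ?_
    rw [smul_comm]
  rw [h1]
  have h2 : ∀ τ : Equiv.Perm ι,
      (Equiv.Perm.sign τ : ℤ) • altSum (fun w => F (w ∘ j τ)) v = altSum F v := by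
    intro τ
    rw [altSum_comp_perm, hj, smul_smul, ← Units.val_mul, Int.units_mul_self, Units.val_one,
      one_smul]
  simp [h2, Fintype.card_perm]

end AltSum

theorem wedge_apply {k l m : ℕ} (h : k + l = m) (α : V [⋀^Fin k]→L[ℝ] A)
    (β : V [⋀^Fin l]→L[ℝ] A) (v : Fin m → V) :
    wedge m α β v = ((k.factorial * l.factorial : ℝ)⁻¹) •
      altSum (fun w : Fin m → V => α (fun i => w (Fin.cast h (Fin.castAdd l i))) *
        β (fun j => w (Fin.cast h (Fin.natAdd k j)))) v := by
  rw [wedge, dif_pos h, ContinuousAlternatingMap.smul_apply,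
    ContinuousMultilinearMap.alternatization_apply_apply]
  rfl

theorem wedge_of_ne {k l m : ℕ} (h : k + l ≠ m) (α : V [⋀^Fin k]→L[ℝ] A)
    (β : V [⋀^Fin l]→L[ℝ] A) : wedge m α β = 0 := by
  rw [wedge, dif_neg h]

theorem alternating_apply_perm {k : ℕ} (α : V [⋀^Fin k]→L[ℝ] A) (v : Fin k → V)
    (τ : Equiv.Perm (Fin k)) : (Equiv.Perm.sign τ : ℤ) • α (v ∘ τ) = α v := by
  have := α.toAlternatingMap.map_perm v τ
  simp only [ContinuousAlternatingMap.coe_toAlternatingMap] at this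
  rw [this, Units.smul_def, smul_smul, ← Units.val_mul, Int.units_mul_self, Units.val_one, one_smul]

theorem altSum_alternating {k : ℕ} (α : V [⋀^Fin k]→L[ℝ] A) (v : Fin k → V) :
    altSum α v = k.factorial • α v := by
  unfold altSum
  simp [alternating_apply_perm, Fintype.card_perm, -zsmul_eq_mul]

theorem altSum_mul_left {k l m n : ℕ} (e : Fin k ⊕ Fin l ≃ Fin m)
    (F : (Fin k → V) → A) (G : (Fin l → V) → A) (v : Fin m → V) (hn : n = k.factorial) :
    altSum (fun w : Fin m → V => altSum F (fun i => w (e (Sum.inl i))) *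
      G (fun j => w (e (Sum.inr j)))) v =
    n • altSum (fun w : Fin m → V => F (fun i => w (e (Sum.inl i))) *
      G (fun j => w (e (Sum.inr j)))) v := by
  have := altSum_sum_perm (fun w : Fin m → V => F (fun i => w (e (Sum.inl i))) *
      G (fun j => w (e (Sum.inr j))))
      (fun τ : Equiv.Perm (Fin k) => e.permCongr (Equiv.Perm.sumCongr τ 1))
      (fun τ => by rw [Equiv.Perm.sign_permCongr, Equiv.Perm.sign_sumCongr, Equiv.Perm.sign_one,
        mul_one]) v
  rw [Fintype.card_fin, ← hn] at this
  rw [← this]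
  congr 1
  funext w
  simp [altSum, Finset.sum_mul, Function.comp_def, Equiv.permCongr_apply,
    -zsmul_eq_mul]

theorem altSum_mul_right {k l m n : ℕ} (e : Fin k ⊕ Fin l ≃ Fin m)
    (F : (Fin k → V) → A) (G : (Fin l → V) → A) (v : Fin m → V) (hn : n = l.factorial) :
    altSum (fun w : Fin m → V => F (fun i => w (e (Sum.inl i))) *
      altSum G (fun j => w (e (Sum.inr j)))) v =
    n • altSum (fun w : Fin m → V => F (fun i => w (e (Sum.inl i))) *
      G (fun j => w (e (Sum.inr j)))) v := by
  have := altSum_sum_perm (fun w : Fin m → V => F (fun i => w (e (Sum.inl i))) *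
      G (fun j => w (e (Sum.inr j))))
      (fun τ : Equiv.Perm (Fin l) => e.permCongr (Equiv.Perm.sumCongr 1 τ))
      (fun τ => by rw [Equiv.Perm.sign_permCongr, Equiv.Perm.sign_sumCongr, Equiv.Perm.sign_one,
        one_mul]) v
  rw [Fintype.card_fin, ← hn] at this
  rw [← this]
  congr 1
  funext w
  simp [altSum, Finset.mul_sum, Function.comp_def, Equiv.permCongr_apply,
    -zsmul_eq_mul]

theorem altSum_smul {X M : Type*} [AddCommGroup M] [Module ℝ M] {m : ℕ} (c : ℝ)
    (F : (Fin m → X) → M) (v : Fin m → X) : altSum (fun w => c • F w) v = c • altSum F v := by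
  unfold altSum
  rw [Finset.smul_sum]
  exact Finset.sum_congr rfl fun σ _ => smul_comm _ _ _

theorem altSum_add {X M : Type*} [AddCommGroup M] {m : ℕ}
    (F G : (Fin m → X) → M) (v : Fin m → X) :
    altSum (fun w => F w + G w) v = altSum F v + altSum G v := by
  simp [altSum, Finset.sum_add_distrib]

/-- Both sides are the alternation of `α ⊗ β ⊗ γ` over all permutations, divided by `j! k! l!`: the
outer alternation absorbs the inner one, and the resulting factor `(j + k)!` or `(k + l)!` cancels
against the normalization of the outer wedge. -/
theorem wedge_assoc {j k l a b m : ℕ} (h1 : j + k = a) (h2 : k + l = b) (h3 : a + l = m)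
    (h4 : j + b = m) (α : V [⋀^Fin j]→L[ℝ] A)
    (β : V [⋀^Fin k]→L[ℝ] A) (γ : V [⋀^Fin l]→L[ℝ] A) :
    wedge m (wedge a α β) γ = wedge m α (wedge b β γ) := by
  subst h1 h2
  ext v
  rw [wedge_apply h3, wedge_apply h4]
  simp only [wedge_apply rfl, smul_mul_assoc, mul_smul_comm]
  rw [altSum_smul, altSum_smul]
  have e1 := altSum_mul_left (finSumFinEquiv.trans (finCongr h3))
    (fun w : Fin (j + k) → V => α (fun i => w (Fin.cast rfl (Fin.castAdd k i))) *
        β (fun i => w (Fin.cast rfl (Fin.natAdd j i)))) γ v rfl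
  have e2 := altSum_mul_right (finSumFinEquiv.trans (finCongr h4)) α
    (fun w : Fin (k + l) → V => β (fun i => w (Fin.cast rfl (Fin.castAdd l i))) *
        γ (fun i => w (Fin.cast rfl (Fin.natAdd k i)))) v rfl
  simp only [Equiv.trans_apply, finSumFinEquiv_apply_left, finSumFinEquiv_apply_right,
    finCongr_apply] at e1 e2
  rw [e1, e2]
  have e3 : (fun w : Fin m → V =>
      α (fun i => w (Fin.cast h3 (Fin.castAdd l (Fin.cast rfl (Fin.castAdd k i))))) *
        β (fun i => w (Fin.cast h3 (Fin.castAdd l (Fin.cast rfl (Fin.natAdd j i))))) *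
        γ (fun i => w (Fin.cast h3 (Fin.natAdd (j + k) i)))) = fun w =>
      α (fun i => w (Fin.cast h4 (Fin.castAdd (k + l) i))) *
        (β (fun i => w (Fin.cast h4 (Fin.natAdd j (Fin.cast rfl (Fin.castAdd l i))))) *
        γ (fun i => w (Fin.cast h4 (Fin.natAdd j (Fin.cast rfl (Fin.natAdd k i)))))) := by
    funext w
    rw [mul_assoc]
    have : ∀ i, Fin.cast h3 (Fin.natAdd (j + k) i) =
        Fin.cast h4 (Fin.natAdd j (Fin.cast rfl (Fin.natAdd k i))) := by
      intro i
      ext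
      simp [add_assoc]
    simp only [this]
    rfl
  rw [e3, ← Nat.cast_smul_eq_nsmul ℝ, ← Nat.cast_smul_eq_nsmul ℝ, smul_smul, smul_smul, smul_smul,
    smul_smul]
  congr 1
  have f1 : ((j + k).factorial : ℝ) ≠ 0 := by exact_mod_cast (Nat.factorial_pos _).ne'
  have f2 : ((k + l).factorial : ℝ) ≠ 0 := by exact_mod_cast (Nat.factorial_pos _).ne'
  field_simp

theorem wedge_const_left {m : ℕ} (c : A) (β : V [⋀^Fin m]→L[ℝ] A) (v : Fin m → V) :
    wedge m (ContinuousAlternatingMap.constOfIsEmpty ℝ V (Fin 0) c) β v = c * β v := by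
  rw [wedge_apply (zero_add m)]
  have : (fun w : Fin m → V => (ContinuousAlternatingMap.constOfIsEmpty ℝ V (Fin 0) c)
      (fun i => w (Fin.cast (zero_add m) (Fin.castAdd m i))) *
      β (fun j => w (Fin.cast (zero_add m) (Fin.natAdd 0 j)))) = fun w => c * β w := by
    funext w
    simp
  rw [this]
  have e : altSum (fun w => c * β w) v = c * altSum β v := by
    simp [altSum, Finset.mul_sum, -zsmul_eq_mul]
  rw [e, altSum_alternating, ← Nat.cast_smul_eq_nsmul ℝ, mul_smul_comm, smul_smul]
  have f1 : (m.factorial : ℝ) ≠ 0 := by exact_mod_cast (Nat.factorial_pos _).ne'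
  simp [f1]

theorem wedge_const_right {m : ℕ} (c : A) (β : V [⋀^Fin m]→L[ℝ] A) (v : Fin m → V) :
    wedge m β (ContinuousAlternatingMap.constOfIsEmpty ℝ V (Fin 0) c) v = β v * c := by
  rw [wedge_apply (add_zero m)]
  have : (fun w : Fin m → V => β (fun j => w (Fin.cast (add_zero m) (Fin.castAdd 0 j))) *
      (ContinuousAlternatingMap.constOfIsEmpty ℝ V (Fin 0) c)
      (fun i => w (Fin.cast (add_zero m) (Fin.natAdd m i)))) = fun w => β w * c := by
    funext w
    simp
  rw [this]
  have e : altSum (fun w => β w * c) v = altSum β v * c := by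
    simp [altSum, Finset.sum_mul, -zsmul_eq_mul]
  rw [e, altSum_alternating, ← Nat.cast_smul_eq_nsmul ℝ, smul_mul_assoc, smul_smul]
  have f1 : (m.factorial : ℝ) ≠ 0 := by exact_mod_cast (Nat.factorial_pos _).ne'
  simp [f1]

theorem wedge_add_left {k l m : ℕ} (α α' : V [⋀^Fin k]→L[ℝ] A) (β : V [⋀^Fin l]→L[ℝ] A) :
    wedge m (α + α') β = wedge m α β + wedge m α' β := by
  by_cases h : k + l = m
  · ext v
    simp only [ContinuousAlternatingMap.add_apply, wedge_apply h, add_mul, altSum_add, smul_add]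
  · simp [wedge_of_ne h]

theorem wedge_add_right {k l m : ℕ} (α : V [⋀^Fin k]→L[ℝ] A) (β β' : V [⋀^Fin l]→L[ℝ] A) :
    wedge m α (β + β') = wedge m α β + wedge m α β' := by
  by_cases h : k + l = m
  · ext v
    simp only [ContinuousAlternatingMap.add_apply, wedge_apply h, mul_add, altSum_add, smul_add]
  · simp [wedge_of_ne h]

theorem wedge_smul_left {𝕜 : Type*} [NormedField 𝕜] [NormedAlgebra 𝕜 A] {k l m : ℕ} (c : 𝕜)
    (α : V [⋀^Fin k]→L[ℝ] A) (β : V [⋀^Fin l]→L[ℝ] A) [SMulCommClass ℝ 𝕜 A] :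
    wedge m (c • α) β = c • wedge m α β := by
  by_cases h : k + l = m
  · ext v
    simp only [ContinuousAlternatingMap.smul_apply, wedge_apply h, smul_mul_assoc]
    rw [smul_comm c]
    congr 1
    simp only [altSum, Finset.smul_sum]
    exact Finset.sum_congr rfl fun σ _ => smul_comm _ _ _
  · ext
    simp [wedge_of_ne h]

theorem wedge_smul_right {𝕜 : Type*} [NormedField 𝕜] [NormedAlgebra 𝕜 A] {k l m : ℕ} (c : 𝕜)
    (α : V [⋀^Fin k]→L[ℝ] A) (β : V [⋀^Fin l]→L[ℝ] A) [SMulCommClass ℝ 𝕜 A] :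
    wedge m α (c • β) = c • wedge m α β := by
  by_cases h : k + l = m
  · ext v
    simp only [ContinuousAlternatingMap.smul_apply, wedge_apply h, mul_smul_comm]
    rw [smul_comm c]
    congr 1
    simp only [altSum, Finset.smul_sum]
    exact Finset.sum_congr rfl fun σ _ => smul_comm _ _ _
  · ext
    simp [wedge_of_ne h]

theorem wedge_zero_left {k l m : ℕ} (β : V [⋀^Fin l]→L[ℝ] A) :
    wedge m (0 : V [⋀^Fin k]→L[ℝ] A) β = 0 := by
  have := wedge_add_left (m := m) (0 : V [⋀^Fin k]→L[ℝ] A) 0 β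
  simpa using this

theorem wedge_zero_right {k l m : ℕ} (α : V [⋀^Fin k]→L[ℝ] A) :
    wedge m α (0 : V [⋀^Fin l]→L[ℝ] A) = 0 := by
  have := wedge_add_right (m := m) α (0 : V [⋀^Fin l]→L[ℝ] A) 0
  simpa using this

theorem wedge_compContinuousLinearMap {k l m : ℕ} (α : V [⋀^Fin k]→L[ℝ] A)
    (β : V [⋀^Fin l]→L[ℝ] A) (f : W →L[ℝ] V) :
    (wedge m α β).compContinuousLinearMap f =
      wedge m (α.compContinuousLinearMap f) (β.compContinuousLinearMap f) := by
  by_cases h : k + l = m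
  · ext v
    rw [ContinuousAlternatingMap.compContinuousLinearMap_apply, wedge_apply h, wedge_apply h]
    rfl
  · simp only [wedge_of_ne h]
    rfl

theorem wedge_map {k l m : ℕ} (α : V [⋀^Fin k]→L[ℝ] A)
    (β : V [⋀^Fin l]→L[ℝ] A) (f : A →L[ℝ] B) (hf : ∀ x y, f (x * y) = f x * f y) :
    f.compContinuousAlternatingMap (wedge m α β) =
      wedge m (f.compContinuousAlternatingMap α) (f.compContinuousAlternatingMap β) := by
  by_cases h : k + l = m
  · ext v
    rw [ContinuousLinearMap.compContinuousAlternatingMap_coe, Function.comp_apply, wedge_apply h,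
      wedge_apply h, map_smul]
    congr 1
    simp [altSum, map_sum, map_zsmul, hf, -zsmul_eq_mul]
  · simp only [wedge_of_ne h]
    ext
    simp

end WedgeAlgebra

/-! ### Wedge products with a 1-form. -/

section OneForms

variable {V : Type*} [NormedAddCommGroup V] [NormedSpace ℝ V]
variable {A : Type*} [NormedRing A] [NormedAlgebra ℝ A]

theorem altSum_alternatingMap {M : Type*} [AddCommGroup M] [Module ℝ M] {k : ℕ}
    (α : V [⋀^Fin k]→ₗ[ℝ] M) (v : Fin k → V) :
    altSum α v = k.factorial • α v := by
  have h : ∀ τ : Equiv.Perm (Fin k), (Equiv.Perm.sign τ : ℤ) • α (v ∘ τ) = α v := fun τ => by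
    rw [α.map_perm v τ, Units.smul_def, smul_smul, ← Units.val_mul, Int.units_mul_self,
      Units.val_one, one_smul]
  simp [altSum, h, Fintype.card_perm, -zsmul_eq_mul]

/-- The sum on the right is already alternating, so alternating it multiplies it by `(k + 1)!`. On
the other hand its `k + 1` signed terms all have the same alternation, a cycle of the matching sign
carrying each of them to the term of index `0`. Cancelling `k + 1` gives the claim. -/
theorem altSum_cons {k : ℕ} (a : V →L[ℝ] A) (β : V [⋀^Fin k]→L[ℝ] A) (v : Fin (k + 1) → V) :
    altSum (fun w : Fin (k + 1) → V => a (w 0) * β (fun j => w j.succ)) v =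
      k.factorial • ∑ i : Fin (k + 1), (-1 : ℤ) ^ (i : ℕ) • (a (v i) * β (i.removeNth v)) := by
  let f : V →ₗ[ℝ] V [⋀^Fin k]→ₗ[ℝ] A :=
    { toFun := fun x => (LinearMap.mulLeft ℝ (a x)).compAlternatingMap β.toAlternatingMap
      map_add' := fun x y => by ext w; simp [add_mul]
      map_smul' := fun c x => by ext w; simp }
  have hf : ∀ w : Fin (k + 1) → V, AlternatingMap.alternatizeUncurryFin f w =
      ∑ i : Fin (k + 1), (-1 : ℤ) ^ (i : ℕ) • (a (w i) * β (i.removeNth w)) := fun w => by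
    rw [AlternatingMap.alternatizeUncurryFin_apply]
    rfl
  have h1 := altSum_alternatingMap (AlternatingMap.alternatizeUncurryFin f) v
  have h2 : altSum (AlternatingMap.alternatizeUncurryFin f) v = ∑ i : Fin (k + 1),
      (-1 : ℤ) ^ (i : ℕ) • altSum (fun w => a (w i) * β (i.removeNth w)) v := by
    unfold altSum
    simp only [hf, Finset.smul_sum]
    rw [Finset.sum_comm]
    exact Finset.sum_congr rfl fun _ _ => Finset.sum_congr rfl fun _ _ => smul_comm _ _ _
  have h3 : ∀ i : Fin (k + 1), (-1 : ℤ) ^ (i : ℕ) • altSum (fun w => a (w i) * β (i.removeNth w)) v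
      = altSum (fun w : Fin (k + 1) → V => a (w 0) * β (fun j => w j.succ)) v := fun i => by
    have := altSum_comp_perm (fun w : Fin (k + 1) → V => a (w 0) * β (fun j => w j.succ))
      i.cycleRange.symm v
    simp only [Function.comp_apply, Fin.cycleRange_symm_zero, Fin.cycleRange_symm_succ,
      Equiv.Perm.sign_symm, Fin.sign_cycleRange] at this
    have e : (fun w : Fin (k + 1) → V => a (w i) * β (i.removeNth w)) =
        fun w => a (w i) * β (fun j => w (i.succAbove j)) := rfl
    rw [e, this, smul_smul]
    have : ((-1 : ℤ) ^ (i : ℕ) * (((-1 : ℤˣ) ^ (i : ℕ) : ℤˣ) : ℤ)) = 1 := by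
      push_cast
      rw [← mul_pow]
      simp
    rw [this, one_smul]
  rw [h2, Finset.sum_congr rfl fun i _ => h3 i, hf] at h1
  rw [Finset.sum_const, Finset.card_univ, Fintype.card_fin, Nat.factorial_succ, mul_smul] at h1
  have h4 : ((k + 1 : ℕ) : ℝ) ≠ 0 := by exact_mod_cast Nat.succ_ne_zero k
  rw [← Nat.cast_smul_eq_nsmul ℝ (k + 1), ← Nat.cast_smul_eq_nsmul ℝ (k + 1)] at h1
  exact smul_right_injective A h4 h1

theorem wedge_one_apply {k : ℕ} (a : V →L[ℝ] A) (β : V [⋀^Fin k]→L[ℝ] A) (v : Fin (k + 1) → V) :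
    wedge (k + 1) (ContinuousAlternatingMap.ofSubsingleton ℝ V A (0 : Fin 1) a) β v =
      ∑ i : Fin (k + 1), (-1 : ℤ) ^ (i : ℕ) • (a (v i) * β (i.removeNth v)) := by
  rw [wedge_apply (Nat.add_comm 1 k)]
  have e : (fun w : Fin (k + 1) → V =>
      (ContinuousAlternatingMap.ofSubsingleton ℝ V A (0 : Fin 1) a)
        (fun i => w (Fin.cast (Nat.add_comm 1 k) (Fin.castAdd k i))) *
      β (fun j => w (Fin.cast (Nat.add_comm 1 k) (Fin.natAdd 1 j)))) =
      fun w => a (w 0) * β (fun j => w j.succ) := by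
    funext w
    have : ∀ j : Fin k, Fin.cast (Nat.add_comm 1 k) (Fin.natAdd 1 j) = j.succ := fun j => by
      ext; simp
    simp only [this]
    rfl
  rw [e, altSum_cons, ← Nat.cast_smul_eq_nsmul ℝ, smul_smul]
  have f1 : (k.factorial : ℝ) ≠ 0 := by exact_mod_cast (Nat.factorial_pos _).ne'
  simp [f1, -zsmul_eq_mul]

/-- Moving the first argument past the other `k` is a cyclic permutation of sign `(-1)^k`.
Commutation of the values is required only after `τ`, so this serves both for traces and, with `τ`
the identity, for 1-forms with central values. -/
theorem wedge_one_comm {M : Type*} [NormedAddCommGroup M] [NormedSpace ℝ M] {k : ℕ}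
    (τ : A →L[ℝ] M) (a : V →L[ℝ] A) (β : V [⋀^Fin k]→L[ℝ] A)
    (h : ∀ x (w : Fin k → V), τ (a x * β w) = τ (β w * a x)) :
    τ.compContinuousAlternatingMap
        (wedge (k + 1) (ContinuousAlternatingMap.ofSubsingleton ℝ V A (0 : Fin 1) a) β) =
      (-1 : ℝ) ^ k • τ.compContinuousAlternatingMap
        (wedge (k + 1) β (ContinuousAlternatingMap.ofSubsingleton ℝ V A (0 : Fin 1) a)) := by
  ext v
  simp only [ContinuousAlternatingMap.smul_apply,
    ContinuousLinearMap.compContinuousAlternatingMap_coe, Function.comp_apply]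
  rw [wedge_apply (Nat.add_comm 1 k), wedge_apply rfl, map_smul, map_smul, smul_comm,
    mul_comm (Nat.factorial 1 : ℝ)]
  congr 1
  have hτ : ∀ F : (Fin (k + 1) → V) → A, τ (altSum F v) = altSum (fun w => τ (F w)) v := fun F => by
    simp [altSum, map_sum, map_zsmul, -zsmul_eq_mul]
  rw [hτ, hτ]
  have := altSum_comp_perm (fun w : Fin (k + 1) → V => τ (β (fun i => w i.castSucc) *
    a (w (Fin.last k)))) (finRotate (k + 1)) v
  rw [sign_finRotate] at this
  simp only [Nat.add_sub_cancel, Units.val_pow_eq_pow_val, Units.val_neg, Units.val_one] at this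
  have e0 : (fun w : Fin (k + 1) → V =>
      τ ((ContinuousAlternatingMap.ofSubsingleton ℝ V A (0 : Fin 1) a)
        (fun i => w (Fin.cast (Nat.add_comm 1 k) (Fin.castAdd k i))) *
      β (fun j => w (Fin.cast (Nat.add_comm 1 k) (Fin.natAdd 1 j))))) =
      fun w => τ (β (fun i => (w ∘ finRotate (k + 1)) i.castSucc) *
        a ((w ∘ finRotate (k + 1)) (Fin.last k))) := by
    funext w
    rw [← h]
    have h1 : ∀ j : Fin k, Fin.cast (Nat.add_comm 1 k) (Fin.natAdd 1 j) = j.succ := fun j => by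
      ext; simp
    have h2 : ∀ j : Fin k, finRotate (k + 1) j.castSucc = j.succ := fun j => by
      rw [finRotate_apply]; simp
    simp only [h1, Function.comp_apply, h2, finRotate_last]
    rfl
  rw [e0, this]
  have e1 : ((-1 : ℝ) ^ k) = (((-1 : ℤ) ^ k : ℤ) : ℝ) := by push_cast; rfl
  rw [e1, Int.cast_smul_eq_zsmul]
  rfl

end OneForms

/-! ### The graded ring of inhomogeneous forms. -/

/-- The graded ring of inhomogeneous alternating forms. -/
def Ext (V : Type*) [NormedAddCommGroup V] [NormedSpace ℝ V]
    (A : Type*) [NormedRing A] [NormedAlgebra ℝ A] : Type _ := FormAlg V A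

namespace Ext

variable {V : Type*} [NormedAddCommGroup V] [NormedSpace ℝ V]
variable {W : Type*} [NormedAddCommGroup W] [NormedSpace ℝ W]
variable {A : Type*} [NormedRing A] [NormedAlgebra ℝ A]
variable {B : Type*} [NormedRing B] [NormedAlgebra ℝ B]

instance instAddCommGroup : AddCommGroup (Ext V A) := inferInstanceAs (AddCommGroup (FormAlg V A))

instance {𝕜 : Type*} [NormedField 𝕜] [NormedAlgebra 𝕜 A] [SMulCommClass ℝ 𝕜 A] :
    Module 𝕜 (Ext V A) := inferInstanceAs (Module 𝕜 (FormAlg V A))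

instance instMul : Mul (Ext V A) := ⟨FormAlg.mul⟩

instance instOne : One (Ext V A) := ⟨FormAlg.one⟩

/-- The component of degree `k`. -/
def coeff (X : Ext V A) (k : ℕ) : V [⋀^Fin k]→L[ℝ] A := (show FormAlg V A from X) k

/-- The element with given components. -/
def mk (X : ∀ k, V [⋀^Fin k]→L[ℝ] A) : Ext V A := X

theorem coeff_mk (X : ∀ k, V [⋀^Fin k]→L[ℝ] A) (k : ℕ) : (mk X).coeff k = X k := rfl

@[ext] theorem ext {X Y : Ext V A} (h : ∀ k, X.coeff k = Y.coeff k) : X = Y := funext h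

theorem coeff_mul (X Y : Ext V A) (m : ℕ) :
    (X * Y).coeff m = ∑ ij ∈ Finset.HasAntidiagonal.antidiagonal m,
      wedge m (X.coeff ij.1) (Y.coeff ij.2) := rfl

@[simp] theorem coeff_add (X Y : Ext V A) (m : ℕ) :
    (X + Y).coeff m = X.coeff m + Y.coeff m := rfl
@[simp] theorem coeff_neg (X : Ext V A) (m : ℕ) : (-X).coeff m = -X.coeff m := rfl
@[simp] theorem coeff_zero (m : ℕ) : (0 : Ext V A).coeff m = 0 := rfl
@[simp] theorem coeff_smul {𝕜 : Type*} [NormedField 𝕜] [NormedAlgebra 𝕜 A] [SMulCommClass ℝ 𝕜 A]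
    (c : 𝕜) (X : Ext V A) (m : ℕ) : (c • X).coeff m = c • X.coeff m := rfl

theorem coeff_sum {ι : Type*} (s : Finset ι) (X : ι → Ext V A) (m : ℕ) :
    (∑ i ∈ s, X i).coeff m = ∑ i ∈ s, (X i).coeff m :=
  map_sum (AddMonoidHom.mk' (fun Y : Ext V A => Y.coeff m) fun _ _ => rfl) X s

/-- A form of degree `k` as an element of the graded ring. -/
def of {k : ℕ} (w : V [⋀^Fin k]→L[ℝ] A) : Ext V A := FormAlg.of w

theorem one_def :
    (1 : Ext V A) = of (ContinuousAlternatingMap.constOfIsEmpty ℝ V (Fin 0) (1 : A)) := rfl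

theorem coeff_of {k : ℕ} (w : V [⋀^Fin k]→L[ℝ] A) : (of w).coeff k = w := by
  change (Pi.single k w : FormAlg V A) k = w
  exact Pi.single_eq_same (M := fun k => V [⋀^Fin k]→L[ℝ] A) k w

theorem coeff_of_ne {k l : ℕ} (w : V [⋀^Fin k]→L[ℝ] A) (h : l ≠ k) : (of w).coeff l = 0 := by
  change (Pi.single k w : FormAlg V A) l = 0
  exact Pi.single_eq_of_ne (M := fun k => V [⋀^Fin k]→L[ℝ] A) h w

theorem coeff_one_succ (k : ℕ) : (1 : Ext V A).coeff (k + 1) = 0 :=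
  coeff_of_ne _ (Nat.succ_ne_zero k)

theorem coeff_of_mul {k l m : ℕ} (h : k + l = m) (α : V [⋀^Fin k]→L[ℝ] A) (Y : Ext V A) :
    (of α * Y).coeff m = wedge m α (Y.coeff l) := by
  rw [coeff_mul, Finset.sum_eq_single (k, l)]
  · simp only [coeff_of]
  · rintro ⟨i, j⟩ hij hne
    have hi : i ≠ k := by
      rintro rfl
      apply hne
      rw [Finset.HasAntidiagonal.mem_antidiagonal] at hij
      simp only [Prod.mk.injEq, true_and]
      simp only at hij
      omega
    simp only [coeff_of_ne α hi, wedge_zero_left]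
  · intro hn
    exact absurd (Finset.HasAntidiagonal.mem_antidiagonal.2 h) hn

theorem coeff_mul_of {k l m : ℕ} (h : k + l = m) (X : Ext V A) (β : V [⋀^Fin l]→L[ℝ] A) :
    (X * of β).coeff m = wedge m (X.coeff k) β := by
  rw [coeff_mul, Finset.sum_eq_single (k, l)]
  · simp only [coeff_of]
  · rintro ⟨i, j⟩ hij hne
    have hi : j ≠ l := by
      rintro rfl
      apply hne
      rw [Finset.HasAntidiagonal.mem_antidiagonal] at hij
      simp only [Prod.mk.injEq, and_true]
      simp only at hij
      omega
    simp only [coeff_of_ne β hi, wedge_zero_right]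
  · intro hn
    exact absurd (Finset.HasAntidiagonal.mem_antidiagonal.2 h) hn

theorem coeff_of_mul_of_lt {k m : ℕ} (h : m < k) (α : V [⋀^Fin k]→L[ℝ] A) (Y : Ext V A) :
    (of α * Y).coeff m = 0 := by
  rw [coeff_mul]
  refine Finset.sum_eq_zero ?_
  rintro ⟨i, j⟩ hij
  rw [Finset.HasAntidiagonal.mem_antidiagonal] at hij
  simp only [coeff_of_ne α (show i ≠ k by simp only at hij; omega), wedge_zero_left]

theorem coeff_mul_of_of_lt {k m : ℕ} (h : m < k) (α : V [⋀^Fin k]→L[ℝ] A) (Y : Ext V A) :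
    (Y * of α).coeff m = 0 := by
  rw [coeff_mul]
  refine Finset.sum_eq_zero ?_
  rintro ⟨i, j⟩ hij
  rw [Finset.HasAntidiagonal.mem_antidiagonal] at hij
  simp only [coeff_of_ne α (show j ≠ k by simp only at hij; omega), wedge_zero_right]

theorem wedge_sum_left {ι : Type*} {k l m : ℕ} (s : Finset ι) (α : ι → V [⋀^Fin k]→L[ℝ] A)
    (β : V [⋀^Fin l]→L[ℝ] A) : wedge m (∑ i ∈ s, α i) β = ∑ i ∈ s, wedge m (α i) β := by
  classical
  induction s using Finset.induction_on with
  | empty => simp [wedge_zero_left]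
  | insert a s ha ih => rw [Finset.sum_insert ha, Finset.sum_insert ha, wedge_add_left, ih]

theorem wedge_sum_right {ι : Type*} {k l m : ℕ} (s : Finset ι) (α : V [⋀^Fin k]→L[ℝ] A)
    (β : ι → V [⋀^Fin l]→L[ℝ] A) : wedge m α (∑ i ∈ s, β i) = ∑ i ∈ s, wedge m α (β i) := by
  classical
  induction s using Finset.induction_on with
  | empty => simp [wedge_zero_right]
  | insert a s ha ih => rw [Finset.sum_insert ha, Finset.sum_insert ha, wedge_add_right, ih]

theorem mul_assoc' (X Y Z : Ext V A) : X * Y * Z = X * (Y * Z) := by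
  ext1 m
  simp only [coeff_mul, wedge_sum_left, wedge_sum_right]
  rw [Finset.sum_sigma', Finset.sum_sigma']
  refine Finset.sum_bij'
    (fun x _ => ⟨(x.2.1, x.2.2 + x.1.2), (x.2.2, x.1.2)⟩)
    (fun x _ => ⟨(x.1.1 + x.2.1, x.2.2), (x.1.1, x.2.1)⟩) ?_ ?_ ?_ ?_ ?_
  · rintro ⟨⟨a, b⟩, ⟨c, d⟩⟩ h
    simp only [Finset.mem_sigma, Finset.HasAntidiagonal.mem_antidiagonal] at h ⊢
    refine ⟨?_, trivial⟩
    omega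
  · rintro ⟨⟨a, b⟩, ⟨c, d⟩⟩ h
    simp only [Finset.mem_sigma, Finset.HasAntidiagonal.mem_antidiagonal] at h ⊢
    refine ⟨?_, trivial⟩
    omega
  · rintro ⟨⟨a, b⟩, ⟨c, d⟩⟩ h
    simp only [Finset.mem_sigma, Finset.HasAntidiagonal.mem_antidiagonal] at h ⊢
    obtain ⟨_, rfl⟩ := h
    rfl
  · rintro ⟨⟨a, b⟩, ⟨c, d⟩⟩ h
    simp only [Finset.mem_sigma, Finset.HasAntidiagonal.mem_antidiagonal] at h ⊢
    obtain ⟨_, rfl⟩ := h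
    rfl
  · rintro ⟨⟨a, b⟩, ⟨c, d⟩⟩ h
    simp only [Finset.mem_sigma, Finset.HasAntidiagonal.mem_antidiagonal] at h ⊢
    exact wedge_assoc h.2 rfl h.1 (by omega) _ _ _

instance : Ring (Ext V A) :=
  { instAddCommGroup, instMul, instOne with
    mul_assoc := mul_assoc'
    one_mul := fun X => by
      ext m v
      rw [one_def, coeff_of_mul (zero_add m), wedge_const_left, _root_.one_mul]
    mul_one := fun X => by
      ext m v
      rw [one_def, coeff_mul_of (add_zero m), wedge_const_right, _root_.mul_one]
    left_distrib := fun X Y Z => by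
      ext1 m
      simp only [coeff_mul, coeff_add, wedge_add_right, Finset.sum_add_distrib]
    right_distrib := fun X Y Z => by
      ext1 m
      simp only [coeff_mul, coeff_add, wedge_add_left, Finset.sum_add_distrib]
    zero_mul := fun X => by
      ext1 m
      simp [coeff_mul, wedge_zero_left]
    mul_zero := fun X => by
      ext1 m
      simp [coeff_mul, wedge_zero_right] }

instance {𝕜 : Type*} [NormedField 𝕜] [NormedAlgebra 𝕜 A] [SMulCommClass ℝ 𝕜 A] :
    IsScalarTower 𝕜 (Ext V A) (Ext V A) where
  smul_assoc c X Y := by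
    ext1 m
    simp only [smul_eq_mul, coeff_smul, coeff_mul, wedge_smul_left, Finset.smul_sum]

instance {𝕜 : Type*} [NormedField 𝕜] [NormedAlgebra 𝕜 A] [SMulCommClass ℝ 𝕜 A] :
    SMulCommClass 𝕜 (Ext V A) (Ext V A) where
  smul_comm c X Y := by
    ext1 m
    simp only [smul_eq_mul, coeff_smul, coeff_mul, wedge_smul_right, Finset.smul_sum]

theorem formAlg_pow_eq (X : Ext V A) (p : ℕ) : FormAlg.pow X p = X ^ p := by
  induction p with
  | zero => rw [pow_zero]; rfl
  | succ p ih => rw [pow_succ, ← ih]; rfl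

theorem formAlg_prod_eq (l : List (Ext V A)) : FormAlg.prod l = l.prod := by
  induction l with
  | nil => rfl
  | cons X l ih => rw [List.prod_cons, ← ih]; rfl

/-- The algebra involution `(-1)^k` in degree `k`. -/
def gradeInv : Ext V A →+* Ext V A where
  toFun X := mk fun k => (-1 : ℝ) ^ k • X.coeff k
  map_one' := by
    ext k v
    rcases k with _ | k
    · simp [coeff_mk]
    · simp [coeff_mk, coeff_one_succ]
  map_zero' := by ext k v; simp [coeff_mk]
  map_add' X Y := by ext k v; simp [coeff_mk]
  map_mul' X Y := by
    ext1 m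
    simp only [coeff_mul, coeff_mk, Finset.smul_sum]
    refine Finset.sum_congr rfl fun ij h => ?_
    rw [wedge_smul_left, wedge_smul_right, smul_smul, ← pow_add,
      Finset.HasAntidiagonal.mem_antidiagonal.1 h]

theorem coeff_gradeInv (X : Ext V A) (k : ℕ) :
    (gradeInv X).coeff k = (-1 : ℝ) ^ k • X.coeff k := rfl

theorem gradeInv_gradeInv (X : Ext V A) : gradeInv (gradeInv X) = X := by
  ext1 k
  rw [coeff_gradeInv, coeff_gradeInv, smul_smul, ← mul_pow]
  simp

theorem gradeInv_smul {𝕜 : Type*} [NormedField 𝕜] [NormedAlgebra 𝕜 A] [SMulCommClass ℝ 𝕜 A]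
    (c : 𝕜) (X : Ext V A) : gradeInv (c • X) = c • gradeInv X := by
  ext k v
  simp only [coeff_gradeInv, coeff_smul, ContinuousAlternatingMap.smul_apply]
  exact smul_comm _ _ _

/-- Pullback of forms along a linear map. -/
def comap (f : W →L[ℝ] V) : Ext V A →+* Ext W A where
  toFun X := mk fun k => (X.coeff k).compContinuousLinearMap f
  map_one' := by
    ext k v
    rcases k with _ | k
    · rfl
    · simp [coeff_mk, coeff_one_succ]
  map_zero' := rfl
  map_add' X Y := rfl
  map_mul' X Y := by
    ext m v
    simp only [coeff_mk, coeff_mul, ← wedge_compContinuousLinearMap]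
    simp [ContinuousAlternatingMap.sum_apply]

theorem coeff_comap (f : W →L[ℝ] V) (X : Ext V A) (k : ℕ) :
    (comap f X).coeff k = (X.coeff k).compContinuousLinearMap f := rfl

theorem comap_smul {𝕜 : Type*} [NormedField 𝕜] [NormedAlgebra 𝕜 A] [SMulCommClass ℝ 𝕜 A]
    (f : W →L[ℝ] V) (c : 𝕜) (X : Ext V A) : comap f (c • X) = c • comap f X := rfl

/-- Composition of the values of a form with a linear map. -/
def map (τ : A →L[ℝ] B) : Ext V A →ₗ[ℝ] Ext V B where
  toFun X := mk fun k => τ.compContinuousAlternatingMap (X.coeff k)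
  map_add' X Y := by ext k v; simp [coeff_mk]
  map_smul' c X := by ext k v; simp [coeff_mk]

theorem coeff_map (τ : A →L[ℝ] B) (X : Ext V A) (k : ℕ) :
    (map τ X).coeff k = τ.compContinuousAlternatingMap (X.coeff k) := rfl

theorem map_mul (τ : A →L[ℝ] B) (hτ : ∀ x y, τ (x * y) = τ x * τ y) (X Y : Ext V A) :
    map τ (X * Y) = map τ X * map τ Y := by
  ext m v
  simp only [coeff_map, coeff_mul, ← wedge_map _ _ τ hτ]
  simp [ContinuousAlternatingMap.sum_apply]

theorem map_one (τ : A →L[ℝ] B) (hτ : τ 1 = 1) : map τ (1 : Ext V A) = 1 := by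
  ext k v
  rcases k with _ | k
  · change τ 1 = 1
    exact hτ
  · simp [coeff_map, coeff_one_succ]

/-- A linear map as a `1`-form. -/
def lin : (V →L[ℝ] A) →ₗ[ℝ] Ext V A where
  toFun a := of (ContinuousAlternatingMap.ofSubsingleton ℝ V A (0 : Fin 1) a)
  map_add' a b := by
    ext k v
    by_cases h : k = 1
    · subst h
      rw [coeff_add, coeff_of, coeff_of, coeff_of]
      rfl
    · simp [coeff_of_ne _ h]
  map_smul' c a := by
    ext k v
    by_cases h : k = 1
    · subst h
      rw [coeff_smul, coeff_of, coeff_of]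
      rfl
    · simp [coeff_of_ne _ h]

theorem lin_def (a : V →L[ℝ] A) :
    lin a = of (ContinuousAlternatingMap.ofSubsingleton ℝ V A (0 : Fin 1) a) := rfl

theorem coeff_lin_one (a : V →L[ℝ] A) (v : Fin 1 → V) : (lin a).coeff 1 v = a (v 0) := by
  rw [lin_def, coeff_of]
  rfl

theorem coeff_lin_mul_zero (a : V →L[ℝ] A) (Y : Ext V A) : (lin a * Y).coeff 0 = 0 :=
  coeff_of_mul_of_lt one_pos _ _

theorem coeff_lin_mul_succ (a : V →L[ℝ] A) (Y : Ext V A) (k : ℕ) (v : Fin (k + 1) → V) :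
    (lin a * Y).coeff (k + 1) v =
      ∑ i : Fin (k + 1), (-1 : ℤ) ^ (i : ℕ) • (a (v i) * Y.coeff k (i.removeNth v)) := by
  rw [lin_def, coeff_of_mul (Nat.add_comm 1 k), wedge_one_apply]

theorem gradeInv_lin (a : V →L[ℝ] A) : gradeInv (lin a) = -lin a := by
  ext k v
  rw [coeff_gradeInv, coeff_neg]
  by_cases h : k = 1
  · subst h
    simp
  · simp [lin_def, coeff_of_ne _ h]

theorem comap_lin (f : W →L[ℝ] V) (a : V →L[ℝ] A) : comap f (lin a) = lin (a ∘L f) := by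
  ext k v
  rw [coeff_comap, lin_def, lin_def]
  by_cases h : k = 1
  · subst h
    rw [coeff_of, coeff_of]
    rfl
  · rw [coeff_of_ne _ h, coeff_of_ne _ h]
    rfl

theorem map_lin (τ : A →L[ℝ] B) (a : V →L[ℝ] A) : map τ (lin a) = lin (τ ∘L a) := by
  ext k v
  rw [coeff_map, lin_def, lin_def]
  by_cases h : k = 1
  · subst h
    rw [coeff_of, coeff_of]
    rfl
  · rw [coeff_of_ne _ h, coeff_of_ne _ h]
    simp

/-- `gradeInv` collects the signs `(-1)^k` of all degrees, which makes the graded commutation rule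
available for inhomogeneous `Y`. -/
theorem coeff_map_lin_mul_comm {M : Type*} [NormedAddCommGroup M] [NormedSpace ℝ M]
    (τ : A →L[ℝ] M) (a : V →L[ℝ] A)
    (h : ∀ x y, τ (a x * y) = τ (y * a x)) (Y : Ext V A) (m : ℕ) :
    τ.compContinuousAlternatingMap ((lin a * Y).coeff m) =
      τ.compContinuousAlternatingMap ((gradeInv Y * lin a).coeff m) := by
  rw [lin_def]
  rcases m with _ | m
  · rw [coeff_of_mul_of_lt one_pos, coeff_mul_of_of_lt one_pos]
  · rw [coeff_of_mul (Nat.add_comm 1 m), coeff_mul_of rfl, wedge_one_comm τ a _ fun x w => h x _,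
      coeff_gradeInv, wedge_smul_left]
    ext v
    simp

theorem map_lin_mul_comm (τ : A →L[ℝ] B) (a : V →L[ℝ] A)
    (h : ∀ x y, τ (a x * y) = τ (y * a x)) (Y : Ext V A) :
    map τ (lin a * Y) = map τ (gradeInv Y * lin a) := by
  ext1 m
  exact coeff_map_lin_mul_comm τ a h Y m

/-- A real-valued linear map as a scalar `1`-form with values in the centre of `A`. -/
def scal : (V →L[ℝ] ℝ) →ₗ[ℝ] Ext V A where
  toFun e := lin (e.smulRight (1 : A))
  map_add' e f := by
    rw [← map_add]
    congr 1
    ext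
    simp [add_smul]
  map_smul' c e := by
    rw [RingHom.id_apply, ← map_smul]
    congr 1
    ext
    simp [smul_smul]

theorem scal_def (e : V →L[ℝ] ℝ) : (scal e : Ext V A) = lin (e.smulRight (1 : A)) := rfl

theorem gradeInv_scal (e : V →L[ℝ] ℝ) : gradeInv (scal e : Ext V A) = -scal e := gradeInv_lin _

theorem comap_scal (f : W →L[ℝ] V) (e : V →L[ℝ] ℝ) :
    comap f (scal e : Ext V A) = scal (e ∘L f) := comap_lin _ _

theorem map_scal (τ : A →L[ℝ] B) (hτ : τ 1 = 1) (e : V →L[ℝ] ℝ) :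
    map τ (scal e : Ext V A) = scal e := by
  rw [scal_def, map_lin, scal_def]
  congr 1
  ext
  simp [hτ]

theorem map_id (X : Ext V A) : map (ContinuousLinearMap.id ℝ A) X = X := by
  ext k v
  simp [coeff_map]

/-- The values of `scal e` are multiples of `1`, hence central, so the commutation rule applies with
the identity in place of a trace. -/
theorem scal_mul_comm (e : V →L[ℝ] ℝ) (Y : Ext V A) : scal e * Y = gradeInv Y * scal e := by
  have := map_lin_mul_comm (ContinuousLinearMap.id ℝ A) (e.smulRight (1 : A))
    (fun x y => by simp) Y
  rwa [map_id, map_id] at this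

theorem scal_sq (e : V →L[ℝ] ℝ) : (scal e : Ext V A) * scal e = 0 := by
  have h := scal_mul_comm e (scal e : Ext V A)
  rw [gradeInv_scal, _root_.neg_mul] at h
  have h2 : (2 : ℝ) • ((scal e : Ext V A) * scal e) = 0 := by
    rw [two_smul]
    nth_rw 1 [h]
    exact neg_add_cancel _
  exact (smul_eq_zero.1 h2).resolve_left two_ne_zero

theorem coeff_scal_mul_zero (e : V →L[ℝ] ℝ) (Y : Ext V A) : (scal e * Y).coeff 0 = 0 :=
  coeff_lin_mul_zero _ _

theorem coeff_scal_mul_succ (e : V →L[ℝ] ℝ) (Y : Ext V A) (k : ℕ) (v : Fin (k + 1) → V) :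
    (scal e * Y).coeff (k + 1) v =
      ∑ i : Fin (k + 1), (-1 : ℤ) ^ (i : ℕ) • (e (v i) • Y.coeff k (i.removeNth v)) := by
  rw [scal_def, coeff_lin_mul_succ]
  simp

/-- Cyclic invariance of a trace on the graded ring, for products of two `1`-forms. -/
theorem map_trace_comm (τ : A →L[ℝ] B) (hτ : ∀ x y, τ (x * y) = τ (y * x)) (a b : V →L[ℝ] A)
    (Y : Ext V A) : map τ (lin a * lin b * Y) = map τ (Y * (lin a * lin b)) := by
  rw [_root_.mul_assoc, map_lin_mul_comm τ a (fun x y => hτ _ _), RingHom.map_mul, gradeInv_lin,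
    _root_.mul_assoc, _root_.neg_mul, LinearMap.map_neg,
    map_lin_mul_comm τ b (fun x y => hτ _ _),
    RingHom.map_mul, gradeInv_gradeInv, gradeInv_lin]
  simp [_root_.mul_assoc]

end Ext

/-! ### Smooth families of forms and the exterior derivative. -/

namespace Ext

variable {E : Type*} [NormedAddCommGroup E] [NormedSpace ℝ E]
variable {V : Type*} [NormedAddCommGroup V] [NormedSpace ℝ V] [FiniteDimensional ℝ V]
variable {A : Type*} [NormedRing A] [NormedAlgebra ℝ A] [FiniteDimensional ℝ A]

instance finiteDimensional_alternating (k : ℕ) : FiniteDimensional ℝ (V [⋀^Fin k]→L[ℝ] A) := by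
  have : FiniteDimensional ℝ (ContinuousMultilinearMap ℝ (fun _ : Fin k => V) A) :=
    Module.Finite.of_injective
      (ContinuousMultilinearMap.toMultilinearMapLinear :
        ContinuousMultilinearMap ℝ (fun _ : Fin k => V) A →ₗ[ℝ] _)
      ContinuousMultilinearMap.toMultilinearMap_injective
  have hinj : Function.Injective
      (ContinuousAlternatingMap.toContinuousMultilinearMapLinear :
        (V [⋀^Fin k]→L[ℝ] A) →ₗ[ℝ] ContinuousMultilinearMap ℝ (fun _ : Fin k => V) A) :=
    ContinuousAlternatingMap.toContinuousMultilinearMap_injective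
  exact Module.Finite.of_injective _ hinj

section Bilinear

variable {X Y Z : Type*} [NormedAddCommGroup X] [NormedSpace ℝ X] [FiniteDimensional ℝ X]
    [NormedAddCommGroup Y] [NormedSpace ℝ Y] [FiniteDimensional ℝ Y]
    [NormedAddCommGroup Z] [NormedSpace ℝ Z]

/-- A bilinear map between finite-dimensional spaces as a continuous bilinear map. -/
def bilinL (b : X → Y → Z)
    (h1 : ∀ x x' y, b (x + x') y = b x y + b x' y) (h2 : ∀ (c : ℝ) x y, b (c • x) y = c • b x y)
    (h3 : ∀ x y y', b x (y + y') = b x y + b x y') (h4 : ∀ (c : ℝ) x y, b x (c • y) = c • b x y) :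
    X →L[ℝ] Y →L[ℝ] Z :=
  LinearMap.toContinuousLinearMap
    { toFun := fun x => LinearMap.toContinuousLinearMap
        { toFun := b x
          map_add' := h3 x
          map_smul' := fun c y => h4 c x y }
      map_add' := fun x x' => by ext y; exact h1 x x' y
      map_smul' := fun c x => by ext y; exact h2 c x y }

theorem contDiffAt_bilin {b : X → Y → Z}
    (h1 : ∀ x x' y, b (x + x') y = b x y + b x' y) (h2 : ∀ (c : ℝ) x y, b (c • x) y = c • b x y)
    (h3 : ∀ x y y', b x (y + y') = b x y + b x y') (h4 : ∀ (c : ℝ) x y, b x (c • y) = c • b x y)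
    {f : E → X} {g : E → Y} {x : E} (hf : ContDiffAt ℝ ∞ f x) (hg : ContDiffAt ℝ ∞ g x) :
    ContDiffAt ℝ ∞ (fun y => b (f y) (g y)) x :=
  ((bilinL b h1 h2 h3 h4).contDiff.contDiffAt.comp x hf).clm_apply hg

theorem fderiv_bilin {b : X → Y → Z}
    (h1 : ∀ x x' y, b (x + x') y = b x y + b x' y) (h2 : ∀ (c : ℝ) x y, b (c • x) y = c • b x y)
    (h3 : ∀ x y y', b x (y + y') = b x y + b x y') (h4 : ∀ (c : ℝ) x y, b x (c • y) = c • b x y)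
    {f : E → X} {g : E → Y} {x : E} (hf : DifferentiableAt ℝ f x) (hg : DifferentiableAt ℝ g x)
    (v : E) : fderiv ℝ (fun y => b (f y) (g y)) x v =
      b (fderiv ℝ f x v) (g x) + b (f x) (fderiv ℝ g x v) := by
  have := (((bilinL b h1 h2 h3 h4).hasFDerivAt.comp x hf.hasFDerivAt).clm_apply
    hg.hasFDerivAt).fderiv
  change fderiv ℝ (fun y => b (f y) (g y)) x = _ at this
  rw [this, add_comm]
  rfl

theorem contDiffAt_linear (L : X →ₗ[ℝ] Z) {f : E → X} {x : E} (hf : ContDiffAt ℝ ∞ f x) :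
    ContDiffAt ℝ ∞ (fun y => L (f y)) x :=
  (LinearMap.toContinuousLinearMap L).contDiff.contDiffAt.comp x hf

theorem fderiv_linear (L : X →ₗ[ℝ] Z) {f : E → X} {x : E} (hf : DifferentiableAt ℝ f x) (v : E) :
    fderiv ℝ (fun y => L (f y)) x v = L (fderiv ℝ f x v) := by
  have := ((LinearMap.toContinuousLinearMap L).hasFDerivAt.comp x hf.hasFDerivAt).fderiv
  change fderiv ℝ (fun y => L (f y)) x = _ at this
  rw [this]
  rfl

end Bilinear

theorem wedge_real_smul_left {k l m : ℕ} (c : ℝ) (α : V [⋀^Fin k]→L[ℝ] A)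
    (β : V [⋀^Fin l]→L[ℝ] A) : wedge m (c • α) β = c • wedge m α β := by
  by_cases h : k + l = m
  · ext v
    simp only [ContinuousAlternatingMap.smul_apply, wedge_apply h, smul_mul_assoc, altSum_smul]
    rw [smul_comm c]
  · ext v
    simp [wedge_of_ne h]

theorem wedge_real_smul_right {k l m : ℕ} (c : ℝ) (α : V [⋀^Fin k]→L[ℝ] A)
    (β : V [⋀^Fin l]→L[ℝ] A) : wedge m α (c • β) = c • wedge m α β := by
  by_cases h : k + l = m
  · ext v
    simp only [ContinuousAlternatingMap.smul_apply, wedge_apply h, mul_smul_comm, altSum_smul]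
    rw [smul_comm c]
  · ext v
    simp [wedge_of_ne h]

/-- Smoothness at a point of a family of inhomogeneous forms. -/
def SmoothAt (F : E → Ext V A) (x : E) : Prop :=
  ∀ k, ContDiffAt ℝ ∞ (fun y => (F y).coeff k) x

/-- The derivative of a family of inhomogeneous forms in the direction `v`. -/
def dirD (F : E → Ext V A) (x v : E) : Ext V A :=
  mk fun k => fderiv ℝ (fun y => (F y).coeff k) x v

@[simp] theorem coeff_dirD (F : E → Ext V A) (x v : E) (k : ℕ) :
    (dirD F x v).coeff k = fderiv ℝ (fun y => (F y).coeff k) x v := rfl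

section

variable {F G : E → Ext V A} {x : E}

theorem SmoothAt.differentiableAt (hF : SmoothAt F x) (k : ℕ) :
    DifferentiableAt ℝ (fun y => (F y).coeff k) x :=
  (hF k).differentiableAt (by simp)

theorem smoothAt_const (X : Ext V A) : SmoothAt (fun _ : E => X) x := fun _ => contDiffAt_const

theorem SmoothAt.add (hF : SmoothAt F x) (hG : SmoothAt G x) :
    SmoothAt (fun y => F y + G y) x := fun k => (hF k).add (hG k)

theorem SmoothAt.neg (hF : SmoothAt F x) : SmoothAt (fun y => -F y) x := fun k => (hF k).neg

theorem SmoothAt.sum {ι : Type*} {s : Finset ι} {H : ι → E → Ext V A}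
    (hH : ∀ i ∈ s, SmoothAt (H i) x) : SmoothAt (fun y => ∑ i ∈ s, H i y) x := fun k => by
  simp only [coeff_sum]
  exact ContDiffAt.sum fun i hi => hH i hi k

theorem SmoothAt.smul {f : E → ℝ} (hf : ContDiffAt ℝ ∞ f x) (hF : SmoothAt F x) :
    SmoothAt (fun y => f y • F y) x := fun k => hf.smul (hF k)

theorem SmoothAt.mul (hF : SmoothAt F x) (hG : SmoothAt G x) :
    SmoothAt (fun y => F y * G y) x := fun k => by
  simp only [coeff_mul]
  refine ContDiffAt.sum fun ij _ => ?_
  exact contDiffAt_bilin wedge_add_left wedge_real_smul_left wedge_add_right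
    wedge_real_smul_right (hF ij.1) (hG ij.2)

theorem SmoothAt.pow (hF : SmoothAt F x) (p : ℕ) : SmoothAt (fun y => F y ^ p) x := by
  induction p with
  | zero => simpa using smoothAt_const _
  | succ p ih => simpa only [pow_succ] using ih.mul hF

theorem SmoothAt.list_prod {ι : Type*} (l : List ι) {H : ι → E → Ext V A}
    (hH : ∀ i, SmoothAt (H i) x) : SmoothAt (fun y => (l.map fun i => H i y).prod) x := by
  induction l with
  | nil => simpa using smoothAt_const _
  | cons a l ih => simpa only [List.map_cons, List.prod_cons] using (hH a).mul ih

/-- The component of degree `k` of a linear map regarded as a form. -/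
def linCoeff (k : ℕ) : (V →L[ℝ] A) →ₗ[ℝ] V [⋀^Fin k]→L[ℝ] A where
  toFun a := (lin a).coeff k
  map_add' a b := by rw [map_add]; rfl
  map_smul' c a := by rw [map_smul]; rfl

theorem smoothAt_lin {a : E → V →L[ℝ] A} (ha : ContDiffAt ℝ ∞ a x) :
    SmoothAt (fun y => lin (a y)) x := fun k => contDiffAt_linear (linCoeff k) ha

theorem dirD_const (X : Ext V A) (v : E) : dirD (fun _ : E => X) x v = 0 := by
  ext1 k
  rw [coeff_dirD]
  simp

theorem dirD_add (hF : SmoothAt F x) (hG : SmoothAt G x) (v : E) :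
    dirD (fun y => F y + G y) x v = dirD F x v + dirD G x v := by
  ext1 k
  simp only [coeff_dirD, coeff_add]
  rw [fderiv_fun_add (hF.differentiableAt k) (hG.differentiableAt k)]
  rfl

theorem dirD_neg (v : E) : dirD (fun y => -F y) x v = -dirD F x v := by
  ext1 k
  simp only [coeff_dirD, coeff_neg]
  rw [fderiv_fun_neg]
  rfl

theorem dirD_sum {ι : Type*} {s : Finset ι} {H : ι → E → Ext V A}
    (hH : ∀ i ∈ s, SmoothAt (H i) x) (v : E) :
    dirD (fun y => ∑ i ∈ s, H i y) x v = ∑ i ∈ s, dirD (H i) x v := by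
  ext1 k
  simp only [coeff_dirD, coeff_sum]
  rw [fderiv_fun_sum fun i hi => (hH i hi).differentiableAt k]
  simp

theorem dirD_smul {f : E → ℝ} (hf : ContDiffAt ℝ ∞ f x) (hF : SmoothAt F x) (v : E) :
    dirD (fun y => f y • F y) x v = fderiv ℝ f x v • F x + f x • dirD F x v := by
  ext1 k
  simp only [coeff_dirD, coeff_smul, coeff_add]
  rw [fderiv_fun_smul (hf.differentiableAt (by simp)) (hF.differentiableAt k)]
  simp [add_comm]

theorem dirD_mul (hF : SmoothAt F x) (hG : SmoothAt G x) (v : E) :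
    dirD (fun y => F y * G y) x v = dirD F x v * G x + F x * dirD G x v := by
  ext1 k
  have h : ∀ ij : ℕ × ℕ, ContDiffAt ℝ ∞
      (fun y => wedge k ((F y).coeff ij.1) ((G y).coeff ij.2)) x := fun ij =>
    contDiffAt_bilin wedge_add_left wedge_real_smul_left wedge_add_right
      wedge_real_smul_right (hF ij.1) (hG ij.2)
  simp only [coeff_dirD, coeff_mul, coeff_add]
  rw [fderiv_fun_sum fun ij _ => (h ij).differentiableAt (by simp)]
  rw [_root_.sum_apply, ← Finset.sum_add_distrib]
  refine Finset.sum_congr rfl fun ij _ => ?_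
  exact fderiv_bilin wedge_add_left wedge_real_smul_left wedge_add_right
      wedge_real_smul_right (hF.differentiableAt ij.1) (hG.differentiableAt ij.2) v

end

section ExteriorDerivative

variable {F G : V → Ext V A} {x : V}

/-- The coordinates of a basis of `V`, as continuous linear maps. -/
def coordL (V : Type*) [NormedAddCommGroup V] [NormedSpace ℝ V] [FiniteDimensional ℝ V]
    (i : Fin (Module.finrank ℝ V)) : V →L[ℝ] ℝ :=
  LinearMap.toContinuousLinearMap ((Module.finBasis ℝ V).coord i)

/-- The exterior derivative of an inhomogeneous form. -/
def dd (F : V → Ext V A) (x : V) : Ext V A :=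
  ∑ i, scal (coordL V i) * dirD F x (Module.finBasis ℝ V i)

theorem sum_coordL_smul {M : Type*} [AddCommGroup M] [Module ℝ M] [TopologicalSpace M]
    (f : V →L[ℝ] M) (v : V) :
    ∑ i, coordL V i v • f (Module.finBasis ℝ V i) = f v := by
  conv_rhs => rw [← (Module.finBasis ℝ V).sum_repr v]
  rw [map_sum]
  exact Finset.sum_congr rfl fun i _ => (map_smul f _ _).symm

/-- Expanding the direction `v i` in the basis identifies `∑ eⁱ ∧ ∂_i` with `extDeriv`. The exterior
derivative can then be computed in the ring `Ext V A`, where the Leibniz rule is formal. -/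
theorem coeff_dd (F : V → Ext V A) (x : V) (k : ℕ) :
    (dd F x).coeff (k + 1) = extDeriv (fun y => (F y).coeff k) x := by
  ext v
  rw [dd, coeff_sum, ContinuousAlternatingMap.sum_apply, extDeriv,
    ContinuousAlternatingMap.alternatizeUncurryFin_apply]
  simp only [coeff_scal_mul_succ]
  rw [Finset.sum_comm]
  refine Finset.sum_congr rfl fun i _ => ?_
  rw [← Finset.smul_sum]
  congr 1
  rw [← sum_coordL_smul (fderiv ℝ (fun y => (F y).coeff k) x) (v i)]
  simp [ContinuousAlternatingMap.sum_apply, coeff_dirD]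

/-- In the second term of the product rule for each `∂_i`, the scalar 1-form has to cross `F x`;
this is where `gradeInv` comes from. -/
theorem dd_mul (hF : SmoothAt F x) (hG : SmoothAt G x) :
    dd (fun y => F y * G y) x = dd F x * G x + gradeInv (F x) * dd G x := by
  simp only [dd, dirD_mul hF hG, mul_add, Finset.sum_add_distrib, Finset.sum_mul, Finset.mul_sum]
  congr 1
  · exact Finset.sum_congr rfl fun i _ => (mul_assoc _ _ _).symm
  · refine Finset.sum_congr rfl fun i _ => ?_
    rw [← mul_assoc, scal_mul_comm, mul_assoc]

theorem dd_add (hF : SmoothAt F x) (hG : SmoothAt G x) :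
    dd (fun y => F y + G y) x = dd F x + dd G x := by
  simp only [dd, dirD_add hF hG, mul_add, Finset.sum_add_distrib]

theorem dd_neg : dd (fun y => -F y) x = -dd F x := by
  simp only [dd, dirD_neg, mul_neg, Finset.sum_neg_distrib]

theorem dd_sum {ι : Type*} {s : Finset ι} {H : ι → V → Ext V A}
    (hH : ∀ i ∈ s, SmoothAt (H i) x) :
    dd (fun y => ∑ i ∈ s, H i y) x = ∑ i ∈ s, dd (H i) x := by
  simp only [dd, dirD_sum hH, Finset.mul_sum]
  rw [Finset.sum_comm]

theorem dd_smul {f : V → ℝ} (hf : ContDiffAt ℝ ∞ f x) (hF : SmoothAt F x) :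
    dd (fun y => f y • F y) x = scal (fderiv ℝ f x) * F x + f x • dd F x := by
  simp only [dd, dirD_smul hf hF, mul_add, Finset.sum_add_distrib, mul_smul_comm, Finset.smul_sum]
  congr 1
  rw [← Finset.sum_congr rfl fun i _ => smul_mul_assoc _ _ _, ← Finset.sum_mul]
  congr 1
  simp only [← map_smul, ← map_sum]
  congr 1
  ext v
  rw [← sum_coordL_smul (fderiv ℝ f x) v]
  simp [mul_comm]

theorem dd_const (X : Ext V A) : dd (fun _ : V => X) x = 0 := by
  simp [dd, dirD_const]

end ExteriorDerivative

end Ext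

namespace Ext

/-! ### Algebra of the curvature, gauge shifts and traces. -/

section Algebra

variable {V : Type*} [NormedAddCommGroup V] [NormedSpace ℝ V]
variable {W : Type*} [NormedAddCommGroup W] [NormedSpace ℝ W]
variable {A : Type*} [NormedRing A] [NormedAlgebra ℝ A]
variable {B : Type*} [NormedRing B] [NormedAlgebra ℝ B]
variable {m : ℕ}

/-- The curvature `-∑ τ_j ψ_j - ∑ t_j ψ_j² + (∑ t_j ψ_j)²` of the connection `-∑ t_j ψ_j`,
where `dt_j = τ_j` and `dψ_j = ψ_j²`. -/
def curv (t : Fin m → ℝ) (τ : Fin m → V →L[ℝ] ℝ) (ψ : Fin m → V →L[ℝ] A) : Ext V A :=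
  -(∑ j, scal (τ j) * lin (ψ j)) - ∑ j, t j • lin (ψ j) ^ 2 + (∑ j, t j • lin (ψ j)) ^ 2

theorem comap_curv (f : W →L[ℝ] V) (t : Fin m → ℝ) (τ : Fin m → V →L[ℝ] ℝ)
    (ψ : Fin m → V →L[ℝ] A) :
    comap f (curv t τ ψ) = curv t (fun j => τ j ∘L f) (fun j => ψ j ∘L f) := by
  simp only [curv, map_add, map_sub, map_neg, map_sum, _root_.map_mul, map_pow, comap_smul,
    comap_lin, comap_scal]

theorem map_pow (c : A →L[ℝ] B) (h1 : c 1 = 1) (hc : ∀ x y, c (x * y) = c x * c y) (X : Ext V A)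
    (p : ℕ) : map c (X ^ p) = map c X ^ p := by
  induction p with
  | zero => rw [pow_zero, pow_zero, map_one c h1]
  | succ p ih => rw [pow_succ, pow_succ, map_mul c hc, ih]

theorem map_curv (c : A →L[ℝ] B) (h1 : c 1 = 1) (hc : ∀ x y, c (x * y) = c x * c y)
    (t : Fin m → ℝ) (τ : Fin m → V →L[ℝ] ℝ) (ψ : Fin m → V →L[ℝ] A) :
    map c (curv t τ ψ) = curv t τ (fun j => c ∘L ψ j) := by
  simp only [curv, _root_.map_add, map_sub, map_neg, map_sum, map_mul c hc, map_pow c h1 hc,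
    map_smul, map_lin, map_scal c h1]

/-- Because `∑ t_j = 1`, the cross terms and the `a²` produced by `-∑ t_j (ψ_j + a)²` cancel those
of `(∑ t_j ψ_j + a)²`; the terms with `τ_j` do not change because `∑ τ_j = 0`. No condition on `da`
enters, since `curv` contains no derivative: `dψ_j` is already replaced by `ψ_j²`. -/
theorem curv_add_const (t : Fin m → ℝ) (τ : Fin m → V →L[ℝ] ℝ) (ψ : Fin m → V →L[ℝ] A)
    (a : V →L[ℝ] A) (ht : ∑ j, t j = 1) (hτ : ∑ j, τ j = 0) :
    curv t τ (fun j => ψ j + a) = curv t τ ψ := by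
  simp only [curv, _root_.map_add, mul_add, Finset.sum_add_distrib, smul_add]
  rw [← Finset.sum_mul, ← map_sum, hτ, map_zero, zero_mul, add_zero, ← Finset.sum_smul, ht,
    one_smul]
  have e : ∀ j, t j • (lin (ψ j) + lin a) ^ 2 = t j • lin (ψ j) ^ 2 + t j • lin (ψ j) * lin a +
      lin a * t j • lin (ψ j) + t j • lin a ^ 2 := fun j => by
    rw [sq, sq, sq, add_mul, mul_add, mul_add, smul_add, smul_add, smul_add, smul_mul_assoc,
      mul_smul_comm]
    abel
  simp only [e, Finset.sum_add_distrib, ← Finset.sum_mul, ← Finset.mul_sum, ← Finset.sum_smul, ht]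
  rw [one_smul, sq (_ + _), add_mul, mul_add, mul_add, sq (lin a), sq (∑ j, t j • lin (ψ j))]
  abel

/-- This is restriction to the face `t_i = 0` of the simplex, where `ψ_i` drops out. -/
theorem curv_insertNth (i : Fin (m + 1)) (t : Fin m → ℝ) (τ : Fin m → V →L[ℝ] ℝ)
    (ψ : Fin (m + 1) → V →L[ℝ] A) :
    curv (i.insertNth 0 t) (i.insertNth 0 τ) ψ = curv t τ (fun j => ψ (i.succAbove j)) := by
  simp only [curv, Fin.sum_univ_succAbove _ i, Fin.insertNth_apply_same,
    Fin.insertNth_apply_succAbove, map_zero, zero_mul, zero_smul, zero_add]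

/-- All terms are products of two 1-forms, so the curvature is even; the Leibniz rule for its powers
and their cyclicity under the trace therefore carry no signs. -/
theorem gradeInv_curv (t : Fin m → ℝ) (τ : Fin m → V →L[ℝ] ℝ) (ψ : Fin m → V →L[ℝ] A) :
    gradeInv (curv t τ ψ) = curv t τ ψ := by
  simp only [curv, _root_.map_add, map_sub, map_neg, map_sum, _root_.map_mul, _root_.map_pow,
    gradeInv_smul, gradeInv_lin, gradeInv_scal, neg_mul_neg, neg_sq, smul_neg,
    Finset.sum_neg_distrib]

/-- The elements of the graded ring that commute with all elements under the trace `τ`. -/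
def TraceComm (τ : A →L[ℝ] B) (X : Ext V A) : Prop :=
  ∀ Y, map τ (X * Y) = map τ (Y * X)

variable {τ : A →L[ℝ] B} {X Y : Ext V A}

theorem traceComm_lin_mul_lin (hτ : ∀ x y, τ (x * y) = τ (y * x)) (a b : V →L[ℝ] A) :
    TraceComm τ (lin a * lin b) := map_trace_comm τ hτ a b

theorem TraceComm.sum {ι : Type*} {s : Finset ι} {F : ι → Ext V A}
    (hF : ∀ i ∈ s, TraceComm τ (F i)) : TraceComm τ (∑ i ∈ s, F i) := fun Z => by
  rw [Finset.sum_mul, Finset.mul_sum, map_sum, map_sum]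
  exact Finset.sum_congr rfl fun i hi => hF i hi Z

theorem TraceComm.smul (hX : TraceComm τ X) (c : ℝ) : TraceComm τ (c • X) :=
  fun Z => by rw [smul_mul_assoc, mul_smul_comm, map_smul, map_smul, hX]

theorem TraceComm.pow (hX : TraceComm τ X) (p : ℕ) : TraceComm τ (X ^ p) := by
  induction p with
  | zero => intro Z; simp
  | succ p ih => intro Z; rw [pow_succ, mul_assoc, ih, mul_assoc, hX, mul_assoc]

/-- If `D Z D = 0` for all `Z`, then `(D + B)^p` is affine in `D`; under the trace its linear part
is `p D B^{p-1}`. -/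
theorem map_add_pow {D B : Ext V A} (hD : ∀ Z, D * Z * D = 0) (hB : TraceComm τ B) (p : ℕ) :
    map τ ((D + B) ^ (p + 1)) = map τ (B ^ (p + 1)) + (p + 1 : ℝ) • map τ (D * B ^ p) := by
  -- A word with two letters `D` contains some `D Z D` and vanishes, so the power is `B ^ q` plus a
  -- sum over the position of a single `D`. Cyclicity of the trace then makes all positions equal.
  have h : ∀ q : ℕ, (D + B) ^ q = B ^ q + ∑ i ∈ Finset.range q, B ^ i * D * B ^ (q - 1 - i) := by
    intro q
    induction q with
    | zero => simp
    | succ q ih =>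
      rw [pow_succ, ih, add_mul, mul_add, mul_add, Finset.sum_mul, Finset.sum_mul,
        Finset.sum_range_succ]
      have e1 : ∑ i ∈ Finset.range q, B ^ i * D * B ^ (q - 1 - i) * D = 0 :=
        Finset.sum_eq_zero fun i _ => by
          rw [mul_assoc (B ^ i), mul_assoc (B ^ i), hD, mul_zero]
      have e2 : ∑ i ∈ Finset.range q, B ^ i * D * B ^ (q - 1 - i) * B =
          ∑ i ∈ Finset.range q, B ^ i * D * B ^ (q + 1 - 1 - i) := by
        refine Finset.sum_congr rfl fun i hi => ?_
        rw [mul_assoc, ← pow_succ]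
        have := Finset.mem_range.1 hi
        rw [show q - 1 - i + 1 = q + 1 - 1 - i by omega]
      rw [e1, e2, zero_add, ← pow_succ, Nat.add_sub_cancel, Nat.sub_self, pow_zero, mul_one]
      abel
  rw [h, _root_.map_add, map_sum]
  congr 1
  have e : ∀ i ∈ Finset.range (p + 1), map τ (B ^ i * D * B ^ (p + 1 - 1 - i)) =
      map τ (D * B ^ p) := fun i hi => by
    have := Finset.mem_range.1 hi
    rw [mul_assoc, hB.pow i, mul_assoc, ← pow_add, show p + 1 - 1 - i + i = p by omega]
  rw [Finset.sum_congr rfl e, Finset.sum_const, Finset.card_range, ← Nat.cast_smul_eq_nsmul ℝ]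
  push_cast
  rfl

/-- The second copy of the scalar 1-form can be brought next to the first, where `scal_sq` applies.
This supplies the hypothesis `D * Z * D = 0` of `map_add_pow` for a letter `D = e ∧ f`. -/
theorem scal_mul_mul_scal_mul (e : V →L[ℝ] ℝ) (X Y Z : Ext V A) :
    scal e * X * Z * (scal e * Y) = 0 := by
  rw [mul_assoc (scal e), scal_mul_comm e (X * Z), mul_assoc, ← mul_assoc (scal e), scal_sq,
    zero_mul, mul_zero]

end Algebra

/-! ### The Bianchi identity and closedness of the traces. -/

section Bianchi

variable {V : Type*} [NormedAddCommGroup V] [NormedSpace ℝ V] [FiniteDimensional ℝ V]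
variable {A : Type*} [NormedRing A] [NormedAlgebra ℝ A] [FiniteDimensional ℝ A]
variable {B : Type*} [NormedRing B] [NormedAlgebra ℝ B] [FiniteDimensional ℝ B]
variable {m : ℕ} {t : V → Fin m → ℝ} {τ : Fin m → V →L[ℝ] ℝ} {ψ : V → Fin m → V →L[ℝ] A} {x : V}

theorem smoothAt_curv (ht : ∀ j, ContDiffAt ℝ ∞ (fun y => t y j) x)
    (hψ : ∀ j, ContDiffAt ℝ ∞ (fun y => ψ y j) x) :
    SmoothAt (fun y => curv (t y) τ (ψ y)) x := by
  simp only [curv, sub_eq_add_neg]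
  refine ((SmoothAt.neg (SmoothAt.sum fun j _ => ?_)).add
    (SmoothAt.neg (SmoothAt.sum fun j _ => ?_))).add
    (SmoothAt.pow (SmoothAt.sum fun j _ => ?_) 2)
  · exact (smoothAt_const _).mul (smoothAt_lin (hψ j))
  · exact SmoothAt.smul (ht j) ((smoothAt_lin (hψ j)).pow 2)
  · exact SmoothAt.smul (ht j) (smoothAt_lin (hψ j))

/-- The Bianchi identity. -/
theorem dd_curv (ht : ∀ j, ContDiffAt ℝ ∞ (fun y => t y j) x)
    (hτ : ∀ j, fderiv ℝ (fun y => t y j) x = τ j)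
    (hψ : ∀ j, ContDiffAt ℝ ∞ (fun y => ψ y j) x)
    (hd : ∀ j, dd (fun y => lin (ψ y j)) x = lin (ψ x j) ^ 2) :
    dd (fun y => curv (t y) τ (ψ y)) x =
      (∑ j, t x j • lin (ψ x j)) * curv (t x) τ (ψ x) -
        curv (t x) τ (ψ x) * ∑ j, t x j • lin (ψ x j) := by
  have s1 : ∀ j, SmoothAt (fun y => lin (ψ y j)) x := fun j => smoothAt_lin (hψ j)
  have s2 : ∀ j, SmoothAt (fun y => t y j • lin (ψ y j)) x := fun j => SmoothAt.smul (ht j) (s1 j)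
  have s3 : ∀ j, SmoothAt (fun y => lin (ψ y j) * lin (ψ y j)) x := fun j => (s1 j).mul (s1 j)
  have s4 : ∀ j, SmoothAt (fun y => t y j • (lin (ψ y j) * lin (ψ y j))) x := fun j =>
    SmoothAt.smul (ht j) (s3 j)
  have s5 : ∀ j, SmoothAt (fun y => scal (τ j) * lin (ψ y j)) x := fun j =>
    (smoothAt_const _).mul (s1 j)
  have s6 : SmoothAt (fun y => ∑ j, t y j • lin (ψ y j)) x := SmoothAt.sum fun j _ => s2 j
  have e3 : ∀ j, dd (fun y => lin (ψ y j) * lin (ψ y j)) x = 0 := fun j => by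
    rw [dd_mul (s1 j) (s1 j), hd, gradeInv_lin, sq, mul_assoc, neg_mul, add_neg_cancel]
  have e6 : dd (fun y => ∑ j, t y j • lin (ψ y j)) x =
      ∑ j, scal (τ j) * lin (ψ x j) + ∑ j, t x j • lin (ψ x j) ^ 2 := by
    rw [dd_sum fun j _ => s2 j, ← Finset.sum_add_distrib]
    exact Finset.sum_congr rfl fun j _ => by rw [dd_smul (ht j) (s1 j), hτ, hd]
  have e5 : ∀ j, dd (fun y => scal (τ j) * lin (ψ y j)) x = -(scal (τ j) * lin (ψ x j) ^ 2) :=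
    fun j => by rw [dd_mul (smoothAt_const _) (s1 j), dd_const, gradeInv_scal, hd, zero_mul,
      zero_add, neg_mul]
  have e4 : ∀ j, dd (fun y => t y j • (lin (ψ y j) * lin (ψ y j))) x =
      scal (τ j) * lin (ψ x j) ^ 2 := fun j => by
    rw [dd_smul (ht j) (s3 j), e3, hτ, smul_zero, add_zero, sq]
  have hg : gradeInv (∑ j, t x j • lin (ψ x j)) = -∑ j, t x j • lin (ψ x j) := by
    simp only [map_sum, gradeInv_smul, gradeInv_lin, smul_neg, Finset.sum_neg_distrib]
  -- With `A = ∑ t_j ψ_j`: the derivatives of the first two parts of `curv` are `τ_j ψ_j²` with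
  -- opposite signs and cancel, so only `d(A²) = dA · A - A · dA` remains.
  have e0 : dd (fun y => curv (t y) τ (ψ y)) x =
      dd (fun y => ∑ j, t y j • lin (ψ y j)) x * (∑ j, t x j • lin (ψ x j)) -
      (∑ j, t x j • lin (ψ x j)) * dd (fun y => ∑ j, t y j • lin (ψ y j)) x := by
    simp only [curv, sub_eq_add_neg, sq]
    rw [dd_add ((SmoothAt.neg (SmoothAt.sum fun j _ => s5 j)).add
        (SmoothAt.neg (SmoothAt.sum fun j _ => s4 j))) (s6.mul s6),
      dd_add (SmoothAt.neg (SmoothAt.sum fun j _ => s5 j))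
        (SmoothAt.neg (SmoothAt.sum fun j _ => s4 j)), dd_neg, dd_neg, dd_sum fun j _ => s5 j,
      dd_sum fun j _ => s4 j, dd_mul s6 s6, hg]
    simp only [e4, e5, Finset.sum_neg_distrib, neg_neg, neg_mul]
    abel
  -- The structure equation `dA = A² - K`. Inserted into `dA · A - A · dA`, the cubes of `A` cancel
  -- and the commutator of `A` and `K` is left.
  have e7 : dd (fun y => ∑ j, t y j • lin (ψ y j)) x =
      (∑ j, t x j • lin (ψ x j)) ^ 2 - curv (t x) τ (ψ x) := by
    rw [e6, curv]
    abel
  rw [e0, e7]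
  simp only [sub_mul, mul_sub, sq, mul_assoc]
  abel

/-- The commutator with `A` is a derivation, and `d` acts on powers of the even element `K` as a
derivation without signs, so the Bianchi identity passes to powers. -/
theorem dd_curv_pow (ht : ∀ j, ContDiffAt ℝ ∞ (fun y => t y j) x)
    (hτ : ∀ j, fderiv ℝ (fun y => t y j) x = τ j)
    (hψ : ∀ j, ContDiffAt ℝ ∞ (fun y => ψ y j) x)
    (hd : ∀ j, dd (fun y => lin (ψ y j)) x = lin (ψ x j) ^ 2) (p : ℕ) :
    dd (fun y => curv (t y) τ (ψ y) ^ p) x =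
      (∑ j, t x j • lin (ψ x j)) * curv (t x) τ (ψ x) ^ p -
        curv (t x) τ (ψ x) ^ p * ∑ j, t x j • lin (ψ x j) := by
  induction p with
  | zero => simp [dd_const]
  | succ p ih =>
    simp only [pow_succ]
    rw [dd_mul ((smoothAt_curv ht hψ).pow p) (smoothAt_curv ht hψ), ih, dd_curv ht hτ hψ hd,
      _root_.map_pow, gradeInv_curv]
    simp only [sub_mul, mul_sub, mul_assoc]
    abel

theorem SmoothAt.map {E : Type*} [NormedAddCommGroup E] [NormedSpace ℝ E] {F : E → Ext V A} {x : E}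
    (hF : SmoothAt F x) (c : A →L[ℝ] B) : SmoothAt (fun y => Ext.map c (F y)) x := fun k =>
  contDiffAt_linear
    ({ toFun := fun w => c.compContinuousAlternatingMap w
       map_add' := fun a b => by ext; simp
       map_smul' := fun r a => by ext; simp } : (V [⋀^Fin k]→L[ℝ] A) →ₗ[ℝ] V [⋀^Fin k]→L[ℝ] B)
    (hF k)

theorem dd_map {F : V → Ext V A} (hF : SmoothAt F x) (c : A →L[ℝ] B) :
    dd (fun y => map c (F y)) x = map c (dd F x) := by
  have h : ∀ v, dirD (fun y => map c (F y)) x v = map c (dirD F x v) := fun v => by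
    ext1 k
    exact fderiv_linear
      ({ toFun := fun w => c.compContinuousAlternatingMap w
         map_add' := fun a b => by ext; simp
         map_smul' := fun r a => by ext; simp } : (V [⋀^Fin k]→L[ℝ] A) →ₗ[ℝ] V [⋀^Fin k]→L[ℝ] B)
      (hF.differentiableAt k) v
  have h2 : ∀ (e : V →L[ℝ] ℝ) (X : Ext V A), map c (scal e * X) = scal e * map c X := by
    intro e X
    ext k v
    rcases k with _ | k
    · rw [coeff_map, coeff_scal_mul_zero, coeff_scal_mul_zero]
      simp
    · rw [coeff_map, coeff_scal_mul_succ, ContinuousLinearMap.compContinuousAlternatingMap_coe,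
        Function.comp_apply, coeff_scal_mul_succ]
      simp [map_sum, coeff_map, map_zsmul, -zsmul_eq_mul]
  simp only [dd, h, map_sum, h2]

/-- The trace of a power of the curvature is closed. -/
theorem dd_map_curv_pow (c : A →L[ℝ] B) (hc : ∀ x y, c (x * y) = c (y * x))
    (ht : ∀ j, ContDiffAt ℝ ∞ (fun y => t y j) x)
    (hτ : ∀ j, fderiv ℝ (fun y => t y j) x = τ j)
    (hψ : ∀ j, ContDiffAt ℝ ∞ (fun y => ψ y j) x)
    (hd : ∀ j, dd (fun y => lin (ψ y j)) x = lin (ψ x j) ^ 2) (p : ℕ) :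
    dd (fun y => map c (curv (t y) τ (ψ y) ^ p)) x = 0 := by
  rw [dd_map ((smoothAt_curv ht hψ).pow p), dd_curv_pow ht hτ hψ hd]
  have : ∑ j, t x j • lin (ψ x j) = lin (∑ j, t x j • ψ x j) := by
    simp only [map_sum, map_smul]
  -- The power of the curvature is even, so the 1-form `A` commutes with it under the trace without
  -- a sign.
  rw [this, map_sub, map_lin_mul_comm c _ fun x y => hc _ _, _root_.map_pow, gradeInv_curv,
    sub_self]

end Bianchi

end Ext

/-! ### Logarithmic derivatives and the Maurer-Cartan equation. -/

section MaurerCartan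

variable {E : Type*} [NormedAddCommGroup E] [NormedSpace ℝ E]
variable {V : Type*} [NormedAddCommGroup V] [NormedSpace ℝ V]
variable {A : Type*} [NormedRing A] [NormedAlgebra ℝ A] [CompleteSpace A]

/-- The logarithmic derivative `df f⁻¹` of an algebra-valued function. -/
def mc (f : V → A) (x : V) : V →L[ℝ] A :=
  (ContinuousLinearMap.mul ℝ A).flip (Ring.inverse (f x)) ∘L fderiv ℝ f x

theorem mc_apply (f : V → A) (x v : V) : mc f x v = fderiv ℝ f x v * Ring.inverse (f x) := rfl

theorem contDiffAt_inverse {f : V → A} {x : V} (hf : ContDiffAt ℝ ∞ f x) (hu : IsUnit (f x)) :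
    ContDiffAt ℝ ∞ (fun y => Ring.inverse (f y)) x := by
  obtain ⟨u, hu⟩ := hu
  have := contDiffAt_ringInverse ℝ (n := ∞) u
  rw [hu] at this
  exact this.comp x hf

theorem fderiv_inverse_comp {f : V → A} {x : V} (hf : DifferentiableAt ℝ f x) (hu : IsUnit (f x))
    (v : V) : fderiv ℝ (fun y => Ring.inverse (f y)) x v =
      -(Ring.inverse (f x) * fderiv ℝ f x v * Ring.inverse (f x)) := by
  obtain ⟨u, hu⟩ := hu
  have h1 := hasFDerivAt_ringInverse (𝕜 := ℝ) u
  rw [hu] at h1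
  have h2 := (h1.comp x hf.hasFDerivAt).fderiv
  change fderiv ℝ (fun y => Ring.inverse (f y)) x = _ at h2
  rw [h2, ← hu, Ring.inverse_unit]
  simp

theorem fderiv_mul_apply {f g : V → A} {x : V} (hf : DifferentiableAt ℝ f x)
    (hg : DifferentiableAt ℝ g x) (v : V) :
    fderiv ℝ (fun y => f y * g y) x v = f x * fderiv ℝ g x v + fderiv ℝ f x v * g x := by
  rw [fderiv_fun_mul' hf hg]
  simp

theorem contDiffAt_mc {f : V → A} {x : V} (hf : ContDiffAt ℝ ∞ f x) (hu : IsUnit (f x)) :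
    ContDiffAt ℝ ∞ (fun y => mc f y) x := by
  have h1 : ContDiffAt ℝ ∞ (fderiv ℝ f) x := hf.fderiv_right (by simp)
  have h2 : ContDiffAt ℝ ∞ (fun y => (ContinuousLinearMap.mul ℝ A).flip (Ring.inverse (f y))) x :=
    (ContinuousLinearMap.contDiff _).contDiffAt.comp x (contDiffAt_inverse hf hu)
  exact h2.clm_comp h1

theorem mc_comp {f : V → A} {g : E → V} {x : E} (hf : DifferentiableAt ℝ f (g x))
    (hg : DifferentiableAt ℝ g x) : mc f (g x) ∘L fderiv ℝ g x = mc (fun y => f (g y)) x := by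
  ext v
  have : fderiv ℝ (fun y => f (g y)) x = fderiv ℝ f (g x) ∘L fderiv ℝ g x :=
    fderiv_comp x hf hg
  simp [mc_apply, this]

theorem mc_congr {f g : V → A} {x : V} (h : f =ᶠ[nhds x] g) : mc f x = mc g x := by
  rw [mc, mc, h.fderiv_eq, h.eq_of_nhds]

/-- Conjugation by `u`. -/
def conjL (u : A) : A →L[ℝ] A := ContinuousLinearMap.mulLeftRight ℝ A u (Ring.inverse u)

theorem conjL_apply (u a : A) : conjL u a = u * a * Ring.inverse u := by
  simp [conjL]

theorem conjL_one {u : A} (hu : IsUnit u) : conjL u 1 = 1 := by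
  rw [conjL_apply, mul_one, Ring.mul_inverse_cancel u hu]

theorem conjL_mul {u : A} (hu : IsUnit u) (a b : A) : conjL u (a * b) = conjL u a * conjL u b := by
  simp only [conjL_apply]
  rw [show u * a * Ring.inverse u * (u * b * Ring.inverse u) =
    u * a * (Ring.inverse u * u) * b * Ring.inverse u by simp only [mul_assoc],
    Ring.inverse_mul_cancel u hu, mul_one, mul_assoc u a b]

theorem ring_inverse_mul {a b : A} (ha : IsUnit a) (hb : IsUnit b) :
    Ring.inverse (a * b) = Ring.inverse b * Ring.inverse a := by
  obtain ⟨u, rfl⟩ := ha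
  obtain ⟨v, rfl⟩ := hb
  rw [← Units.val_mul, Ring.inverse_unit, Ring.inverse_unit, Ring.inverse_unit, mul_inv_rev,
    Units.val_mul]

/-- The product rule, with `f f⁻¹` cancelling in the second term. For a family `u f_j` with common
factor `u` this is precisely the gauge change that traces of powers of the curvature do not see. -/
theorem mc_mul {u f : V → A} {x : V} (hu : DifferentiableAt ℝ u x) (hf : DifferentiableAt ℝ f x)
    (hux : IsUnit (u x)) (hfx : IsUnit (f x)) :
    mc (fun y => u y * f y) x = conjL (u x) ∘L mc f x + mc u x := by
  ext v
  simp only [mc_apply, _root_.add_apply, ContinuousLinearMap.comp_apply, conjL_apply]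
  rw [fderiv_mul_apply hu hf, ring_inverse_mul hux hfx, add_mul]
  congr 1
  · simp only [mul_assoc]
  · rw [mul_assoc, ← mul_assoc (f x), Ring.mul_inverse_cancel _ hfx, one_mul]

theorem mc_inverse {f : V → A} {x : V} (hf : DifferentiableAt ℝ f x) (hu : IsUnit (f x)) (v : V) :
    mc (fun y => Ring.inverse (f y)) x v = -(Ring.inverse (f x) * fderiv ℝ f x v) := by
  rw [mc_apply, fderiv_inverse_comp hf hu, Ring.inverse_inverse hu, neg_mul, mul_assoc,
    Ring.inverse_mul_cancel _ hu, mul_one]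

theorem Ext.coeff_lin_mul_lin (a b : V →L[ℝ] A) (v : Fin 2 → V) :
    (Ext.lin a * Ext.lin b).coeff 2 v = a (v 0) * b (v 1) - a (v 1) * b (v 0) := by
  rw [Ext.coeff_lin_mul_succ, Fin.sum_univ_two]
  simp [Ext.coeff_lin_one, Fin.removeNth, sub_eq_add_neg]
  rfl

theorem Ext.coeff_lin_of_ne (a : V →L[ℝ] A) {k : ℕ} (h : k ≠ 1) : (Ext.lin a).coeff k = 0 := by
  rw [Ext.lin_def, Ext.coeff_of_ne _ h]

theorem Ext.coeff_lin_mul_lin_of_ne (a b : V →L[ℝ] A) {k : ℕ} (h : k ≠ 2) :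
    (Ext.lin a * Ext.lin b).coeff k = 0 := by
  rcases k with _ | k
  · rw [Ext.coeff_lin_mul_zero]
  · ext v
    rw [Ext.coeff_lin_mul_succ, Ext.coeff_lin_of_ne b (by omega)]
    simp

variable [FiniteDimensional ℝ V] [FiniteDimensional ℝ A]

theorem Ext.coeff_dd_zero (F : V → Ext V A) (x : V) : (Ext.dd F x).coeff 0 = 0 := by
  rw [Ext.dd, Ext.coeff_sum]
  exact Finset.sum_eq_zero fun i _ => Ext.coeff_scal_mul_zero _ _

/-- The Maurer-Cartan equation. -/
theorem dd_lin_mc {f : V → A} {x : V} (hf : ContDiffAt ℝ ∞ f x) (hu : IsUnit (f x)) :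
    Ext.dd (fun y => Ext.lin (mc f y)) x = Ext.lin (mc f x) ^ 2 := by
  have hs := Ext.smoothAt_lin (contDiffAt_mc hf hu)
  ext k v
  rw [sq]
  rcases k with _ | k
  · rw [Ext.coeff_dd_zero, Ext.coeff_lin_mul_zero]
  by_cases hk : k = 1
  swap
  · rw [Ext.coeff_dd, Ext.coeff_lin_mul_lin_of_ne _ _ (by omega)]
    have : (fun y => (Ext.lin (mc f y)).coeff k) = fun _ => 0 :=
      funext fun y => Ext.coeff_lin_of_ne _ hk
    rw [this, extDeriv]
    simp [ContinuousAlternatingMap.alternatizeUncurryFin_apply]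
  subst hk
  rw [Ext.coeff_dd, Ext.coeff_lin_mul_lin, extDeriv_apply (hs.differentiableAt 1)]
  rw [Fin.sum_univ_two]
  simp only [Ext.coeff_lin_one]
  -- The derivative of `df f⁻¹` is a second derivative term minus a product of two values of `mc f`.
  -- Antisymmetrization removes the former by symmetry of second derivatives, and what remains is
  -- the square.
  have h1 : ∀ w v : V, fderiv ℝ (fun y => mc f y w) x v =
      fderiv ℝ (fderiv ℝ f) x v w * Ring.inverse (f x) - mc f x w * mc f x v := fun w v => by
    have hd : DifferentiableAt ℝ (fderiv ℝ f) x :=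
      (hf.fderiv_right (m := ∞) (by simp)).differentiableAt (by simp)
    have hi := (contDiffAt_inverse hf hu).differentiableAt (by simp)
    have hfx := hf.differentiableAt (by simp : (∞ : WithTop ℕ∞) ≠ 0)
    simp only [mc_apply]
    rw [fderiv_mul_apply (hd.clm_apply (differentiableAt_const w)) hi, fderiv_inverse_comp hfx hu]
    have : fderiv ℝ (fun y => fderiv ℝ f y w) x v = fderiv ℝ (fderiv ℝ f) x v w := by
      rw [fderiv_clm_apply hd (differentiableAt_const w)]
      simp
    rw [this]
    simp only [mul_neg, mul_assoc]
    abel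
  have hsym : IsSymmSndFDerivAt ℝ f x :=
    ContDiffAt.isSymmSndFDerivAt hf (by
      rw [minSmoothness_of_isRCLikeNormedField]
      exact WithTop.coe_le_coe.2 (le_top (a := (2 : ℕ∞))))
  have e1 : (1 : Fin 2).removeNth v = fun _ => v 0 := by
    funext i
    fin_cases i
    rfl
  have e0 : (0 : Fin 2).removeNth v = fun _ => v 1 := by
    funext i
    fin_cases i
    rfl
  simp only [e0, e1, h1, hsym (v 0) (v 1)]
  simp

end MaurerCartan

/-! ### Partial products, barycentric coordinates and the curvature form on the nerve. -/

section Geometry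

variable {n : ℕ}

/-- The product `h_1 ⋯ h_j`. -/
def pprod {r : ℕ} (h : Fin r → Mat n) (j : ℕ) : Mat n := ((List.ofFn h).take j).prod

theorem pprod_zero {r : ℕ} (h : Fin r → Mat n) : pprod h 0 = 1 := by simp [pprod]

theorem pprod_succ {r : ℕ} (h : Fin r → Mat n) {j : ℕ} (hj : j < r) :
    pprod h (j + 1) = pprod h j * h ⟨j, hj⟩ := by
  unfold pprod
  rw [List.prod_take_succ (List.ofFn h) j (by simpa using hj)]
  simp

theorem contDiff_pprod (r j : ℕ) (hj : j ≤ r) :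
    ContDiff ℝ ∞ fun h : Fin r → Mat n => pprod h j := by
  induction j with
  | zero => simpa only [pprod_zero] using contDiff_const
  | succ j ih =>
    have e : (fun h : Fin r → Mat n => pprod h (j + 1)) = fun h => pprod h j * h ⟨j, hj⟩ :=
      funext fun h => pprod_succ h hj
    rw [e]
    exact (ih (by omega)).mul (contDiff_apply ℝ (Mat n) _)

theorem isUnit_pprod {r : ℕ} {h : Fin r → Mat n} (hh : h ∈ GPow n r) {j : ℕ} (hj : j ≤ r) :
    IsUnit (pprod h j) := by
  induction j with
  | zero => simp [pprod_zero]
  | succ j ih =>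
    rw [pprod_succ h hj]
    exact (ih (by omega)).mul (hh _)

/-- A point of the nerve is a chain of vertices `v_j = h_1 ⋯ h_j` with `v_0 = 1`. The face operator
of index `i` drops `v_i` and renormalizes by dividing on the left by the first remaining vertex,
which differs from `1` only for `i = 0`. -/
theorem pprod_face {r : ℕ} (i : Fin (r + 2)) (y : Fin (r + 1) → Mat n) (j : Fin (r + 1)) :
    pprod y (i.succAbove 0 : Fin (r + 2)) * pprod (face n i y) j =
      pprod y (i.succAbove j : Fin (r + 2)) := by
  obtain ⟨j, hj⟩ := j
  induction j with
  | zero => rw [pprod_zero, mul_one]; rfl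
  | succ j ih =>
    have hj' : j < r := by omega
    rw [pprod_succ (face n i y) hj', ← mul_assoc, ih (by omega)]
    unfold face
    simp only [Fin.succAbove, Fin.lt_def, Fin.val_castSucc]
    by_cases h1 : j + 1 < i.1
    · rw [if_pos h1, if_pos (by omega), if_pos h1]
      exact (pprod_succ y _).symm
    · rw [if_neg h1, if_neg h1]
      by_cases h2 : j + 1 = i.1
      · rw [if_pos h2, if_pos (by omega)]
        simp only [Fin.val_castSucc, Fin.val_succ]
        rw [pprod_succ y (show j + 1 < r + 1 by omega), pprod_succ y (show j < r + 1 by omega),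
          mul_assoc]
        rfl
      · rw [if_neg h2, if_neg (by omega)]
        simp only [Fin.val_succ]
        exact (pprod_succ y (show j + 1 < r + 1 by omega)).symm

/-- The factors `g_j⁻¹ g_j` telescope. The left factor `g 0` common to all `j` is what makes the
comparison with the nerve a gauge transformation. -/
theorem pprod_gamma {m : ℕ} {g : Fin (m + 1) → Mat n} (hg : g ∈ GPow n (m + 1))
    (j : Fin (m + 1)) : pprod (gamma n g) j = g 0 * Ring.inverse (g j) := by
  obtain ⟨j, hj⟩ := j
  induction j with
  | zero => rw [pprod_zero]; exact (Ring.mul_inverse_cancel _ (hg 0)).symm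
  | succ j ih =>
    have hj' : j < m := by omega
    rw [pprod_succ (gamma n g) hj', ih (by omega)]
    change g 0 * Ring.inverse (g ⟨j, _⟩) * (g ⟨j, _⟩ * Ring.inverse (g ⟨j + 1, _⟩)) = _
    rw [mul_assoc, ← mul_assoc (Ring.inverse _), Ring.inverse_mul_cancel _ (hg _), one_mul]

theorem mapsTo_gamma (n m : ℕ) : Set.MapsTo (gamma n) (GPow n (m + 1)) (GPow n m) :=
  fun _ hg _ => (hg _).mul (isUnit_ringInverse.2 (hg _))

/-- The derivative of the barycentric coordinates on `Δ^m × G^r`. -/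
def dbary (n m r : ℕ) : Fin (m + 1) → Ambient n m r →L[ℝ] ℝ :=
  Fin.cons (α := fun _ => Ambient n m r →L[ℝ] ℝ)
    (-(∑ i, ContinuousLinearMap.proj i ∘L ContinuousLinearMap.fst ℝ (Fin m → ℝ) (Fin r → Mat n)))
    (fun i => ContinuousLinearMap.proj i ∘L ContinuousLinearMap.fst ℝ (Fin m → ℝ) (Fin r → Mat n))

theorem hasFDerivAt_bary (n m r : ℕ) (j : Fin (m + 1)) (x : Ambient n m r) :
    HasFDerivAt (fun y : Ambient n m r => bary y.1 j) (dbary n m r j) x := by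
  have h : ∀ i : Fin m, HasFDerivAt (fun y : Ambient n m r => y.1 i)
      (ContinuousLinearMap.proj (R := ℝ) (φ := fun _ : Fin m => ℝ) i ∘L
        ContinuousLinearMap.fst ℝ (Fin m → ℝ) (Fin r → Mat n)) x := fun i =>
    ContinuousLinearMap.hasFDerivAt (ContinuousLinearMap.proj (R := ℝ)
      (φ := fun _ : Fin m => ℝ) i ∘L ContinuousLinearMap.fst ℝ (Fin m → ℝ) (Fin r → Mat n))
  refine Fin.cases ?_ (fun i => ?_) j
  · have := (HasFDerivAt.fun_sum fun i (_ : i ∈ Finset.univ) => h i).const_sub 1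
    exact this
  · exact h i

theorem contDiff_bary (n m r : ℕ) (j : Fin (m + 1)) :
    ContDiff ℝ ∞ fun y : Ambient n m r => bary y.1 j := by
  refine Fin.cases ?_ (fun i => ?_) j
  · have h : ContDiff ℝ ∞ fun y : Ambient n m r => 1 - ∑ i, y.1 i :=
      contDiff_const.sub (ContDiff.sum fun i _ => (contDiff_apply ℝ ℝ i).comp contDiff_fst)
    exact h
  · exact (contDiff_apply ℝ ℝ i).comp contDiff_fst

theorem sum_bary {m : ℕ} (t : Fin m → ℝ) : ∑ j, bary t j = 1 := by
  rw [Fin.sum_univ_succ]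
  simp [bary]

theorem sum_dbary (n m r : ℕ) : ∑ j, dbary n m r j = 0 := by
  rw [Fin.sum_univ_succ]
  simp [dbary]

theorem bary_coface {m : ℕ} (i : Fin (m + 2)) (t : Fin m → ℝ) :
    bary (coface i t) = i.insertNth 0 (bary t) := by
  have h : ∀ u : Fin (m + 2) → ℝ, ∑ j, u j = 1 → bary (Fin.tail u) = u := by
    intro u hu
    rw [Fin.sum_univ_succ] at hu
    funext j
    refine Fin.cases ?_ (fun i => ?_) j
    · simp only [bary, Fin.cons_zero, Fin.tail]
      linarith
    · simp [bary, Fin.tail]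
  refine h _ ?_
  rw [Fin.sum_univ_succAbove _ i]
  simp [sum_bary]

theorem contDiff_coface {m : ℕ} (i : Fin (m + 2)) : ContDiff ℝ ∞ (coface i) := by
  refine contDiff_pi.2 fun j => ?_
  change ContDiff ℝ ∞ fun t : Fin m → ℝ => (i.insertNth 0 (bary t) : Fin (m + 2) → ℝ) j.succ
  have hb : ∀ l : Fin (m + 1), ContDiff ℝ ∞ fun t : Fin m → ℝ => bary t l := by
    intro l
    refine Fin.cases ?_ (fun i => ?_) l
    · have h : ContDiff ℝ ∞ fun y : Fin m → ℝ => 1 - ∑ i, y i :=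
        contDiff_const.sub (ContDiff.sum fun i _ => contDiff_apply ℝ ℝ i)
      exact h
    · exact contDiff_apply ℝ ℝ i
  rcases Fin.eq_self_or_eq_succAbove i j.succ with h | ⟨l, h⟩
  · rw [h]
    simpa using contDiff_const
  · rw [h]
    simpa using hb l

theorem mem_simplex_iff {m : ℕ} {t : Fin m → ℝ} : t ∈ simplex m ↔ ∀ j, 0 ≤ bary t j := by
  rw [Fin.forall_fin_succ]
  simp only [simplex, bary, Set.mem_ofPred_eq, Fin.cons_zero, Fin.cons_succ]
  constructor
  · rintro ⟨h1, h2⟩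
    exact ⟨by linarith, h1⟩
  · rintro ⟨h1, h2⟩
    exact ⟨h2, by linarith⟩

theorem mapsTo_coface {m : ℕ} (i : Fin (m + 2)) : Set.MapsTo (coface i) (simplex m)
    (simplex (m + 1)) := by
  intro t ht
  rw [mem_simplex_iff] at ht ⊢
  rw [bary_coface]
  intro j
  rcases Fin.eq_self_or_eq_succAbove i j with h | ⟨l, h⟩
  · rw [h]
    simp
  · rw [h]
    simpa using ht l

/-- The form `(h_1 ⋯ h_j)^* (dg g⁻¹)` on `Δ^m × NG(m)`. -/
def psi (n m : ℕ) (x : Ambient n m m) (j : Fin (m + 1)) : Ambient n m m →L[ℝ] Mat n :=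
  mc (fun y : Ambient n m m => pprod y.2 j) x

/-- The curvature of the connection `-∑ t_j ψ_j` on `Δ^m × NG(m)`. -/
def nerveCurv (n m : ℕ) (x : Ambient n m m) : Ext (Ambient n m m) (Mat n) :=
  Ext.curv (bary x.1) (dbary n m m) (psi n m x)

/-- The trace, as a real linear map. -/
def trR (n : ℕ) : Mat n →L[ℝ] ℂ := (tr n).restrictScalars ℝ

theorem trR_mul_comm (a b : Mat n) : trR n (a * b) = trR n (b * a) := tr_mul_comm a b

theorem trR_conjL {u : Mat n} (hu : IsUnit u) (a : Mat n) : trR n (conjL u a) = trR n a := by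
  rw [conjL_apply, trR_mul_comm, ← mul_assoc, Ring.inverse_mul_cancel _ hu, one_mul]

/-- The trace of the powers of the curvature is gauge invariant. -/
theorem map_trR_curv_gauge {V : Type*} [NormedAddCommGroup V] [NormedSpace ℝ V] {m : ℕ}
    {u : Mat n} (hu : IsUnit u) (t : Fin m → ℝ) (τ : Fin m → V →L[ℝ] ℝ)
    (ψ : Fin m → V →L[ℝ] Mat n) (a : V →L[ℝ] Mat n)
    (ht : ∑ j, t j = 1) (hτ : ∑ j, τ j = 0) (p : ℕ) :
    Ext.map (trR n) (Ext.curv t τ (fun j => conjL u ∘L ψ j + a) ^ p) =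
      Ext.map (trR n) (Ext.curv t τ ψ ^ p) := by
  -- The shift `a` is removed first. Conjugation by `u` is multiplicative and fixes `1`, so it comes
  -- out of the curvature and of its power, and the trace forgets it.
  rw [Ext.curv_add_const t τ (fun j => conjL u ∘L ψ j) a ht hτ,
    ← Ext.map_curv (conjL u) (conjL_one hu) (conjL_mul hu), ← Ext.map_pow _ (conjL_one hu)
      (conjL_mul hu)]
  ext k v
  simp only [Ext.coeff_map, ContinuousLinearMap.compContinuousAlternatingMap_coe,
    Function.comp_apply, trR_conjL hu]

/-- The normalization of the Chern character form. -/
def chernConst (p : ℕ) : ℂ :=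
  (1 / (p.factorial : ℂ)) * (-(1 / (2 * Real.pi * Complex.I)) : ℂ) ^ p

/-- The Chern character form of the nerve, without restriction to the simplex. -/
def nerveForm (n p m : ℕ) (x : Ambient n m m) : Ambient n m m [⋀^Fin (2 * p)]→L[ℝ] ℂ :=
  chernConst p • (Ext.map (trR n) (nerveCurv n m x ^ p)).coeff (2 * p)

/-- The simplicial Chern character form of the nerve. -/
def nerveChernForm (n p : ℕ) : FormSeq n (2 * p) := fun m =>
  (simplexTimes n m m).indicator (nerveForm n p m)

theorem isOpen_setOf_snd_mem_GPow (n m r : ℕ) : IsOpen {x : Ambient n m r | x.2 ∈ GPow n r} :=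
  (isOpen_GPow n r).preimage continuous_snd

theorem contDiff_pprod_snd (n m r j : ℕ) (hj : j ≤ r) :
    ContDiff ℝ ∞ fun x : Ambient n m r => pprod x.2 j := (contDiff_pprod r j hj).comp contDiff_snd

theorem contDiffAt_psi {m : ℕ} {x : Ambient n m m} (hx : x.2 ∈ GPow n m) (j : Fin (m + 1)) :
    ContDiffAt ℝ ∞ (fun y => psi n m y j) x :=
  contDiffAt_mc (contDiff_pprod_snd n m m j (by omega)).contDiffAt (isUnit_pprod hx (by omega))

theorem smoothAt_nerveCurv {m : ℕ} {x : Ambient n m m} (hx : x.2 ∈ GPow n m) :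
    Ext.SmoothAt (nerveCurv n m) x :=
  Ext.smoothAt_curv (fun j => (contDiff_bary n m m j).contDiffAt) (contDiffAt_psi hx)

theorem fderiv_bary (n m r : ℕ) (j : Fin (m + 1)) (x : Ambient n m r) :
    fderiv ℝ (fun y : Ambient n m r => bary y.1 j) x = dbary n m r j :=
  (hasFDerivAt_bary n m r j x).fderiv

/-- The simplex coordinate is unrestricted, the curvature being polynomial in it. Before the cut-off
to the simplex one can therefore work with ordinary derivatives instead of derivatives within a set.
-/
theorem contDiffAt_nerveForm (p : ℕ) {m : ℕ} {x : Ambient n m m} (hx : x.2 ∈ GPow n m) :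
    ContDiffAt ℝ ∞ (nerveForm n p m) x :=
  (((smoothAt_nerveCurv hx).pow p).map (trR n) (2 * p)).const_smul (chernConst p)

theorem extDeriv_nerveForm (p : ℕ) {m : ℕ} {x : Ambient n m m} (hx : x.2 ∈ GPow n m) :
    extDeriv (nerveForm n p m) x = 0 := by
  have h := Ext.dd_map_curv_pow (trR n) trR_mul_comm
    (fun j => (contDiff_bary n m m j).contDiffAt (x := x)) (fun j => fderiv_bary n m m j x)
    (contDiffAt_psi hx)
    (fun j => dd_lin_mc (contDiff_pprod_snd n m m j (by omega)).contDiffAt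
      (isUnit_pprod hx (by omega))) p
  have h2 := Ext.coeff_dd (fun y => Ext.map (trR n) (nerveCurv n m y ^ p)) x (2 * p)
  have hd : DifferentiableAt ℝ
      (fun y => (Ext.map (trR n) (nerveCurv n m y ^ p)).coeff (2 * p)) x :=
    (((smoothAt_nerveCurv hx).pow p).map (trR n)).differentiableAt (2 * p)
  have h3 : extDeriv (fun y => (Ext.map (trR n) (nerveCurv n m y ^ p)).coeff (2 * p)) x = 0 := by
    rw [← h2]
    change (Ext.dd (fun y => Ext.map (trR n) (Ext.curv (bary y.1) (dbary n m m) (psi n m y) ^ p))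
      x).coeff _ = _
    rw [h]
    rfl
  ext v
  have h4 : fderiv ℝ (nerveForm n p m) x = chernConst p •
      fderiv ℝ (fun y => (Ext.map (trR n) (nerveCurv n m y ^ p)).coeff (2 * p)) x :=
    fderiv_fun_const_smul hd (chernConst p)
  have h5 := congrArg (fun w => chernConst p • w v) h3
  simp only [extDeriv, ContinuousAlternatingMap.alternatizeUncurryFin_apply, h4] at h5 ⊢
  rw [Finset.smul_sum] at h5
  have h6 : chernConst p • (0 : Ambient n m m [⋀^Fin (2 * p + 1)]→L[ℝ] ℂ) v = 0 := smul_zero _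
  rw [h6] at h5
  refine Eq.trans ?_ h5
  refine Finset.sum_congr rfl fun i _ => ?_
  exact smul_comm _ _ _

end Geometry

/-! ### The simplicial Chern character form: compatibility, pullback along `gamma`, uniqueness. -/

section Simplicial

variable {n : ℕ}

theorem comap_nerveCurv {E : Type*} [NormedAddCommGroup E] [NormedSpace ℝ E] {m : ℕ}
    {f : E → Ambient n m m} {x : E} (hf : DifferentiableAt ℝ f x) :
    Ext.comap (fderiv ℝ f x) (nerveCurv n m (f x)) =
      Ext.curv (bary (f x).1) (fun j => fderiv ℝ (fun y => bary (f y).1 j) x)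
        (fun j => mc (fun y => pprod (f y).2 j) x) := by
  rw [nerveCurv, Ext.comap_curv]
  congr 1
  · funext j
    have := fderiv_comp x (hasFDerivAt_bary n m m j (f x)).differentiableAt hf
    rw [fderiv_bary] at this
    exact this.symm
  · funext j
    exact mc_comp ((contDiff_pprod_snd n m m j (by omega)).contDiffAt.differentiableAt
      (by simp)) hf

theorem pullback_nerveChernForm_apply {m m' r : ℕ} (p : ℕ) {f : Ambient n m r → Ambient n m' m'}
    {x : Ambient n m r} (hx : x ∈ simplexTimes n m r) (hfx : f x ∈ simplexTimes n m' m') :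
    pullback (simplexTimes n m r) f (2 * p) (nerveChernForm n p m') x =
      chernConst p • (Ext.map (trR n)
        (Ext.comap (fderiv ℝ f x) (nerveCurv n m' (f x)) ^ p)).coeff (2 * p) := by
  rw [pullback_apply, Set.indicator_of_mem hx, nerveChernForm, Set.indicator_of_mem hfx, nerveForm,
    ← _root_.map_pow]
  rfl

theorem simplexTimes_mk {m r : ℕ} {x : Ambient n m r} (hx : x ∈ simplexTimes n m r) :
    x.1 ∈ simplex m ∧ x.2 ∈ GPow n r := hx

/-- On the `i`-th face of the simplex `t_i` vanishes and `ψ_i` drops out; the face operator of the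
nerve omits the vertex `v_i` and changes the others by a common left factor. The two curvatures
hence differ by a gauge transformation. -/
theorem nerveChernForm_simplicial (p m : ℕ) (i : Fin (m + 2)) :
    pullback (simplexTimes n m (m + 1))
        (fun x : Ambient n m (m + 1) => ((coface i x.1, x.2) : Ambient n (m + 1) (m + 1))) (2 * p)
        (nerveChernForm n p (m + 1)) =
      pullback (simplexTimes n m (m + 1))
        (fun x : Ambient n m (m + 1) => ((x.1, face n i x.2) : Ambient n m m)) (2 * p)
        (nerveChernForm n p m) := by
  funext x
  by_cases hx : x ∈ simplexTimes n m (m + 1)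
  swap
  · rw [pullback_apply, pullback_apply, Set.indicator_of_notMem hx, Set.indicator_of_notMem hx]
  have hx1 := (simplexTimes_mk hx).1
  have hx2 := (simplexTimes_mk hx).2
  have hd1 : DifferentiableAt ℝ
      (fun x : Ambient n m (m + 1) => ((coface i x.1, x.2) : Ambient n (m + 1) (m + 1))) x :=
    (((contDiff_coface i).comp contDiff_fst).prodMk contDiff_snd).contDiffAt.differentiableAt
      (by simp : (∞ : WithTop ℕ∞) ≠ 0)
  have hd2 : DifferentiableAt ℝ
      (fun x : Ambient n m (m + 1) => ((x.1, face n i x.2) : Ambient n m m)) x :=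
    (contDiff_fst.prodMk ((contDiff_face n i).comp contDiff_snd)).contDiffAt.differentiableAt
      (by simp : (∞ : WithTop ℕ∞) ≠ 0)
  rw [pullback_nerveChernForm_apply p hx ⟨mapsTo_coface i hx1, hx2⟩,
    pullback_nerveChernForm_apply p hx ⟨hx1, mapsTo_face n i hx2⟩,
    comap_nerveCurv hd1, comap_nerveCurv hd2]
  have e1 : (fun j => fderiv ℝ (fun y : Ambient n m (m + 1) => bary (coface i y.1) j) x) =
      i.insertNth 0 (dbary n m (m + 1)) := by
    funext j
    simp only [bary_coface]
    rcases Fin.eq_self_or_eq_succAbove i j with h | ⟨l, h⟩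
    · rw [h]
      simp
    · rw [h]
      simp [fderiv_bary]
  rw [e1]
  simp only [bary_coface, Ext.curv_insertNth, fderiv_bary]
  have hu : IsUnit (pprod x.2 (i.succAbove 0 : Fin (m + 2))) := isUnit_pprod hx2 (by omega)
  have hu' := isUnit_ringInverse.2 hu
  -- This is `pprod_face` solved for the partial product of the face, followed by `mc_mul`. The
  -- dividing factor does not depend on `j`, as gauge invariance requires.
  have e2 : (fun j : Fin (m + 1) =>
      mc (fun y : Ambient n m (m + 1) => pprod (face n i y.2) j) x) = fun j =>
      conjL (Ring.inverse (pprod x.2 (i.succAbove 0 : Fin (m + 2)))) ∘L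
        mc (fun y : Ambient n m (m + 1) => pprod y.2 (i.succAbove j : Fin (m + 2))) x +
        mc (fun y : Ambient n m (m + 1) =>
          Ring.inverse (pprod y.2 (i.succAbove 0 : Fin (m + 2)))) x := by
    funext j
    have hs : ∀ j : Fin (m + 2), ContDiffAt ℝ ∞ (fun y : Ambient n m (m + 1) => pprod y.2 j) x :=
      fun j => (contDiff_pprod_snd n m (m + 1) j (by omega)).contDiffAt
    rw [← mc_mul ((contDiffAt_inverse (hs _) hu).differentiableAt (by simp))
      ((hs _).differentiableAt (by simp)) hu' (isUnit_pprod hx2 (by omega))]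
    refine mc_congr ?_
    filter_upwards [(isOpen_setOf_snd_mem_GPow n m (m + 1)).mem_nhds hx2] with y hy
    rw [← pprod_face i y.2 j, ← mul_assoc,
      Ring.inverse_mul_cancel _ (isUnit_pprod hy (by omega)), one_mul]
  rw [e2, map_trR_curv_gauge hu' _ _ _ _ (sum_bary _) (sum_dbary n m (m + 1))]

/-- Together these give unique differentiability, needed because `dConnection` differentiates within
a set with boundary. -/
theorem simplexTimes_convexity (m : ℕ) :
    Convex ℝ (simplex m) ∧ (interior (simplex m)).Nonempty := by
  constructor
  · intro a ha b hb s t hs ht hst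
    refine ⟨fun i => ?_, ?_⟩
    · have := ha.1 i
      have := hb.1 i
      simp only [Pi.add_apply, Pi.smul_apply, smul_eq_mul]
      positivity
    · simp only [Pi.add_apply, Pi.smul_apply, smul_eq_mul, Finset.sum_add_distrib,
        ← Finset.mul_sum]
      nlinarith [ha.2, hb.2]
  · have ho : IsOpen {t : Fin m → ℝ | (∀ i, 0 < t i) ∧ ∑ i, t i < 1} := by
      rw [Set.ofPred_and, Set.ofPred_forall]
      exact (isOpen_iInter_of_finite fun i =>
        isOpen_lt continuous_const (continuous_apply i)).inter
        (isOpen_lt (by fun_prop) continuous_const)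
    -- The barycentre; its coordinate sum `m / (m + 1)` is less than `1` even for `m = 0`.
    refine ⟨fun _ => 1 / ((m : ℝ) + 1), ?_⟩
    rw [mem_interior]
    refine ⟨_, fun t ht => ⟨fun i => (ht.1 i).le, ht.2.le⟩, ho, fun i => by positivity, ?_⟩
    rw [Finset.sum_const, Finset.card_univ, Fintype.card_fin, nsmul_eq_mul, mul_one_div,
      div_lt_one (by positivity)]
    linarith

theorem uniqueDiffOn_simplexTimes (n m r : ℕ) : UniqueDiffOn ℝ (simplexTimes n m r) :=
  (uniqueDiffOn_convex (simplexTimes_convexity m).1 (simplexTimes_convexity m).2).prod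
    (isOpen_GPow n r).uniqueDiffOn

theorem connection_eq (m : ℕ) (x : Ambient n m (m + 1)) :
    connection n m x = (Ext.lin (∑ j, bary x.1 j • maurerCartan n m j x)).coeff 1 := by
  rw [Ext.lin_def, Ext.coeff_of]
  rfl

/-- The function `g_j⁻¹` has logarithmic derivative `-θ_j`. -/
theorem mc_inverse_snd {m : ℕ} {x : Ambient n m (m + 1)} (hx : x.2 ∈ GPow n (m + 1))
    (j : Fin (m + 1)) :
    mc (fun y : Ambient n m (m + 1) => Ring.inverse (y.2 j)) x = -maurerCartan n m j x := by
  refine ContinuousLinearMap.ext fun v => ?_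
  have hd : HasFDerivAt (fun y : Ambient n m (m + 1) => y.2 j)
      (ContinuousLinearMap.proj (R := ℝ) (φ := fun _ : Fin (m + 1) => Mat n) j ∘L
        ContinuousLinearMap.snd ℝ (Fin m → ℝ) (Fin (m + 1) → Mat n)) x :=
    ContinuousLinearMap.hasFDerivAt
      (ContinuousLinearMap.proj (R := ℝ) (φ := fun _ : Fin (m + 1) => Mat n) j ∘L
        ContinuousLinearMap.snd ℝ (Fin m → ℝ) (Fin (m + 1) → Mat n))
  rw [mc_inverse hd.differentiableAt (hx j), hd.fderiv]
  simp [maurerCartan]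

theorem contDiffAt_inverse_snd {m : ℕ} {x : Ambient n m (m + 1)} (hx : x.2 ∈ GPow n (m + 1))
    (j : Fin (m + 1)) :
    ContDiffAt ℝ ∞ (fun y : Ambient n m (m + 1) => Ring.inverse (y.2 j)) x :=
  contDiffAt_inverse ((contDiff_apply ℝ (Mat n) j).comp contDiff_snd).contDiffAt (hx j)

/-- The logarithmic derivatives of the `g_j⁻¹` are `ψ_j = -θ_j`, so the connection is `-∑ t_j ψ_j`;
its derivative follows from the Maurer-Cartan equation, and `[θ, θ] / 2 = θ ∧ θ`. The derivative
within the set equals the full one because the connection is differentiable in the ambient space. -/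
theorem of_curvature {m : ℕ} {x : Ambient n m (m + 1)} (hx : x ∈ simplexTimes n m (m + 1)) :
    Ext.of (curvature n m x) = Ext.curv (bary x.1) (dbary n m (m + 1))
      (fun j => mc (fun y : Ambient n m (m + 1) => Ring.inverse (y.2 j)) x) := by
  have hx2 := (simplexTimes_mk hx).2
  set ψ : Ambient n m (m + 1) → Fin (m + 1) → Ambient n m (m + 1) →L[ℝ] Mat n :=
    fun y j => mc (fun y : Ambient n m (m + 1) => Ring.inverse (y.2 j)) y with hψ
  have hu : ∀ j, IsUnit (Ring.inverse (x.2 j)) := fun j => isUnit_ringInverse.2 (hx2 j)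
  have hs : ∀ j, Ext.SmoothAt (fun y => Ext.lin (ψ y j)) x := fun j =>
    Ext.smoothAt_lin (contDiffAt_mc (contDiffAt_inverse_snd hx2 j) (hu j))
  have hst : ∀ j, Ext.SmoothAt (fun y => bary y.1 j • Ext.lin (ψ y j)) x := fun j =>
    Ext.SmoothAt.smul (contDiff_bary n m (m + 1) j).contDiffAt (hs j)
  have hsum := Ext.SmoothAt.sum (s := Finset.univ) fun j _ => hst j
  -- the connection near `x`
  have h1 : connection n m =ᶠ[nhds x]
      fun y => (-∑ j, bary y.1 j • Ext.lin (ψ y j)).coeff 1 := by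
    filter_upwards [(isOpen_setOf_snd_mem_GPow n m (m + 1)).mem_nhds hx2] with y hy
    rw [connection_eq]
    congr 1
    simp only [map_sum, map_smul, hψ, mc_inverse_snd hy, map_neg, smul_neg,
      Finset.sum_neg_distrib, neg_neg]
  have hdd : Ext.dd (fun y => -∑ j, bary y.1 j • Ext.lin (ψ y j)) x =
      -∑ j, (Ext.scal (dbary n m (m + 1) j) * Ext.lin (ψ x j) +
        bary x.1 j • Ext.lin (ψ x j) ^ 2) := by
    rw [Ext.dd_neg, Ext.dd_sum fun j _ => hst j]
    congr 1
    refine Finset.sum_congr rfl fun j _ => ?_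
    rw [Ext.dd_smul (contDiff_bary n m (m + 1) j).contDiffAt (hs j), fderiv_bary,
      dd_lin_mc (contDiffAt_inverse_snd hx2 j) (hu j)]
  have hdiff : DifferentiableAt ℝ (connection n m) x :=
    (hsum.neg.differentiableAt 1).congr_of_eventuallyEq h1
  have h2 : dConnection n m x =
      (Ext.dd (fun y => -∑ j, bary y.1 j • Ext.lin (ψ y j)) x).coeff 2 := by
    rw [Ext.coeff_dd, ← h1.extDeriv_eq, dConnection, extDerivWithin, extDeriv,
      hdiff.fderivWithin (uniqueDiffOn_simplexTimes n m (m + 1) x hx)]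
  have h3 : (1 / 2 : ℝ) • bracket (connection n m x) (connection n m x) =
      ((∑ j, bary x.1 j • Ext.lin (ψ x j)) ^ 2).coeff 2 := by
    have e : Ext.of (connection n m x) = -∑ j, bary x.1 j • Ext.lin (ψ x j) := by
      rw [connection_eq, Ext.lin_def, Ext.coeff_of, ← Ext.lin_def]
      simp only [map_sum, map_smul, hψ, mc_inverse_snd hx2, map_neg, smul_neg,
        Finset.sum_neg_distrib, neg_neg]
    rw [← neg_sq, ← e, sq, Ext.coeff_of_mul (show 1 + 1 = 2 from rfl), Ext.coeff_of, bracket, ← two_smul ℝ, smul_smul]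
    norm_num
  ext k v
  by_cases hk : k = 2
  · subst hk
    rw [Ext.coeff_of, curvature, h2, h3, hdd, ← Ext.coeff_add]
    congr 2
    rw [Ext.curv, Finset.sum_add_distrib]
    abel
  · rw [Ext.coeff_of_ne _ hk]
    have e0 : ∀ a b : Ambient n m (m + 1) →L[ℝ] Mat n, (Ext.lin a * Ext.lin b).coeff k = 0 :=
      fun a b => Ext.coeff_lin_mul_lin_of_ne a b hk
    have e1 : ∑ j, bary x.1 j • Ext.lin (ψ x j) = Ext.lin (∑ j, bary x.1 j • ψ x j) := by
      simp only [map_sum, map_smul]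
    rw [Ext.curv, e1]
    simp only [Ext.coeff_add, sub_eq_add_neg, Ext.coeff_neg, Ext.coeff_sum, sq, Ext.scal_def, e0,
      Ext.coeff_smul]
    simp

theorem chernForm_apply (p : ℕ) {m : ℕ} {x : Ambient n m (m + 1)}
    (hx : x ∈ simplexTimes n m (m + 1)) :
    chernForm n p m x = chernConst p • (Ext.map (trR n)
      (Ext.curv (bary x.1) (dbary n m (m + 1))
      (fun j => mc (fun y : Ambient n m (m + 1) => Ring.inverse (y.2 j)) x) ^ p)).coeff (2 * p) := by
  rw [chernForm, Set.indicator_of_mem hx, ← of_curvature hx]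
  have h1 : FormAlg.of ((-(1 / (2 * Real.pi * Complex.I)) : ℂ) • curvature n m x) =
      ((-(1 / (2 * Real.pi * Complex.I)) : ℂ) • Ext.of (curvature n m x) :
        Ext (Ambient n m (m + 1)) (Mat n)) := by
    change Ext.of _ = _
    ext k v
    by_cases hk : k = 2
    · subst hk
      rw [Ext.coeff_smul, Ext.coeff_of, Ext.coeff_of]
    · rw [Ext.coeff_smul, Ext.coeff_of_ne _ hk, Ext.coeff_of_ne _ hk]
      simp
  rw [h1, Ext.formAlg_pow_eq, smul_pow]
  ext v
  simp only [chernConst, ContinuousAlternatingMap.smul_apply, traceForm, Ext.coeff_map,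
    ContinuousLinearMap.compContinuousAlternatingMap_coe, Function.comp_apply, mul_smul]
  congr 1
  exact (tr n).map_smul _ _

/-- By `pprod_gamma` the forms `ψ_j` pull back to the gauge transforms by `g_0` of the logarithmic
derivatives of `g_j⁻¹`, which by `of_curvature` are the forms that define `Ω`. -/
theorem pullback_gamma_nerveChernForm (p m : ℕ) :
    pullback (simplexTimes n m (m + 1))
      (fun x : Ambient n m (m + 1) => ((x.1, gamma n x.2) : Ambient n m m)) (2 * p)
      (nerveChernForm n p m) = chernForm n p m := by
  funext x
  by_cases hx : x ∈ simplexTimes n m (m + 1)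
  swap
  · rw [pullback_apply, Set.indicator_of_notMem hx, chernForm, Set.indicator_of_notMem hx]
  have hx1 := (simplexTimes_mk hx).1
  have hx2 := (simplexTimes_mk hx).2
  have hd : DifferentiableAt ℝ
      (fun x : Ambient n m (m + 1) => ((x.1, gamma n x.2) : Ambient n m m)) x := by
    refine differentiableAt_fst.prodMk (differentiableAt_pi.2 fun j => ?_)
    exact (((contDiff_apply ℝ (Mat n) j.castSucc).comp contDiff_snd).contDiffAt.mul
      (contDiffAt_inverse_snd hx2 j.succ)).differentiableAt (by simp : (∞ : WithTop ℕ∞) ≠ 0)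
  rw [pullback_nerveChernForm_apply p hx ⟨hx1, mapsTo_gamma n m hx2⟩, comap_nerveCurv hd,
    chernForm_apply p hx]
  simp only [fderiv_bary]
  have e2 : (fun j : Fin (m + 1) =>
      mc (fun y : Ambient n m (m + 1) => pprod (gamma n y.2) j) x) = fun j =>
      conjL (x.2 0) ∘L mc (fun y : Ambient n m (m + 1) => Ring.inverse (y.2 j)) x +
        mc (fun y : Ambient n m (m + 1) => y.2 0) x := by
    funext j
    have h0 : DifferentiableAt ℝ (fun y : Ambient n m (m + 1) => y.2 0) x :=
      ((contDiff_apply ℝ (Mat n) (0 : Fin (m + 1))).comp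
        contDiff_snd).contDiffAt.differentiableAt (by simp : (∞ : WithTop ℕ∞) ≠ 0)
    rw [← mc_mul h0
      ((contDiffAt_inverse_snd hx2 j).differentiableAt (by simp)) (hx2 0)
      (isUnit_ringInverse.2 (hx2 j))]
    refine mc_congr ?_
    filter_upwards [(isOpen_setOf_snd_mem_GPow n m (m + 1)).mem_nhds hx2] with y hy
    rw [pprod_gamma hy]
  rw [e2, map_trR_curv_gauge (hx2 0) _ _ _ _ (sum_bary _) (sum_dbary n m (m + 1))]

theorem nerveChernForm_mem (p m : ℕ) :
    nerveChernForm n p m ∈ forms (simplexTimes n m m) (2 * p) := by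
  refine ⟨?_, fun x hx => Set.indicator_of_notMem hx _⟩
  have h : ContDiffOn ℝ ∞ (nerveForm n p m) (simplexTimes n m m) := fun x hx =>
    (contDiffAt_nerveForm p (simplexTimes_mk hx).2).contDiffWithinAt
  exact h.congr fun x hx => Set.indicator_of_mem hx _

/-- A section of `γ`: `g_j = (h_1 ⋯ h_j)⁻¹`. -/
def gammaSection {m : ℕ} (h : Fin m → Mat n) : Fin (m + 1) → Mat n := fun j =>
  Ring.inverse (pprod h j)

theorem gammaSection_mem {m : ℕ} {h : Fin m → Mat n} (hh : h ∈ GPow n m) :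
    gammaSection h ∈ GPow n (m + 1) := fun _ => isUnit_ringInverse.2 (isUnit_pprod hh (by omega))

theorem gamma_gammaSection {m : ℕ} {h : Fin m → Mat n} (hh : h ∈ GPow n m) :
    gamma n (gammaSection h) = h := by
  funext j
  have hu := isUnit_pprod hh (show (j : ℕ) ≤ m by omega)
  simp only [gamma, gammaSection, Fin.val_castSucc, Fin.val_succ]
  rw [Ring.inverse_inverse (isUnit_pprod hh (by omega)), pprod_succ h j.2, ← mul_assoc,
    Ring.inverse_mul_cancel _ hu, one_mul]

/-- Pulling back once more along `gammaSection` recovers the form: the composite is the identity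
near each point of the set, hence so is its derivative. Outside the set both forms vanish by
convention. -/
theorem pullback_gamma_injective {m N : ℕ}
    {w w' : Ambient n m m → Ambient n m m [⋀^Fin N]→L[ℝ] ℂ}
    (hw : ∀ x ∉ simplexTimes n m m, w x = 0) (hw' : ∀ x ∉ simplexTimes n m m, w' x = 0)
    (h : pullback (simplexTimes n m (m + 1))
      (fun x : Ambient n m (m + 1) => ((x.1, gamma n x.2) : Ambient n m m)) N w =
      pullback (simplexTimes n m (m + 1))
      (fun x : Ambient n m (m + 1) => ((x.1, gamma n x.2) : Ambient n m m)) N w') : w = w' := by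
  funext x
  by_cases hx : x ∈ simplexTimes n m m
  swap
  · rw [hw x hx, hw' x hx]
  have hx1 := (simplexTimes_mk hx).1
  have hx2 := (simplexTimes_mk hx).2
  set s : Ambient n m m → Ambient n m (m + 1) := fun y => (y.1, gammaSection y.2) with hs
  set g : Ambient n m (m + 1) → Ambient n m m := fun x => (x.1, gamma n x.2) with hg
  have hsx : s x ∈ simplexTimes n m (m + 1) := ⟨hx1, gammaSection_mem hx2⟩
  have hsd : DifferentiableAt ℝ s x := by
    refine differentiableAt_fst.prodMk (differentiableAt_pi.2 fun j => ?_)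
    exact (contDiffAt_inverse (contDiff_pprod_snd n m m j (by omega)).contDiffAt
      (isUnit_pprod hx2 (by omega))).differentiableAt (by simp)
  have hgd : DifferentiableAt ℝ g (s x) := by
    refine differentiableAt_fst.prodMk (differentiableAt_pi.2 fun j => ?_)
    exact (((contDiff_apply ℝ (Mat n) j.castSucc).comp contDiff_snd).contDiffAt.mul
      (contDiffAt_inverse_snd hsx.2 j.succ)).differentiableAt (by simp : (∞ : WithTop ℕ∞) ≠ 0)
  have hgs : g (s x) = x := Prod.ext rfl (gamma_gammaSection hx2)
  have hid : fderiv ℝ g (s x) ∘L fderiv ℝ s x = ContinuousLinearMap.id ℝ _ := by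
    rw [← fderiv_comp x hgd hsd, ← fderiv_id (x := x)]
    refine Filter.EventuallyEq.fderiv_eq ?_
    filter_upwards [(isOpen_setOf_snd_mem_GPow n m m).mem_nhds hx2] with y hy
    exact Prod.ext rfl (gamma_gammaSection hy)
  have h1 := congrFun h (s x)
  rw [pullback_apply, pullback_apply, Set.indicator_of_mem hsx, Set.indicator_of_mem hsx, hgs] at h1
  ext v
  have h2 := congrArg (fun a => a fun i => fderiv ℝ s x (v i)) h1
  simp only [ContinuousAlternatingMap.compContinuousLinearMap_apply] at h2
  have h3 : ∀ i, fderiv ℝ g (s x) (fderiv ℝ s x (v i)) = v i := fun i =>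
    congrArg (fun L => L (v i)) hid
  simpa only [Function.comp_def, h3] using h2

theorem isChernCharacterForm_nerveChernForm (n p : ℕ) :
    IsChernCharacterForm n p (nerveChernForm n p) :=
  ⟨⟨nerveChernForm_mem p, nerveChernForm_simplicial p⟩, pullback_gamma_nerveChernForm p⟩

theorem isChernCharacterForm_iff (n p : ℕ) (φ : FormSeq n (2 * p)) :
    IsChernCharacterForm n p φ ↔ φ = nerveChernForm n p := by
  constructor
  · intro h
    funext m
    exact pullback_gamma_injective (h.1.1 m).2 (nerveChernForm_mem p m).2
      ((h.2 m).trans (pullback_gamma_nerveChernForm p m).symm)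
  · rintro rfl
    exact isChernCharacterForm_nerveChernForm n p

end Simplicial

/-! ### Expansion of the curvature into letters and evaluation of words. -/

theorem sum_sum_eq_two_smul_sum_pairs {M : Type*} [AddCommGroup M] [Module ℝ M] {m : ℕ}
    (f : Fin m → Fin m → M) (hs : ∀ i j, f i j = f j i) (h0 : ∀ i, f i i = 0) :
    ∑ i, ∑ j, f i j = (2 : ℝ) • ∑ ij : {ij : Fin m × Fin m // ij.1 < ij.2}, f ij.1.1 ij.1.2 := by
  have h1 : ∑ ij : {ij : Fin m × Fin m // ij.1 < ij.2}, f ij.1.1 ij.1.2 =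
      ∑ i, ∑ j, if i < j then f i j else 0 := by
    rw [← Finset.sum_product', Finset.univ_product_univ,
      ← Finset.sum_filter (fun x : Fin m × Fin m => x.1 < x.2) fun x => f x.1 x.2]
    exact (Finset.sum_subtype (Finset.univ.filter fun x : Fin m × Fin m => x.1 < x.2)
      (fun x => by simp) fun x => f x.1 x.2).symm
  have h2 : ∑ i, ∑ j, f i j =
      (∑ i, ∑ j, if i < j then f i j else 0) + ∑ i, ∑ j, if j < i then f i j else 0 := by
    simp only [← Finset.sum_add_distrib]
    refine Finset.sum_congr rfl fun i _ => Finset.sum_congr rfl fun j _ => ?_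
    rcases lt_trichotomy i j with h | h | h
    · simp [h, h.not_gt]
    · simp [h, h0]
    · simp [h, h.not_gt]
  rw [h2, h1, two_smul]
  congr 1
  rw [Finset.sum_comm]
  refine Finset.sum_congr rfl fun i _ => Finset.sum_congr rfl fun j _ => ?_
  rw [hs]

namespace Ext

variable {V : Type*} [NormedAddCommGroup V] [NormedSpace ℝ V]
variable {A : Type*} [NormedRing A] [NormedAlgebra ℝ A]

/-- A noncommutative variance identity: as `∑ t_j = 1`, the difference `∑ t_j ψ_j² - (∑ t_j ψ_j)²`
is half of `∑ t_i t_j (ψ_j - ψ_i)²` over all `i, j`. It is the source of the forms `R_{ij}` and of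
the weights of the words. -/
theorem curv_eq_neg_sum_pairs {m : ℕ} (t : Fin m → ℝ) (τ : Fin m → V →L[ℝ] ℝ)
    (ψ : Fin m → V →L[ℝ] A) (ht : ∑ j, t j = 1) :
    curv t τ ψ = -(∑ j, scal (τ j) * lin (ψ j) +
      ∑ ij : {ij : Fin m × Fin m // ij.1 < ij.2},
        (t ij.1.1 * t ij.1.2) • lin (ψ ij.1.2 - ψ ij.1.1) ^ 2) := by
  have h := sum_sum_eq_two_smul_sum_pairs
    (fun i j => (t i * t j) • (lin (ψ j - ψ i) ^ 2 : Ext V A))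
    (fun i j => by
      rw [mul_comm, ← neg_sub (ψ i) (ψ j), _root_.map_neg, neg_sq])
    (fun i => by
      rw [sub_self, _root_.map_zero, zero_pow two_ne_zero, smul_zero])
  have h2 : ∑ i, ∑ j, (t i * t j) • (lin (ψ j - ψ i) ^ 2 : Ext V A) =
      (2 : ℝ) • (∑ j, t j • lin (ψ j) ^ 2 - (∑ j, t j • lin (ψ j)) ^ 2) := by
    have e : ∀ i j, (t i * t j) • (lin (ψ j - ψ i) ^ 2 : Ext V A) =
        t i • (t j • lin (ψ j) ^ 2) + t j • (t i • lin (ψ i) ^ 2) -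
          ((t i • lin (ψ i)) * (t j • lin (ψ j)) + (t j • lin (ψ j)) * (t i • lin (ψ i))) := by
      intro i j
      rw [_root_.map_sub, sq, sub_mul, mul_sub, mul_sub, smul_mul_smul_comm, smul_mul_smul_comm,
        mul_comm (t j) (t i), smul_smul, smul_smul, mul_comm (t j) (t i), sq, sq]
      simp only [smul_sub]
      abel
    simp only [e, Finset.sum_sub_distrib, Finset.sum_add_distrib, ← Finset.smul_sum,
      ← Finset.sum_smul, ht, one_smul, ← Finset.mul_sum, ← Finset.sum_mul]
    rw [two_smul, sq]
    abel
  rw [h2] at h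
  have h3 := congrArg (fun X : Ext V A => (1 / 2 : ℝ) • X) h
  simp only [smul_smul] at h3
  norm_num only [one_smul] at h3
  rw [← h3, curv]
  abel

theorem add_sum_pow {ι S : Type*} [Fintype ι] [Semiring S] (Y : ι → S) (l : ℕ) :
    (∑ i, Y i) ^ l = ∑ u : Fin l → ι, ((List.ofFn u).map Y).prod := by
  induction l with
  | zero => simp
  | succ l ih =>
    rw [pow_succ', ih, Finset.sum_mul_sum, ← Finset.sum_product', Finset.univ_product_univ]
    refine Fintype.sum_equiv (Fin.consEquiv fun _ => ι) _ _ fun x => ?_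
    simp [List.ofFn_succ]

theorem scal_mul_lin (e : V →L[ℝ] ℝ) (a : V →L[ℝ] A) :
    (scal e * lin a : Ext V A) = -(lin a * scal e) := by
  rw [scal_mul_comm, gradeInv_lin, neg_mul]

/-- The value of the product of a list of real `1`-forms on a family of vectors. -/
def pairing : List (V →L[ℝ] ℝ) → ∀ r : ℕ, (Fin r → V) → ℝ
  | [], 0, _ => 1
  | [], _ + 1, _ => 0
  | _ :: _, 0, _ => 0
  | a :: l, r + 1, X => ∑ i : Fin (r + 1), (-1) ^ (i : ℕ) * a (X i) * pairing l r (i.removeNth X)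

theorem pairing_eq_zero (l : List (V →L[ℝ] ℝ)) {r : ℕ} (X : Fin r → V) (h : l.length ≠ r) :
    pairing l r X = 0 := by
  induction l generalizing r with
  | nil =>
    cases r with
    | zero => exact absurd rfl h
    | succ r => rfl
  | cons a l ih =>
    cases r with
    | zero => rfl
    | succ r =>
      rw [pairing]
      refine Finset.sum_eq_zero fun i _ => ?_
      rw [ih _ (by simpa using h), mul_zero]

/-- The recursion defining `pairing` is the Laplace expansion along the first row. -/
theorem pairing_ofFn {r : ℕ} (a : Fin r → V →L[ℝ] ℝ) (X : Fin r → V) :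
    pairing (List.ofFn a) r X = (Matrix.of fun i j => a i (X j)).det := by
  induction r with
  | zero => simp [pairing]
  | succ r ih =>
    rw [List.ofFn_succ, pairing, Matrix.det_succ_row_zero]
    refine Finset.sum_congr rfl fun i _ => ?_
    rw [ih]
    rfl

variable {W : Type*} [NormedAddCommGroup W] [NormedSpace ℝ W]

theorem removeNth_append {α : Type*} {r s : ℕ} (X : Fin (r + 1) → α) (w : Fin s → α) {N : ℕ}
    (h : r + 1 + s = N + 1) (i : Fin (r + 1)) :
    (Fin.cast h (Fin.castAdd s i)).removeNth (fun a => Fin.append X w (Fin.cast h.symm a)) =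
      fun a => Fin.append (i.removeNth X) w (Fin.cast (by omega : N = r + s) a) := by
  obtain rfl : N = r + s := by omega
  funext a
  refine Fin.addCases (fun b => ?_) (fun b => ?_) a
  · have e : Fin.cast h.symm ((Fin.cast h (Fin.castAdd s i)).succAbove (Fin.castAdd s b)) =
        Fin.castAdd s (i.succAbove b) := by
      ext
      simp only [Fin.succAbove, Fin.lt_def, Fin.val_cast, Fin.val_castAdd, Fin.val_castSucc]
      split_ifs <;> rfl
    simp only [Fin.removeNth, e, Fin.append_left, Fin.cast_eq_self]
  · have e : Fin.cast h.symm ((Fin.cast h (Fin.castAdd s i)).succAbove (Fin.natAdd r b)) =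
        Fin.natAdd (r + 1) b := by
      ext
      simp only [Fin.succAbove, Fin.lt_def, Fin.val_cast, Fin.val_castAdd, Fin.val_natAdd,
        Fin.val_castSucc]
      rw [if_neg (by omega)]
      simp only [Fin.val_succ, Fin.val_natAdd]
      omega
    simp only [Fin.removeNth, e, Fin.append_right, Fin.cast_eq_self]

/-- Evaluation of `a_1 ∧ ⋯ ∧ a_c ∧ pr^* w` for real `1`-forms `a_i`. -/
theorem coeff_scal_prod_mul_comap (π : V →L[ℝ] W) (Z : Ext W A) (l : List (V →L[ℝ] ℝ))
    {r s N : ℕ} (h : r + s = N) (X : Fin r → V) (hX : ∀ i, π (X i) = 0) (w : Fin s → V)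
    (hw : ∀ a ∈ l, ∀ j, a (w j) = 0) :
    ((l.map scal).prod * comap π Z : Ext V A).coeff N
        (fun a => Fin.append X w (Fin.cast h.symm a)) =
      pairing l r X • Z.coeff s fun j => π (w j) := by
  induction l generalizing r N with
  | nil =>
    rw [List.map_nil, List.prod_nil, one_mul, coeff_comap]
    cases r with
    | zero =>
      obtain rfl : s = N := by omega
      rw [pairing, one_smul, ContinuousAlternatingMap.compContinuousLinearMap_apply]
      congr 1
      funext j
      have : Fin.cast h.symm j = Fin.natAdd 0 j := by ext; simp
      simp only [Function.comp_apply, this, Fin.append_right]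
    | succ r =>
      -- A vector annihilated by `π` is left over as an argument of the pulled back form and makes
      -- it vanish.
      rw [pairing, zero_smul, ContinuousAlternatingMap.compContinuousLinearMap_apply]
      refine ContinuousAlternatingMap.map_coord_zero _ (Fin.cast h (Fin.castAdd s 0)) ?_
      simp [hX]
  | cons a l ih =>
    rw [List.map_cons, List.prod_cons, mul_assoc]
    have hwl : ∀ b ∈ l, ∀ j, b (w j) = 0 := fun b hb => hw b (List.mem_cons_of_mem _ hb)
    have hwa := hw a List.mem_cons_self
    cases N with
    | zero =>
      obtain rfl : r = 0 := by omega
      rw [coeff_scal_mul_zero, pairing, zero_smul]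
      rfl
    | succ N =>
      rw [coeff_scal_mul_succ, ← (finCongr h).sum_comp, Fin.sum_univ_add]
      -- The 1-form `a` kills the vectors `w j`, so it can only be paired with some `X i`; this
      -- matches the recursion of `pairing`.
      have h2 : ∀ j : Fin s, a (Fin.append X w (Fin.cast h.symm (finCongr h (Fin.natAdd r j)))) = 0 := by
        intro j
        simp [hwa]
      simp only [h2, zero_smul, smul_zero, Finset.sum_const_zero, add_zero]
      cases r with
      | zero => simp [pairing]
      | succ r =>
        rw [pairing, Finset.sum_smul]
        refine Finset.sum_congr rfl fun i _ => ?_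
        have e := removeNth_append X w h i
        have ih' := ih (by omega : r + s = N) (i.removeNth X) (fun j => hX _) hwl
        rw [finCongr_apply, e, ih']
        simp [mul_smul, ← Int.cast_smul_eq_zsmul ℝ]

end Ext

namespace Ext

variable {V : Type*} [NormedAddCommGroup V] [NormedSpace ℝ V]
variable {A : Type*} [NormedRing A] [NormedAlgebra ℝ A]

theorem lin_mul_scal_prod (a : V →L[ℝ] A) (l : List (V →L[ℝ] ℝ)) :
    lin a * (l.map scal).prod = (-1 : ℝ) ^ l.length • ((l.map scal).prod * lin a : Ext V A) := by
  induction l with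
  | nil => simp
  | cons e l ih =>
    have h : (lin a * scal e : Ext V A) = -(scal e * lin a) := by rw [scal_mul_lin, neg_neg]
    rw [List.map_cons, List.prod_cons, ← mul_assoc, h, neg_mul, mul_assoc, ih, mul_smul_comm,
      List.length_cons, pow_succ, mul_neg_one, neg_smul, mul_assoc]

theorem lin_sq_mul_scal_prod (a : V →L[ℝ] A) (l : List (V →L[ℝ] ℝ)) :
    lin a ^ 2 * (l.map scal).prod = ((l.map scal).prod * lin a ^ 2 : Ext V A) := by
  rw [sq, mul_assoc, lin_mul_scal_prod, mul_smul_comm, ← mul_assoc, lin_mul_scal_prod,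
    smul_mul_assoc, smul_smul, ← mul_pow, neg_one_mul, neg_neg, one_pow, one_smul, mul_assoc]

variable {α β : Type*}

/-- `c + c(c-1)/2 = (c+1)c/2`: the sorting sign changes by `(-1)^c` when one more algebra-valued
1-form has to cross `c` scalar ones. -/
theorem neg_one_pow_choose (c : ℕ) :
    (-1 : ℝ) ^ c * (-1) ^ (c * (c - 1) / 2) = (-1) ^ ((c + 1) * c / 2) := by
  have h := Finset.sum_range_succ (fun x => x) c
  rw [Finset.sum_range_id, Finset.sum_range_id, Nat.add_sub_cancel] at h
  rw [← pow_add, h, add_comm]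

/-- The letters of the powers of the curvature. -/
def letter (e : α → V →L[ℝ] ℝ) (f : α → V →L[ℝ] A) (c : β → ℝ) (g : β → V →L[ℝ] A) :
    α ⊕ β → Ext V A :=
  Sum.elim (fun a => scal (e a) * lin (f a)) fun b => c b • lin (g b) ^ 2

/-- A product of letters, sorted with the real `1`-forms in front. -/
theorem prod_map_letter (e : α → V →L[ℝ] ℝ) (f : α → V →L[ℝ] A) (c : β → ℝ)
    (g : β → V →L[ℝ] A) (L : List (α ⊕ β)) :
    (L.map (letter e f c g)).prod =
      ((-1) ^ ((L.filterMap Sum.getLeft?).length * ((L.filterMap Sum.getLeft?).length - 1) / 2) *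
        (L.map (Sum.elim (fun _ => 1) c)).prod) •
      ((((L.filterMap Sum.getLeft?).map e).map scal).prod *
        (L.map (Sum.elim (fun a => lin (f a)) fun b => lin (g b) ^ 2)).prod) := by
  induction L with
  | nil => simp
  | cons x L ih =>
    cases x with
    | inl a =>
      have h : (Sum.inl a :: L : List (α ⊕ β)).filterMap Sum.getLeft? =
          a :: L.filterMap Sum.getLeft? := by simp
      rw [h, List.length_cons, Nat.add_sub_cancel, ← neg_one_pow_choose]
      have hl : letter e f c g (Sum.inl a) = scal (e a) * lin (f a) := rfl
      simp only [List.map_cons, List.prod_cons, Sum.elim_inl, one_mul]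
      rw [ih, hl, mul_smul_comm, mul_assoc (scal (e a)), ← mul_assoc (lin (f a)), lin_mul_scal_prod,
        smul_mul_assoc, mul_smul_comm, smul_smul, List.length_map]
      congr 1
      · ring
      · simp only [mul_assoc]
    | inr b =>
      have h : (Sum.inr b :: L : List (α ⊕ β)).filterMap Sum.getLeft? =
          L.filterMap Sum.getLeft? := rfl
      rw [h]
      have hl : letter e f c g (Sum.inr b) = c b • lin (g b) ^ 2 := rfl
      simp only [List.map_cons, List.prod_cons, Sum.elim_inr]
      rw [ih, hl, smul_mul_smul_comm, ← mul_assoc (lin (g b) ^ 2), lin_sq_mul_scal_prod, mul_assoc]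
      congr 1
      ring

theorem scal_mul_lin_mul_prod_map_letter (e₀ : V →L[ℝ] ℝ) (f₀ : V →L[ℝ] A)
    (e : α → V →L[ℝ] ℝ) (f : α → V →L[ℝ] A) (c : β → ℝ) (g : β → V →L[ℝ] A) (L : List (α ⊕ β)) :
    scal e₀ * lin f₀ * (L.map (letter e f c g)).prod =
      ((-1) ^ (((L.filterMap Sum.getLeft?).length + 1) * (L.filterMap Sum.getLeft?).length / 2) *
        (L.map (Sum.elim (fun _ => 1) c)).prod) •
      (((e₀ :: (L.filterMap Sum.getLeft?).map e).map scal).prod *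
        (lin f₀ * (L.map (Sum.elim (fun a => lin (f a)) fun b => lin (g b) ^ 2)).prod)) := by
  rw [prod_map_letter, ← neg_one_pow_choose, mul_smul_comm, mul_assoc, ← mul_assoc (lin f₀),
    lin_mul_scal_prod, smul_mul_assoc, mul_smul_comm, smul_smul, List.length_map, List.map_cons,
    List.prod_cons]
  congr 1
  · ring
  · simp only [mul_assoc]

/-- The determinant has a zero column. -/
theorem pairing_eq_zero_of_forall (l : List (V →L[ℝ] ℝ)) {r : ℕ} (X : Fin r → V) (i : Fin r)
    (h : ∀ a ∈ l, a (X i) = 0) : pairing l r X = 0 := by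
  by_cases hr : l.length = r
  · subst hr
    have e := pairing_ofFn l.get X
    rw [List.ofFn_get] at e
    rw [e]
    exact Matrix.det_eq_zero_of_column_eq_zero i fun j => h _ (List.get_mem l j)
  · exact pairing_eq_zero l X hr

end Ext

/-! ### Determinants of the forms `dt_s + ⋯ + dt_m`. -/

section Tau

/-- The form `dt_{s+1} + ⋯ + dt_m` on `Δ^m × G^r`. -/
def dtau (n m r : ℕ) (s : Fin m) : Ambient n m r →L[ℝ] ℝ :=
  ∑ i : Fin m with s ≤ i,
    ContinuousLinearMap.proj i ∘L ContinuousLinearMap.fst ℝ (Fin m → ℝ) (Fin r → Mat n)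

theorem dtau_snd {n m r : ℕ} (s : Fin m) (v : Fin r → Mat n) : dtau n m r s (0, v) = 0 := by
  simp [dtau]

theorem dtau_single {n m r : ℕ} (s i : Fin m) :
    dtau n m r s (Pi.single i 1, 0) = if s ≤ i then 1 else 0 := by
  rw [dtau, _root_.sum_apply]
  simp [Pi.single_apply]

theorem det_upper_one (m : ℕ) :
    (Matrix.of fun s j : Fin m => if s ≤ j then (1 : ℝ) else 0).det = 1 := by
  rw [Matrix.det_of_isUpperTriangular]
  · simp
  · intro i j hij
    have : ¬ i ≤ j := not_le.2 hij
    simp [this]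

/-- The sign of a list of elements of `Fin k` if it is a permutation, and `0` otherwise. -/
def listSign {k : ℕ} (L : List (Fin k)) : ℝ :=
  ∑ σ : Equiv.Perm (Fin k), if L = List.ofFn σ then ((Equiv.Perm.sign σ : ℤ) : ℝ) else 0

/-- In their natural order these 1-forms have a unitriangular matrix on the coordinate fields. A
list that is a permutation permutes the rows and gives its sign; a repetition gives two equal rows,
and a wrong length gives zero by degree. -/
theorem pairing_dtau {n k r : ℕ} (L : List (Fin k)) :
    Ext.pairing (dtau n (k + 1) r 0 :: L.map fun a => dtau n (k + 1) r a.succ) (k + 1)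
      (fun i => (Pi.single i 1, 0)) = listSign L := by
  unfold listSign
  by_cases hL : L.length = k
  · obtain ⟨f, rfl⟩ : ∃ f : Fin k → Fin k, L = List.ofFn f :=
      ⟨_, (List.ofFn_get L).symm.trans (List.ofFn_congr hL _)⟩
    have h1 : (dtau n (k + 1) r 0 :: (List.ofFn f).map fun a => dtau n (k + 1) r a.succ) =
        List.ofFn fun i : Fin (k + 1) =>
          dtau n (k + 1) r ((Fin.cons 0 (fun a => (f a).succ) : Fin (k + 1) → Fin (k + 1)) i) := by
      simp [List.ofFn_succ, List.map_ofFn, Function.comp_def]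
    rw [h1, Ext.pairing_ofFn]
    simp only [dtau_single, List.ofFn_inj]
    by_cases hf : Function.Injective f
    · set σ := Equiv.ofBijective f (Finite.injective_iff_bijective.1 hf) with hσ
      have hσf : f = σ := rfl
      rw [Finset.sum_eq_single σ]
      · rw [if_pos hσf]
        -- The row permutation fixes `0` and acts as `σ` on the successors, so it has the sign of
        -- `σ`.
        have h2 : (Matrix.of fun i j : Fin (k + 1) =>
            if (Fin.cons 0 (fun a => (f a).succ) : Fin (k + 1) → Fin (k + 1)) i ≤ j
              then (1 : ℝ) else 0) =
            (Matrix.of fun s j : Fin (k + 1) => if s ≤ j then (1 : ℝ) else 0).submatrix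
              (Equiv.Perm.decomposeFin.symm (0, σ)) id := by
          ext i j
          refine Fin.cases ?_ (fun a => ?_) i
          · simp
          · simp [hσf]
        rw [h2, Matrix.det_permute, det_upper_one, Equiv.Perm.decomposeFin.symm_sign]
        simp
      · intro τ _ hτ
        rw [if_neg]
        intro h
        exact hτ (Equiv.ext fun x => (congrFun (hσf.symm.trans h) x).symm)
      · simp
    · rw [Finset.sum_eq_zero]
      · obtain ⟨a, b, hab, hne⟩ : ∃ a b, f a = f b ∧ a ≠ b := by
          simpa [Function.Injective] using hf
        refine Matrix.det_zero_of_row_eq (i := a.succ) (j := b.succ)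
          (fun h => hne (Fin.succ_injective _ h)) ?_
        funext j
        simp [hab]
      · intro τ _
        rw [if_neg]
        rintro rfl
        exact hf τ.injective
  · rw [Ext.pairing_eq_zero, Finset.sum_eq_zero]
    · intro τ _
      rw [if_neg]
      rintro rfl
      exact hL (by simp)
    · simpa using hL

end Tau

/-! ### The curvature of the nerve in terms of the forms `phi`. -/

section Formula

variable {n : ℕ}

/-- Each further factor adds, by `mc_mul`, the conjugate by `h_1 ⋯ h_j` of `dh h⁻¹` for that factor,
which is the next form `phi`. -/
theorem mc_pprod_snd {m : ℕ} {x : Ambient n m m} (hx : x.2 ∈ GPow n m) {j : ℕ} (hj : j ≤ m) :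
    mc (fun y : Ambient n m m => pprod y.2 j) x =
      (∑ s : Fin m with s.val < j, phi x.2 s) ∘L
        ContinuousLinearMap.snd ℝ (Fin m → ℝ) (Fin m → Mat n) := by
  induction j with
  | zero =>
    refine ContinuousLinearMap.ext fun v => ?_
    simp [mc_apply, pprod_zero]
  | succ j ih =>
    have hs : (Finset.univ.filter fun s : Fin m => (s : ℕ) < j + 1) =
        insert ⟨j, hj⟩ (Finset.univ.filter fun s : Fin m => (s : ℕ) < j) := by
      ext s
      simp only [Finset.mem_filter, Finset.mem_univ, true_and, Finset.mem_insert, Fin.ext_iff]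
      omega
    have hp := (contDiff_pprod_snd n m m j (by omega)).contDiffAt (x := x)
    have hd : HasFDerivAt (fun y : Ambient n m m => y.2 ⟨j, hj⟩)
        (ContinuousLinearMap.proj (R := ℝ) (φ := fun _ : Fin m => Mat n) ⟨j, hj⟩ ∘L
          ContinuousLinearMap.snd ℝ (Fin m → ℝ) (Fin m → Mat n)) x :=
      ContinuousLinearMap.hasFDerivAt
        (ContinuousLinearMap.proj (R := ℝ) (φ := fun _ : Fin m => Mat n) ⟨j, hj⟩ ∘L
          ContinuousLinearMap.snd ℝ (Fin m → ℝ) (Fin m → Mat n))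
    have hu := isUnit_pprod hx (show j ≤ m by omega)
    have e : (fun y : Ambient n m m => pprod y.2 (j + 1)) =
        fun y => pprod y.2 j * y.2 ⟨j, hj⟩ := funext fun y => pprod_succ y.2 hj
    rw [e, mc_mul (hp.differentiableAt (by simp)) hd.differentiableAt hu (hx _), ih (by omega), hs,
      Finset.sum_insert (by simp)]
    refine ContinuousLinearMap.ext fun v => ?_
    have h3 : Ring.inverse (pprod x.2 (j + 1)) =
        Ring.inverse (x.2 ⟨j, hj⟩) * Ring.inverse (pprod x.2 j) := by
      rw [pprod_succ x.2 hj, ring_inverse_mul hu (hx _)]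
    have h4 : phi x.2 ⟨j, hj⟩ v.2 =
        pprod x.2 j * v.2 ⟨j, hj⟩ * Ring.inverse (pprod x.2 (j + 1)) := rfl
    simp only [_root_.add_apply, ContinuousLinearMap.comp_apply, mc_apply, hd.fderiv,
      conjL_apply, ContinuousLinearMap.coe_snd', ContinuousLinearMap.proj_apply, h4, h3, mul_assoc]

theorem psi_eq {m : ℕ} {x : Ambient n m m} (hx : x.2 ∈ GPow n m) (j : Fin (m + 1)) :
    psi n m x j = (∑ s : Fin m with s.castSucc < j, phi x.2 s) ∘L
        ContinuousLinearMap.snd ℝ (Fin m → ℝ) (Fin m → Mat n) :=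
  mc_pprod_snd hx (by omega)

theorem psi_sub {m : ℕ} {x : Ambient n m m} (hx : x.2 ∈ GPow n m) {i j : Fin (m + 1)}
    (hij : i < j) :
    psi n m x j - psi n m x i =
      (∑ s : Fin m with i ≤ s.castSucc ∧ s.castSucc < j, phi x.2 s) ∘L
        ContinuousLinearMap.snd ℝ (Fin m → ℝ) (Fin m → Mat n) := by
  have h : ∑ s : Fin m with s.castSucc < j, phi x.2 s =
      ∑ s : Fin m with i ≤ s.castSucc ∧ s.castSucc < j, phi x.2 s +
        ∑ s : Fin m with s.castSucc < i, phi x.2 s := by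
    simp only [Finset.sum_filter, ← Finset.sum_add_distrib]
    refine Finset.sum_congr rfl fun s _ => ?_
    by_cases h1 : s.castSucc < i
    · simp [h1, h1.trans hij, h1.not_ge]
    · by_cases h2 : s.castSucc < j
      · simp [h1, h2, not_lt.1 h1]
      · simp [h1, h2]
  rw [psi_eq hx, psi_eq hx, h]
  refine ContinuousLinearMap.ext fun v => ?_
  simp

/-- Summation by parts, from `ψ_0 = 0` and `ψ_j = φ_1 + ⋯ + φ_j`. -/
theorem sum_scal_mul_lin_psi {m : ℕ} {x : Ambient n m m} (hx : x.2 ∈ GPow n m) :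
    ∑ j, (Ext.scal (dbary n m m j) * Ext.lin (psi n m x j) : Ext _ (Mat n)) =
      ∑ s, Ext.scal (dtau n m m s) * Ext.lin (phi x.2 s ∘L
        ContinuousLinearMap.snd ℝ (Fin m → ℝ) (Fin m → Mat n)) := by
  have h0 : psi n m x 0 = 0 := by
    rw [psi_eq hx]
    refine ContinuousLinearMap.ext fun v => ?_
    simp
  have h1 : ∀ i : Fin m, psi n m x i.succ = ∑ s : Fin m with s ≤ i, phi x.2 s ∘L
      ContinuousLinearMap.snd ℝ (Fin m → ℝ) (Fin m → Mat n) := by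
    intro i
    rw [psi_eq hx]
    simp only [Fin.castSucc_lt_succ_iff]
    refine ContinuousLinearMap.ext fun v => ?_
    simp
  rw [Fin.sum_univ_succ, h0, map_zero, mul_zero, zero_add]
  simp only [h1, dtau, map_sum, Finset.mul_sum, Finset.sum_mul, Finset.sum_filter]
  rw [Finset.sum_comm]
  refine Finset.sum_congr rfl fun s _ => Finset.sum_congr rfl fun i _ => ?_
  split_ifs
  · rfl
  · simp only [map_zero, mul_zero, zero_mul]

/-- The only form at level zero, `ψ_0`, is the logarithmic derivative of a constant. This is why the
cochain has no component on `NG(0)`. -/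
theorem nerveCurv_zero (n : ℕ) (x : Ambient n 0 0) : nerveCurv n 0 x = 0 := by
  have h0 : psi n 0 x = 0 := by
    funext j
    rw [psi_eq (fun i => i.elim0)]
    refine ContinuousLinearMap.ext fun v => ?_
    simp
  rw [nerveCurv, h0, Ext.curv]
  simp

/-- The letters of the curvature of the nerve. -/
def nerveLetter {k : ℕ} (x : Ambient n (k + 1) (k + 1)) :
    Letter k → Ext (Ambient n (k + 1) (k + 1)) (Mat n) :=
  Ext.letter (fun a => dtau n (k + 1) (k + 1) a.succ)
    (fun a => phi x.2 a.succ ∘L ContinuousLinearMap.snd ℝ (Fin (k + 1) → ℝ) (Fin (k + 1) → Mat n))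
    (fun ij => bary x.1 ij.1.1 * bary x.1 ij.1.2)
    (fun ij => (∑ s : Fin (k + 1) with ij.1.1 ≤ s.castSucc ∧ s.castSucc < ij.1.2, phi x.2 s) ∘L
      ContinuousLinearMap.snd ℝ (Fin (k + 1) → ℝ) (Fin (k + 1) → Mat n))

/-- The letter with `dt_1 + ⋯ + dt_m` is split off: it alone contains `dt_1`, so it must occur in
every word that survives integration. -/
theorem nerveCurv_eq {k : ℕ} {x : Ambient n (k + 1) (k + 1)} (hx : x.2 ∈ GPow n (k + 1)) :
    nerveCurv n (k + 1) x = -(Ext.scal (dtau n (k + 1) (k + 1) 0) * Ext.lin (phi x.2 0 ∘L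
        ContinuousLinearMap.snd ℝ (Fin (k + 1) → ℝ) (Fin (k + 1) → Mat n)) +
      ∑ ℓ, nerveLetter x ℓ) := by
  rw [nerveCurv, Ext.curv_eq_neg_sum_pairs _ _ _ (sum_bary _), sum_scal_mul_lin_psi hx,
    Fin.sum_univ_succ, Fintype.sum_sum_type, add_assoc]
  have h : ∀ ij : Pair k, nerveLetter x (Sum.inr ij) = (bary x.1 ij.1.1 * bary x.1 ij.1.2) •
      Ext.lin (psi n (k + 1) x ij.1.2 - psi n (k + 1) x ij.1.1) ^ 2 := by
    intro ij
    rw [psi_sub hx ij.2]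
    rfl
  have h' : ∀ a : Fin k, nerveLetter x (Sum.inl a) = Ext.scal (dtau n (k + 1) (k + 1) a.succ) *
      Ext.lin (phi x.2 a.succ ∘L
        ContinuousLinearMap.snd ℝ (Fin (k + 1) → ℝ) (Fin (k + 1) → Mat n)) := fun _ => rfl
  rw [Finset.sum_congr rfl fun ij _ => h ij, Finset.sum_congr rfl fun a _ => h' a]

end Formula

/-! ### Words in the letters and the contracted Chern character form. -/

section Words

variable {n : ℕ}

/-- The trace of the word `u` in the forms `φ_s` and `R_{ij}`, preceded by `φ_1`. -/
def wordForm {k l : ℕ} (s : ℕ) (u : Fin l → Letter k) (h : Fin (k + 1) → Mat n) :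
    (Fin (k + 1) → Mat n) [⋀^Fin s]→L[ℝ] ℂ :=
  traceForm (FormAlg.mul (FormAlg.ofLin (phi h 0))
    (FormAlg.prod ((List.ofFn u).map (letterForm h))) s)

/-- The form of a letter, as an element of the exterior algebra. -/
def extLetter {k : ℕ} (h : Fin (k + 1) → Mat n) :
    Letter k → Ext (Fin (k + 1) → Mat n) (Mat n) :=
  Sum.elim (fun a => Ext.lin (phi h a.succ)) fun ij =>
    Ext.lin (∑ s : Fin (k + 1) with ij.1.1 ≤ s.castSucc ∧ s.castSucc < ij.1.2, phi h s) ^ 2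

theorem letterForm_eq {k : ℕ} (h : Fin (k + 1) → Mat n) : letterForm h = extLetter h := by
  funext ℓ
  cases ℓ with
  | inl a => rfl
  | inr ij => exact Ext.formAlg_pow_eq _ 2

theorem wordForm_eq {k l : ℕ} (s : ℕ) (u : Fin l → Letter k) (h : Fin (k + 1) → Mat n) :
    wordForm s u h = (Ext.map (trR n) (Ext.lin (phi h 0) *
      ((List.ofFn u).map (extLetter h)).prod)).coeff s := by
  have h1 : FormAlg.prod ((List.ofFn u).map (letterForm h)) =
      (show FormAlg _ _ from ((List.ofFn u).map (extLetter h)).prod) := by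
    rw [letterForm_eq]
    exact Ext.formAlg_prod_eq _
  exact congrArg (fun Z => traceForm (FormAlg.mul (FormAlg.ofLin (phi h 0)) Z s)) h1

theorem contDiffAt_phi {k : ℕ} {h : Fin k → Mat n} (hh : h ∈ GPow n k) (s : Fin k) :
    ContDiffAt ℝ ∞ (fun h : Fin k → Mat n => phi h s) h := by
  have h1 := (contDiff_pprod (n := n) k s (by omega)).contDiffAt (x := h)
  have h2 := contDiffAt_inverse ((contDiff_pprod (n := n) k (s + 1) (by omega)).contDiffAt (x := h))
    (isUnit_pprod hh (by omega))
  have h3 : ContDiffAt ℝ ∞ (fun h : Fin k → Mat n =>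
      ContinuousLinearMap.mul ℝ (Mat n) (pprod h s)) h :=
    (ContinuousLinearMap.contDiff _).contDiffAt.comp h h1
  have h4 : ContDiffAt ℝ ∞ (fun h : Fin k → Mat n =>
      (ContinuousLinearMap.mul ℝ (Mat n)).flip (Ring.inverse (pprod h (s + 1)))) h :=
    (ContinuousLinearMap.contDiff _).contDiffAt.comp h h2
  have e : (fun h : Fin k → Mat n => phi h s) = fun h =>
      ContinuousLinearMap.mul ℝ (Mat n) (pprod h s) ∘L
        (ContinuousLinearMap.mul ℝ (Mat n)).flip (Ring.inverse (pprod h (s + 1))) ∘L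
          ContinuousLinearMap.proj s := by
    funext h
    refine ContinuousLinearMap.ext fun v => ?_
    exact mul_assoc (pprod h s) (v s) (Ring.inverse (pprod h (s + 1)))
  rw [e]
  exact h3.clm_comp (h4.clm_comp contDiffAt_const)

theorem contDiffAt_wordForm {k l : ℕ} (s : ℕ) (u : Fin l → Letter k) {h : Fin (k + 1) → Mat n}
    (hh : h ∈ GPow n (k + 1)) : ContDiffAt ℝ ∞ (wordForm s u) h := by
  have h1 : ∀ ℓ, Ext.SmoothAt (fun h => extLetter h ℓ) h := by
    intro ℓ
    cases ℓ with
    | inl a => exact Ext.smoothAt_lin (contDiffAt_phi hh _)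
    | inr ij =>
      exact (Ext.smoothAt_lin (ContDiffAt.sum fun s _ => contDiffAt_phi hh s)).pow 2
  have h2 : Ext.SmoothAt (fun h => ((List.ofFn u).map (extLetter h)).prod) h :=
    Ext.SmoothAt.list_prod _ h1
  have h3 := (((Ext.smoothAt_lin (contDiffAt_phi hh 0)).mul h2).map (trR n)) s
  exact h3.congr_of_eventuallyEq (Filter.Eventually.of_forall fun h => wordForm_eq s u h)

/-- The polynomial in the barycentric coordinates belonging to a word. -/
def wordMonomial {k l : ℕ} (u : Fin l → Letter k) (t : Fin (k + 1) → ℝ) : ℝ :=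
  ∏ ij : Pair k, (bary t ij.1.1 * bary t ij.1.2) ^ count u ij

theorem prod_map_ofFn_eq_prod_pow_count {k l : ℕ} (u : Fin l → Letter k) (c : Pair k → ℝ) :
    ((List.ofFn u).map (Sum.elim (fun _ => 1) c)).prod = ∏ ij, c ij ^ count u ij := by
  rw [List.map_ofFn, List.prod_ofFn]
  have h : ∀ b, (Sum.elim (fun _ => 1) c ∘ u) b =
      ∏ ij : Pair k, if u b = Sum.inr ij then c ij else 1 := by
    intro b
    rw [Function.comp_apply]
    cases hb : u b with
    | inl a => simp
    | inr ij =>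
      rw [Finset.prod_eq_single ij]
      · simp
      · intro ij' _ hne
        rw [if_neg]
        intro h
        exact hne (Sum.inr_injective h).symm
      · simp
  rw [Finset.prod_congr rfl fun b _ => h b, Finset.prod_comm]
  refine Finset.prod_congr rfl fun ij _ => ?_
  rw [← Finset.prod_filter, Finset.prod_const, count]

theorem comap_snd_extLetter {k : ℕ} (x : Ambient n (k + 1) (k + 1)) (L : List (Letter k)) :
    (L.map (Sum.elim (fun a => Ext.lin (phi x.2 a.succ ∘L
          ContinuousLinearMap.snd ℝ (Fin (k + 1) → ℝ) (Fin (k + 1) → Mat n)))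
        fun ij : Pair k => Ext.lin ((∑ s : Fin (k + 1) with ij.1.1 ≤ s.castSucc ∧
            s.castSucc < ij.1.2, phi x.2 s) ∘L
          ContinuousLinearMap.snd ℝ (Fin (k + 1) → ℝ) (Fin (k + 1) → Mat n)) ^ 2)).prod =
      Ext.comap (ContinuousLinearMap.snd ℝ (Fin (k + 1) → ℝ) (Fin (k + 1) → Mat n))
        (L.map (extLetter x.2)).prod := by
  rw [map_list_prod, List.map_map]
  congr 2
  funext ℓ
  cases ℓ with
  | inl a => exact (Ext.comap_lin _ _).symm
  | inr ij =>
    simp only [Sum.elim_inr, Function.comp_apply, extLetter, RingHom.map_pow, Ext.comap_lin]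

/-- Every letter is a multiple of a product of two 1-forms, and such elements are cyclic under the
trace without a sign. -/
theorem traceComm_sum_nerveLetter {k : ℕ} (x : Ambient n (k + 1) (k + 1)) :
    Ext.TraceComm (trR n) (∑ ℓ, nerveLetter x ℓ) := by
  refine Ext.TraceComm.sum fun ℓ _ => ?_
  cases ℓ with
  | inl a => exact Ext.traceComm_lin_mul_lin trR_mul_comm _ _
  | inr ij =>
    refine Ext.TraceComm.smul ?_ _
    rw [sq]
    exact Ext.traceComm_lin_mul_lin trR_mul_comm _ _

/-- The vectors at which contracted forms are evaluated. -/
def tangentFamily {r s N : ℕ} (e : r + s = N) {k : ℕ} (v : Fin s → Fin k → Mat n) :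
    Fin N → Ambient n r k := fun a =>
  Fin.append (fun i : Fin r => ((Pi.single i 1, 0) : Ambient n r k))
    (fun j : Fin s => ((0, v j) : Ambient n r k)) (Fin.cast e.symm a)

theorem contract_apply {r s N k : ℕ} (e : r + s = N) (w : Ambient n r k [⋀^Fin N]→L[ℝ] ℂ)
    (v : Fin s → Fin k → Mat n) : contract e w v = w (tangentFamily e v) := rfl

/-- After the scalar 1-forms are sorted to the front, evaluation splits into their determinant on
the coordinate fields, which is `listSign`, and a form on the group factor alone. -/
theorem coeff_letter_prod {k s N : ℕ} (x : Ambient n (k + 1) (k + 1)) (e : k + 1 + s = N)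
    (v : Fin s → Fin (k + 1) → Mat n) (L : List (Letter k)) :
    (Ext.scal (dtau n (k + 1) (k + 1) 0) * Ext.lin (phi x.2 0 ∘L
        ContinuousLinearMap.snd ℝ (Fin (k + 1) → ℝ) (Fin (k + 1) → Mat n)) *
      (L.map (nerveLetter x)).prod).coeff N (tangentFamily e v) =
    ((-1) ^ ((k + 1) * k / 2) * (listSign (L.filterMap Sum.getLeft?) *
      (L.map (Sum.elim (fun _ => 1) fun ij => bary x.1 ij.1.1 * bary x.1 ij.1.2)).prod) : ℝ) •
      (Ext.lin (phi x.2 0) * (L.map (extLetter x.2)).prod).coeff s v := by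
  unfold nerveLetter
  rw [Ext.scal_mul_lin_mul_prod_map_letter, comap_snd_extLetter, ← Ext.comap_lin,
    ← RingHom.map_mul, Ext.coeff_smul]
  have h := Ext.coeff_scal_prod_mul_comap
    (ContinuousLinearMap.snd ℝ (Fin (k + 1) → ℝ) (Fin (k + 1) → Mat n))
    (Ext.lin (phi x.2 0) * (L.map (extLetter x.2)).prod)
    (dtau n (k + 1) (k + 1) 0 :: (L.filterMap Sum.getLeft?).map fun a =>
      dtau n (k + 1) (k + 1) a.succ) e (fun i => (Pi.single i 1, 0)) (fun i => rfl)
    (fun j => (0, v j)) (by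
      intro a ha j
      rw [List.mem_cons, List.mem_map] at ha
      rcases ha with rfl | ⟨b, _, rfl⟩
      · exact dtau_snd _ _
      · exact dtau_snd _ _)
  rw [pairing_dtau] at h
  rw [ContinuousAlternatingMap.smul_apply]
  refine (congrArg _ h).trans ?_
  rw [smul_smul]
  congr 1
  -- The sorting sign depends on the actual number of letters `φ`. If that number is not `k`,
  -- `listSign` vanishes, so the exponent may be written with `k` throughout.
  by_cases hL : (L.filterMap Sum.getLeft?).length = k
  · rw [hL]
    ring
  · have : listSign (L.filterMap Sum.getLeft?) = 0 := by
      rw [← pairing_dtau (n := n) (r := k + 1), Ext.pairing_eq_zero]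
      simpa using hL
    rw [this]
    ring

/-- None of the remaining scalar 1-forms contains `dt_1`, so contraction with `∂/∂t_1` gives zero.
-/
theorem coeff_sum_nerveLetter_pow {k s N : ℕ} (x : Ambient n (k + 1) (k + 1)) (e : k + 1 + s = N)
    (v : Fin s → Fin (k + 1) → Mat n) (p : ℕ) :
    ((∑ ℓ, nerveLetter x ℓ) ^ p).coeff N (tangentFamily e v) = 0 := by
  rw [Ext.add_sum_pow, Ext.coeff_sum, ContinuousAlternatingMap.sum_apply]
  refine Finset.sum_eq_zero fun u _ => ?_
  unfold nerveLetter
  rw [Ext.prod_map_letter, comap_snd_extLetter, Ext.coeff_smul,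
    ContinuousAlternatingMap.smul_apply]
  have h := Ext.coeff_scal_prod_mul_comap
    (ContinuousLinearMap.snd ℝ (Fin (k + 1) → ℝ) (Fin (k + 1) → Mat n))
    ((List.ofFn u).map (extLetter x.2)).prod
    (((List.ofFn u).filterMap Sum.getLeft?).map fun a => dtau n (k + 1) (k + 1) a.succ) e
    (fun i => (Pi.single i 1, 0)) (fun i => rfl) (fun j => (0, v j)) (by
      intro a ha j
      obtain ⟨b, _, rfl⟩ := List.mem_map.1 ha
      exact dtau_snd _ _)
  rw [Ext.pairing_eq_zero_of_forall _ _ 0, zero_smul] at h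
  · exact (congrArg _ h).trans (smul_zero _)
  · intro a ha
    obtain ⟨b, _, rfl⟩ := List.mem_map.1 ha
    rw [dtau_single]
    simp

/-- The constant in the explicit formula. -/
def formulaConst (l k : ℕ) : ℂ :=
  (1 / (l.factorial : ℂ)) * (1 / (2 * Real.pi * Complex.I)) ^ (l + 1) * (-1) ^ ((k + 1) * k / 2)

/-- The explicit formula before integration. Only words with exactly one leading letter `D`
contribute, and the sum over all words replaces the sum over `σ` and insertions, with `listSign`
selecting the admissible ones. -/
theorem contract_nerveForm {k s l : ℕ} {x : Ambient n (k + 1) (k + 1)}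
    (hx : x.2 ∈ GPow n (k + 1)) (e : k + 1 + s = 2 * (l + 1)) :
    contract e (nerveForm n (l + 1) (k + 1) x) = formulaConst l k •
      ∑ u : Fin l → Letter k, (listSign ((List.ofFn u).filterMap Sum.getLeft?) *
        wordMonomial u x.1) • wordForm s u x.2 := by
  ext v
  set D := Ext.scal (dtau n (k + 1) (k + 1) 0) * Ext.lin (phi x.2 0 ∘L
        ContinuousLinearMap.snd ℝ (Fin (k + 1) → ℝ) (Fin (k + 1) → Mat n)) with hD
  set B := ∑ ℓ, nerveLetter x ℓ with hB
  have h1 : nerveCurv n (k + 1) x = (-1 : ℝ) • (D + B) := by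
    rw [nerveCurv_eq hx, neg_one_smul]
  -- The trace of the power is affine in `D`; its linear part carries the factor `l + 1 = p`.
  have h2 : Ext.map (trR n) ((D + B) ^ (l + 1)) = Ext.map (trR n) (B ^ (l + 1)) +
      (l + 1 : ℝ) • Ext.map (trR n) (D * B ^ l) := Ext.map_add_pow
    (fun Z => Ext.scal_mul_mul_scal_mul _ _ _ _ : ∀ Z, D * Z * D = 0) (traceComm_sum_nerveLetter x) l
  have h3 : (Ext.map (trR n) (B ^ (l + 1))).coeff (2 * (l + 1)) (tangentFamily e v) = 0 := by
    have := coeff_sum_nerveLetter_pow x e v (l + 1)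
    rw [Ext.coeff_map]
    change trR n ((B ^ (l + 1)).coeff (2 * (l + 1)) (tangentFamily e v)) = 0
    rw [this, map_zero]
  have h4 : (Ext.map (trR n) (D * B ^ l)).coeff (2 * (l + 1)) (tangentFamily e v) =
      ((-1 : ℝ) ^ ((k + 1) * k / 2)) • ∑ u : Fin l → Letter k,
        (listSign ((List.ofFn u).filterMap Sum.getLeft?) * wordMonomial u x.1) •
          wordForm s u x.2 v := by
    rw [Ext.coeff_map]
    change trR n ((D * B ^ l).coeff (2 * (l + 1)) (tangentFamily e v)) = _
    rw [hB, Ext.add_sum_pow, Finset.mul_sum, Ext.coeff_sum, ContinuousAlternatingMap.sum_apply,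
      map_sum, Finset.smul_sum]
    refine Finset.sum_congr rfl fun u _ => ?_
    rw [hD, coeff_letter_prod, map_smul, prod_map_ofFn_eq_prod_pow_count, wordForm_eq, smul_smul]
    rfl
  rw [contract_apply, nerveForm, h1, smul_pow, map_smul, h2]
  simp only [ContinuousAlternatingMap.smul_apply, ContinuousAlternatingMap.sum_apply,
    ContinuousAlternatingMap.add_apply, Ext.coeff_smul, Ext.coeff_add, h3, h4, zero_add]
  generalize (∑ u : Fin l → Letter k,
        (listSign ((List.ofFn u).filterMap Sum.getLeft?) * wordMonomial u x.1) •
          wordForm s u x.2 v) = S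
  simp only [Complex.real_smul, smul_eq_mul, chernConst, formulaConst]
  push_cast
  rw [Nat.factorial_succ, neg_pow (1 / (2 * Real.pi * Complex.I) : ℂ)]
  have e1 : (-1 : ℂ) ^ (l + 1) * (-1) ^ (l + 1) = 1 := by rw [← mul_pow]; norm_num
  have e2 : ((l : ℂ) + 1) ≠ 0 := by exact_mod_cast Nat.succ_ne_zero l
  push_cast
  have e3 : (1 / (((l : ℂ) + 1) * l.factorial)) * ((l : ℂ) + 1) = 1 / l.factorial := by
    field_simp
  -- The sign `(-1)^p` of the curvature cancels that of the normalization, and `p / p! = 1 /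
  -- (p-1)!`.
  linear_combination (1 / (2 * Real.pi * Complex.I) : ℂ) ^ (l + 1) * (-1) ^ ((k + 1) * k / 2) * S *
    (1 / (((l : ℂ) + 1) * l.factorial)) * ((l : ℂ) + 1) * e1 +
    (1 / (2 * Real.pi * Complex.I) : ℂ) ^ (l + 1) * (-1) ^ ((k + 1) * k / 2) * S * e3

theorem nerveForm_zero {l : ℕ} (x : Ambient n 0 0) : nerveForm n (l + 1) 0 x = 0 := by
  rw [nerveForm, nerveCurv_zero, zero_pow (Nat.succ_ne_zero l), map_zero]
  ext v
  simp [Ext.coeff_zero]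

end Words

open MeasureTheory

/-! ### Compactness of the simplex and integrability. -/

section SimplexTopology

theorem isClosed_simplex (r : ℕ) : IsClosed (simplex r) := by
  have h : simplex r = (⋂ i, {t : Fin r → ℝ | 0 ≤ t i}) ∩ {t | ∑ i, t i ≤ 1} := by
    ext t
    simp [simplex]
  rw [h]
  exact (isClosed_iInter fun i => isClosed_le continuous_const (continuous_apply i)).inter
    (isClosed_le (by fun_prop) continuous_const)

theorem simplex_subset_Icc (r : ℕ) : simplex r ⊆ Set.Icc 0 1 := by
  intro t ht
  refine ⟨ht.1, fun i => ?_⟩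
  exact (Finset.single_le_sum (fun j _ => ht.1 j) (Finset.mem_univ i)).trans ht.2

theorem isCompact_simplex (r : ℕ) : IsCompact (simplex r) :=
  isCompact_Icc.of_isClosed_subset (isClosed_simplex r) (simplex_subset_Icc r)

theorem integrableOn_simplex {E : Type*} [NormedAddCommGroup E] {r : ℕ} {f : (Fin r → ℝ) → E}
    (hf : Continuous f) : IntegrableOn f (simplex r) :=
  hf.continuousOn.integrableOn_compact (isCompact_simplex r)

theorem setIntegral_sum_smul_const {E : Type*} [NormedAddCommGroup E] [NormedSpace ℝ E]
    [CompleteSpace E] {ι : Type*} [Fintype ι] {r : ℕ} {P : ι → (Fin r → ℝ) → ℝ}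
    (hP : ∀ i, Continuous (P i)) (c : ι → E) :
    ∫ t in simplex r, ∑ i, P i t • c i = ∑ i, (∫ t in simplex r, P i t) • c i := by
  rw [integral_finsetSum]
  · simp only [integral_smul_const]
  · exact fun i _ => integrableOn_simplex ((hP i).smul continuous_const)

theorem contDiff_bary_apply {m : ℕ} (l : Fin (m + 1)) :
    ContDiff ℝ ∞ fun t : Fin m → ℝ => bary t l := by
  refine Fin.cases ?_ (fun i => ?_) l
  · have h : ContDiff ℝ ∞ fun y : Fin m → ℝ => 1 - ∑ i, y i :=
      contDiff_const.sub (ContDiff.sum fun i _ => contDiff_apply ℝ ℝ i)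
    exact h
  · exact contDiff_apply ℝ ℝ i

theorem contDiff_wordMonomial {k l : ℕ} (u : Fin l → Letter k) :
    ContDiff ℝ ∞ (wordMonomial u) :=
  contDiff_prod fun _ _ => ((contDiff_bary_apply _).mul (contDiff_bary_apply _)).pow _

end SimplexTopology

/-! ### The integral over the simplex and the explicit components. -/

section Integral

variable {n : ℕ}

theorem contract_zero {r k s N : ℕ} (e : r + s = N) :
    contract e (0 : Ambient n r k [⋀^Fin N]→L[ℝ] ℂ) = 0 := by
  ext v
  rfl

/-- The integral over the simplex of the Chern character form, in closed form. -/
def integralForm (n l k s : ℕ) (h : Fin (k + 1) → Mat n) :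
    (Fin (k + 1) → Mat n) [⋀^Fin s]→L[ℝ] ℂ :=
  formulaConst l k • ∑ u : Fin l → Letter k,
    (listSign ((List.ofFn u).filterMap Sum.getLeft?) * coefficient u) • wordForm s u h

theorem fiberIntegral_of_ne {r s N : ℕ} (h : r + s ≠ N)
    (w : Ambient n r r → Ambient n r r [⋀^Fin N]→L[ℝ] ℂ) : fiberIntegral s w = 0 := by
  funext x
  rw [fiberIntegral, dif_neg h]
  rfl

theorem fiberIntegral_nerveChernForm_zero (l s : ℕ) :
    fiberIntegral s (nerveChernForm n (l + 1) 0) = 0 := by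
  funext h
  rw [fiberIntegral]
  split_ifs with e
  · have h0 : ∀ x : Ambient n 0 0, nerveChernForm n (l + 1) 0 x = 0 := by
      intro x
      rw [nerveChernForm]
      by_cases hx : x ∈ simplexTimes n 0 0
      · rw [Set.indicator_of_mem hx, nerveForm_zero]
      · rw [Set.indicator_of_notMem hx]
    simp only [h0, contract_zero, integral_zero]
    rfl
  · rfl

/-- After contraction the integrand is a finite sum of polynomials in `t` with coefficients
independent of `t`, so only scalar integrals are left. -/
theorem fiberIntegral_nerveChernForm (l k s : ℕ) (e : k + 1 + s = 2 * (l + 1)) :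
    fiberIntegral s (nerveChernForm n (l + 1) (k + 1)) =
      (GPow n (k + 1)).indicator (integralForm n l k s) := by
  funext h
  rw [fiberIntegral, dif_pos e]
  by_cases hh : h ∈ GPow n (k + 1)
  · have h1 : ∀ t ∈ simplex (k + 1), contract e (nerveChernForm n (l + 1) (k + 1) (t, h)) =
        ∑ u : Fin l → Letter k, (listSign ((List.ofFn u).filterMap Sum.getLeft?) *
          wordMonomial u t) • (formulaConst l k • wordForm s u h) := by
      intro t ht
      have hx : ((t, h) : Ambient n (k + 1) (k + 1)) ∈ simplexTimes n (k + 1) (k + 1) := ⟨ht, hh⟩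
      rw [nerveChernForm, Set.indicator_of_mem hx, contract_nerveForm (x := (t, h)) hh e]
      ext v
      simp only [ContinuousAlternatingMap.smul_apply, ContinuousAlternatingMap.sum_apply,
        Finset.smul_sum]
      exact Finset.sum_congr rfl fun u _ => smul_comm _ _ _
    rw [Set.indicator_of_mem hh, setIntegral_congr_fun (isClosed_simplex _).measurableSet h1]
    refine (setIntegral_sum_smul_const
      (fun u => continuous_const.mul (contDiff_wordMonomial u).continuous) _).trans ?_
    rw [integralForm]
    ext v
    simp only [ContinuousAlternatingMap.smul_apply, ContinuousAlternatingMap.sum_apply,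
        Finset.smul_sum]
    refine Finset.sum_congr rfl fun u _ => ?_
    simp only [Pi.mul_apply, integral_const_mul]
    rw [smul_comm]
    rfl
  · rw [Set.indicator_of_notMem hh]
    have h0 : ∀ t, nerveChernForm n (l + 1) (k + 1) (t, h) = 0 := fun t =>
      Set.indicator_of_notMem (fun hx => hh (simplexTimes_mk hx).2) _
    simp only [h0, contract_zero, integral_zero]

theorem contDiffAt_integralForm (l k s : ℕ) {h : Fin (k + 1) → Mat n}
    (hh : h ∈ GPow n (k + 1)) : ContDiffAt ℝ ∞ (integralForm n l k s) h := by
  have h1 : ContDiffAt ℝ ∞ (fun h => ∑ u : Fin l → Letter k,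
      (listSign ((List.ofFn u).filterMap Sum.getLeft?) * coefficient u) • wordForm s u h) h :=
    ContDiffAt.sum fun u _ => (contDiffAt_wordForm s u hh).const_smul
      (listSign ((List.ofFn u).filterMap Sum.getLeft?) * coefficient u)
  exact h1.const_smul (formulaConst l k)

theorem fiberIntegral_nerveChernForm_mem (l r s : ℕ) :
    fiberIntegral s (nerveChernForm n (l + 1) r) ∈ forms (GPow n r) s := by
  by_cases e : r + s = 2 * (l + 1)
  swap
  · rw [fiberIntegral_of_ne e]
    exact Submodule.zero_mem _
  cases r with
  | zero =>
    rw [fiberIntegral_nerveChernForm_zero]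
    exact Submodule.zero_mem _
  | succ k =>
    rw [fiberIntegral_nerveChernForm l k s e]
    refine ⟨?_, fun x hx => Set.indicator_of_notMem hx _⟩
    have h : ContDiffOn ℝ ∞ (integralForm n l k s) (GPow n (k + 1)) := fun x hx =>
      (contDiffAt_integralForm l k s hx).contDiffWithinAt
    exact h.congr fun x hx => Set.indicator_of_mem hx _

/-- The cochain `I_Δ` of the Chern character form. -/
def integralCochain (n l : ℕ) : DoubleComplex n := fun r s =>
  ⟨fiberIntegral s (nerveChernForm n (l + 1) r), fiberIntegral_nerveChernForm_mem l r s⟩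

theorem isIntegralOf_integralCochain (n l : ℕ) :
    IsIntegralOf (integralCochain n l) (nerveChernForm n (l + 1)) := fun _ _ => rfl

theorem listSign_eq_zero {k : ℕ} {L : List (Fin k)} (hL : L.length ≠ k) : listSign L = 0 := by
  refine Finset.sum_eq_zero fun σ _ => if_neg ?_
  rintro rfl
  exact hL (by simp)

/-- A word of `l` letters cannot contain `k > l` letters `φ`, so `listSign` vanishes on all of them.
-/
theorem integralForm_eq_zero {l k : ℕ} (h : l < k) (s : ℕ) : integralForm n l k s = 0 := by
  funext x
  rw [integralForm, Finset.sum_eq_zero]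
  · ext v
    simp
  · intro u _
    rw [listSign_eq_zero, zero_mul]
    · ext v
      simp
    · have := List.length_filterMap_le (Sum.getLeft? : Letter k → _) (List.ofFn u)
      rw [List.length_ofFn] at this
      omega

/-- Writing `listSign` as a sum over `σ` and exchanging the sums groups the words by the permutation
they insert into. -/
theorem integralForm_eq_component (q k : ℕ) :
    (GPow n (k + 1)).indicator (integralForm n (k + q) k (k + q + 1 + q)) =
      component n (k + q + 1) q k := by
  unfold component
  refine congrArg _ (funext fun h => ?_)
  ext v
  have h1 : ∀ u : Fin (k + q) → Letter k,
      (listSign ((List.ofFn u).filterMap Sum.getLeft?) * coefficient u) •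
        wordForm (k + q + 1 + q) u h v = ∑ σ : Equiv.Perm (Fin k),
          if (List.ofFn u).filterMap Sum.getLeft? = List.ofFn σ then
            (((Equiv.Perm.sign σ : ℤ) : ℝ) * coefficient u) •
              wordForm (k + q + 1 + q) u h v else 0 := by
    intro u
    rw [listSign, Finset.sum_mul, Finset.sum_smul]
    refine Finset.sum_congr rfl fun σ _ => ?_
    split_ifs
    · rfl
    · simp
  have h2 : (∑ u : Fin (k + q) → Letter k,
      (listSign ((List.ofFn u).filterMap Sum.getLeft?) * coefficient u) •
        wordForm (k + q + 1 + q) u h) v = ∑ σ : Equiv.Perm (Fin k), ∑ u ∈ insertions q σ,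
          (((Equiv.Perm.sign σ : ℤ) : ℝ) * coefficient u) • wordForm (k + q + 1 + q) u h v := by
    rw [ContinuousAlternatingMap.sum_apply]
    simp only [ContinuousAlternatingMap.smul_apply, h1]
    rw [Finset.sum_comm]
    refine Finset.sum_congr rfl fun σ _ => ?_
    rw [insertions, Finset.sum_filter]
  rw [integralForm, ContinuousAlternatingMap.smul_apply, h2, ContinuousAlternatingMap.smul_apply]
  congr 1
  have h3 : ∀ Z : (Fin (k + 1) → Mat n) [⋀^Fin (k + q + 1 + q)]→L[ℝ] Mat n,
      traceForm Z v = trR n (Z v) := fun _ => rfl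
  rw [h3]
  simp only [Pi.smul_apply, ContinuousAlternatingMap.sum_apply,
    ContinuousAlternatingMap.smul_apply, map_sum, map_smul]
  rfl

theorem integralCochain_eq_component (q k : ℕ) :
    (integralCochain n (k + q) (k + 1) (k + q + 1 + q) :
      (Fin (k + 1) → Mat n) → (Fin (k + 1) → Mat n) [⋀^Fin (k + q + 1 + q)]→L[ℝ] ℂ) =
      component n (k + q + 1) q k :=
  (fiberIntegral_nerveChernForm (k + q) k _ (by omega)).trans (integralForm_eq_component q k)

theorem integralCochain_eq_zero {l r s : ℕ} (h : ¬ ∃ q < l + 1, r = l + 1 - q ∧ s = l + 1 + q) :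
    integralCochain n l r s = 0 := by
  refine Subtype.ext ?_
  change fiberIntegral s (nerveChernForm n (l + 1) r) = 0
  by_cases e : r + s = 2 * (l + 1)
  swap
  · exact fiberIntegral_of_ne e _
  cases r with
  | zero => exact fiberIntegral_nerveChernForm_zero l s
  | succ k =>
    rw [fiberIntegral_nerveChernForm l k s e, integralForm_eq_zero]
    · funext x
      by_cases hx : x ∈ GPow n (k + 1)
      · rw [Set.indicator_of_mem hx]
      · rw [Set.indicator_of_notMem hx]
        rfl
    · by_contra hk
      -- The equation `k + 1 = l + 1 - q` forces this `q`.
      exact h ⟨l - k, by omega, by omega, by omega⟩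

end Integral

open MeasureTheory

/-! ### Stokes' theorem on the simplex. -/

section Stokes

variable {E : Type*} [NormedAddCommGroup E] [NormedSpace ℝ E] [CompleteSpace E]

theorem insertNth_mem_simplex_iff {r : ℕ} (i : Fin (r + 1)) (s : ℝ) (y : Fin r → ℝ) :
    (i.insertNth s y : Fin (r + 1) → ℝ) ∈ simplex (r + 1) ↔
      y ∈ simplex r ∧ s ∈ Set.Icc 0 (1 - ∑ j, y j) := by
  simp only [simplex, Set.mem_ofPred_eq, Fin.forall_iff_succAbove i, Fin.sum_univ_succAbove _ i,
    Fin.insertNth_apply_same, Fin.insertNth_apply_succAbove, Set.mem_Icc]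
  constructor
  · rintro ⟨⟨h1, h2⟩, h3⟩
    exact ⟨⟨h2, by linarith⟩, h1, by linarith⟩
  · rintro ⟨⟨h1, h2⟩, h3, h4⟩
    exact ⟨⟨h3, h1⟩, by linarith⟩

/-- Integration over the simplex, one coordinate first. -/
theorem setIntegral_simplex_succ {r : ℕ} (i : Fin (r + 1)) {F : (Fin (r + 1) → ℝ) → E}
    (hF : Continuous F) :
    ∫ t in simplex (r + 1), F t =
      ∫ y in simplex r, ∫ s in (0 : ℝ)..(1 - ∑ j, y j), F (i.insertNth s y) := by
  have hm := (isClosed_simplex (r + 1)).measurableSet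
  have hint : Integrable ((simplex (r + 1)).indicator F) :=
    (integrable_indicator_iff hm).2 (integrableOn_simplex hF)
  have hmp := (volume_preserving_piFinSuccAbove (fun _ : Fin (r + 1) => ℝ) i).symm
  rw [← integral_indicator hm, ← hmp.integral_comp', Measure.volume_eq_prod, integral_prod_symm _
    (by
      rw [← Measure.volume_eq_prod]
      exact (hmp.integrable_comp_emb (MeasurableEquiv.measurableEmbedding _)).2 hint),
    ← integral_indicator (isClosed_simplex r).measurableSet]
  congr 1
  funext y
  have e : ∀ s : ℝ, (simplex (r + 1)).indicator F
      ((MeasurableEquiv.piFinSuccAbove (fun _ : Fin (r + 1) => ℝ) i).symm (s, y)) =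
      (simplex r).indicator (fun y => (Set.Icc 0 (1 - ∑ j, y j)).indicator
        (fun s => F (i.insertNth s y)) s) y := by
    intro s
    change (simplex (r + 1)).indicator F (i.insertNth s y) = _
    have := insertNth_mem_simplex_iff i s y
    by_cases hy : y ∈ simplex r
    · rw [Set.indicator_of_mem hy]
      by_cases hs : s ∈ Set.Icc 0 (1 - ∑ j, y j)
      · rw [Set.indicator_of_mem hs, Set.indicator_of_mem (this.2 ⟨hy, hs⟩)]
      · rw [Set.indicator_of_notMem hs, Set.indicator_of_notMem fun h => hs (this.1 h).2]
    · rw [Set.indicator_of_notMem hy, Set.indicator_of_notMem fun h => hy (this.1 h).1]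
  simp only [e]
  by_cases hy : y ∈ simplex r
  · simp only [Set.indicator_of_mem hy]
    rw [integral_indicator measurableSet_Icc, integral_Icc_eq_integral_Ioc,
      intervalIntegral.integral_of_le (by linarith [hy.2])]
  · simp only [Set.indicator_of_notMem hy, integral_zero]

theorem coface_zero {r : ℕ} (t : Fin r → ℝ) : coface 0 t = bary t := by
  funext j
  simp [coface, Fin.tail]

theorem coface_succ {r : ℕ} (i : Fin (r + 1)) (t : Fin r → ℝ) :
    coface i.succ t = (i.insertNth 0 t : Fin (r + 1) → ℝ) := by
  funext j
  simp only [coface, Fin.tail]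
  rcases Fin.eq_self_or_eq_succAbove i j with rfl | ⟨l, rfl⟩
  · simp
  · rw [← Fin.succ_succAbove_succ, Fin.insertNth_apply_succAbove, Fin.insertNth_apply_succAbove]
    simp [bary]

/-- The volume of the simplex is invariant under the affine permutation exchanging the zeroth and
another barycentric coordinate. -/
theorem setIntegral_simplex_insertNth {r : ℕ} (i : Fin (r + 1)) {f : (Fin (r + 1) → ℝ) → E}
    (hf : Continuous f) :
    ∫ y in simplex r, f (i.insertNth (1 - ∑ j, y j) y) = ∫ t in simplex r, f (bary t) := by
  refine Fin.cases ?_ (fun i' => ?_) i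
  · refine congrArg _ (funext fun y => ?_)
    rw [Fin.insertNth_zero']
    rfl
  · cases r with
    | zero => exact i'.elim0
    | succ r =>
      have hb : Continuous fun t : Fin (r + 1) → ℝ => f (bary t) :=
        hf.comp (continuous_pi fun l => (contDiff_bary_apply l).continuous)
      have hc : Continuous fun y : Fin (r + 1) → ℝ =>
          f ((i'.succ).insertNth (1 - ∑ j, y j) y) := by
        refine hf.comp (Continuous.finInsertNth _ ?_ continuous_id)
        fun_prop
      rw [setIntegral_simplex_succ 0 hc, setIntegral_simplex_succ i' hb]
      refine congrArg _ (funext fun y => ?_)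
      -- With the first coordinate innermost on the left and coordinate `i'` innermost on the right,
      -- the substitution `s ↦ (1 - ∑ y) - s` makes the two points agree.
      have h1 := intervalIntegral.integral_comp_sub_left (a := 0) (b := 1 - ∑ j, y j)
        (fun s => f (bary (i'.insertNth s y : Fin (r + 1) → ℝ))) (1 - ∑ j, y j)
      rw [sub_self, sub_zero] at h1
      rw [← h1]
      refine intervalIntegral.integral_congr fun s _ => congrArg f ?_
      rw [Fin.insertNth_zero', Fin.sum_cons]
      funext j
      rcases Fin.eq_self_or_eq_succAbove i'.succ j with rfl | ⟨l, rfl⟩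
      · simp only [Fin.insertNth_apply_same, bary, Fin.cons_succ]
        ring
      · rw [Fin.insertNth_apply_succAbove]
        refine Fin.cases ?_ (fun l => ?_) l
        · rw [Fin.succ_succAbove_zero, bary, Fin.cons_zero, Fin.cons_zero,
            Fin.sum_univ_succAbove _ i']
          simp only [Fin.insertNth_apply_same, Fin.insertNth_apply_succAbove]
          ring
        · rw [Fin.succ_succAbove_succ, bary, Fin.cons_succ, Fin.cons_succ,
            Fin.insertNth_apply_succAbove]

/-- Stokes' theorem for the form `f dt_1 ⋯ \hat{dt_i} ⋯ dt_{r+1}` on the simplex. -/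
theorem setIntegral_simplex_fderiv {r : ℕ} (i : Fin (r + 1)) {f : (Fin (r + 1) → ℝ) → E}
    (hf : ContDiff ℝ 1 f) :
    ∫ t in simplex (r + 1), fderiv ℝ f t (Pi.single i 1) =
      (∫ t in simplex r, f (coface 0 t)) - ∫ t in simplex r, f (coface i.succ t) := by
  have hc : Continuous fun t => fderiv ℝ f t (Pi.single i 1) :=
    (hf.continuous_fderiv one_ne_zero).clm_apply continuous_const
  have hins : ∀ y : Fin r → ℝ, ∀ s : ℝ, HasDerivAt
      (fun s : ℝ => (i.insertNth s y : Fin (r + 1) → ℝ)) (Pi.single i 1) s := by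
    intro y s
    rw [hasDerivAt_pi]
    intro j
    rcases Fin.eq_self_or_eq_succAbove i j with rfl | ⟨l, rfl⟩
    · simp only [Fin.insertNth_apply_same, Pi.single_eq_same]
      exact hasDerivAt_id' s
    · simpa [Pi.single_apply] using hasDerivAt_const s (y l)
  -- The fundamental theorem of calculus along direction `i`, from the coordinate face to the
  -- slanted face `t_0 = 0`.
  have h1 : ∀ y : Fin r → ℝ, ∫ s in (0 : ℝ)..(1 - ∑ j, y j),
      fderiv ℝ f (i.insertNth s y) (Pi.single i 1) =
        f (i.insertNth (1 - ∑ j, y j) y) - f (i.insertNth 0 y) := by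
    intro y
    have hd : ∀ s, HasDerivAt (fun s => f (i.insertNth s y))
        (fderiv ℝ f (i.insertNth s y) (Pi.single i 1)) s := fun s =>
      ((hf.differentiable one_ne_zero _).hasFDerivAt.comp_hasDerivAt s (hins y s))
    refine intervalIntegral.integral_eq_sub_of_hasDerivAt (fun s _ => hd s) ?_
    refine Continuous.intervalIntegrable ?_ _ _
    exact hc.comp (continuous_iff_continuousAt.2 fun s => (hins y s).continuousAt)
  rw [setIntegral_simplex_succ i hc]
  simp only [h1, coface_succ, coface_zero]
  have c1 : Continuous fun y : Fin r → ℝ =>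
      f (i.insertNth (1 - ∑ j, y j) y : Fin (r + 1) → ℝ) := by
    refine hf.continuous.comp (Continuous.finInsertNth _ ?_ continuous_id)
    fun_prop
  have c2 : Continuous fun y : Fin r → ℝ => f (i.insertNth 0 y : Fin (r + 1) → ℝ) :=
    hf.continuous.comp (Continuous.finInsertNth _ continuous_const continuous_id)
  rw [integral_sub (integrableOn_simplex c1) (integrableOn_simplex c2),
    setIntegral_simplex_insertNth i hf.continuous]

end Stokes

open MeasureTheory

/-! ### Evaluation of alternating forms on concatenated families of vectors. -/

section Alternating

variable {V : Type*} [NormedAddCommGroup V] [NormedSpace ℝ V]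

/-- Column operations, one argument at a time; `c i = 0` ensures that `X i` itself stays in place.
-/
theorem ContinuousAlternatingMap.map_sub_smul {B : Type*} [NormedAddCommGroup B] [NormedSpace ℝ B]
    {N : ℕ} (g : V [⋀^Fin N]→L[ℝ] B) (X : Fin N → V) (i : Fin N) (c : Fin N → ℝ) (hc : c i = 0) :
    g (fun j => X j - c j • X i) = g X := by
  set X' : Fin N → V := fun j => X j - c j • X i with hX'
  have h : ∀ s : Finset (Fin N), g (s.piecewise X' X) = g X := by
    intro s
    induction s using Finset.induction_on with
    | empty => simp
    | insert j s hj ih =>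
      rw [Finset.piecewise_insert, hX']
      simp only
      rw [sub_eq_add_neg, ← neg_smul, g.map_update_add, g.map_update_smul]
      have h1 : Function.update (s.piecewise X' X) j (X j) = s.piecewise X' X := by
        rw [Function.update_eq_self_iff, Finset.piecewise_eq_of_notMem _ _ _ hj]
      have h2 : c j • g (Function.update (s.piecewise X' X) j (X i)) = 0 := by
        by_cases hji : j = i
        · rw [hji, hc, zero_smul]
        · rw [g.map_eq_zero_of_eq _ _ hji, smul_zero]
          rw [Function.update_self, Function.update_of_ne (Ne.symm hji)]
          by_cases his : i ∈ s
          · rw [Finset.piecewise_eq_of_mem _ _ _ his, hX']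
            simp [hc]
          · rw [Finset.piecewise_eq_of_notMem _ _ _ his]
      rw [← hX', h1, ih, neg_smul, h2, neg_zero, add_zero]
  simpa using h Finset.univ

/-- Both sides compute `(ε ∧ f) X`. The right side is its expansion; the left is the same value
after subtracting multiples of `X 0`, when `ε` kills all vectors but the first. It is needed for the
slanted face of the simplex. -/
theorem map_sub_smul_zero {N : ℕ} (f : V [⋀^Fin N]→L[ℝ] ℂ) (ε : V →L[ℝ] ℝ) (X : Fin (N + 1) → V)
    (h : ε (X 0) = 1) :
    f (fun j => X j.succ - ε (X j.succ) • X 0) =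
      ∑ i : Fin (N + 1), (-1 : ℝ) ^ (i : ℕ) • ε (X i) • f (i.removeNth X) := by
  set g := (Ext.scal ε * Ext.of f : Ext V ℂ).coeff (N + 1) with hg
  have h1 : ∀ Y : Fin (N + 1) → V,
      g Y = ∑ i : Fin (N + 1), (-1 : ℝ) ^ (i : ℕ) • ε (Y i) • f (i.removeNth Y) := by
    intro Y
    rw [hg, Ext.coeff_scal_mul_succ, Ext.coeff_of]
    refine Finset.sum_congr rfl fun i _ => ?_
    rw [← Int.cast_smul_eq_zsmul ℝ]
    push_cast
    rfl
  rw [← h1, ← ContinuousAlternatingMap.map_sub_smul g X 0 (Fin.cons 0 fun j => ε (X j.succ)) rfl,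
    h1, Fin.sum_univ_succ]
  have h2 : ∀ j : Fin N, ε (X j.succ - (Fin.cons 0 (fun j => ε (X j.succ)) : Fin (N + 1) → ℝ)
      j.succ • X 0) = 0 := by
    intro j
    simp [h]
  simp only [h2, zero_smul, smul_zero, Finset.sum_const_zero, add_zero]
  simp only [Fin.cons_zero, zero_smul, sub_zero, h, Fin.val_zero, pow_zero, one_smul,
    Fin.removeNth_zero]
  rfl

/-- The concatenation of two families of vectors. -/
def frame {α : Type*} {r s N : ℕ} (e : r + s = N) (X : Fin r → α) (Y : Fin s → α) : Fin N → α :=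
  fun a => Fin.append X Y (Fin.cast e.symm a)

theorem frame_comp {α β : Type*} {r s N : ℕ} (e : r + s = N) (X : Fin r → α) (Y : Fin s → α)
    (f : α → β) :
    (fun a => f (frame e X Y a)) = frame e (fun i => f (X i)) fun j => f (Y j) := by
  funext a
  unfold frame
  refine Fin.addCases (fun b => ?_) (fun b => ?_) (Fin.cast e.symm a)
  · simp
  · simp

theorem sum_frame {M : Type*} [AddCommMonoid M] {r s N : ℕ} (e : r + s = N) (f : Fin N → M) :
    ∑ a, f a = ∑ i : Fin r, f (Fin.cast e (Fin.castAdd s i)) +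
      ∑ j : Fin s, f (Fin.cast e (Fin.natAdd r j)) := by
  rw [← (finCongr e).sum_comp, Fin.sum_univ_add]
  rfl

theorem removeNth_frame_left {α : Type*} {r s N : ℕ} (h : r + 1 + s = N + 1) (h' : r + s = N)
    (X : Fin (r + 1) → α) (Y : Fin s → α) (i : Fin (r + 1)) :
    (Fin.cast h (Fin.castAdd s i)).removeNth (frame h X Y) = frame h' (i.removeNth X) Y :=
  Ext.removeNth_append X Y h i

theorem removeNth_frame_right {α : Type*} {r s N : ℕ} (h : r + (s + 1) = N + 1) (h' : r + s = N)
    (X : Fin r → α) (Y : Fin (s + 1) → α) (j : Fin (s + 1)) :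
    (Fin.cast h (Fin.natAdd r j)).removeNth (frame h X Y) = frame h' X (j.removeNth Y) := by
  subst h'
  funext a
  unfold frame
  refine Fin.addCases (fun b => ?_) (fun b => ?_) a
  · have e : Fin.cast h.symm ((Fin.cast h (Fin.natAdd r j)).succAbove (Fin.castAdd s b)) =
        Fin.castAdd (s + 1) b := by
      ext
      simp only [Fin.succAbove, Fin.lt_def, Fin.val_cast, Fin.val_castAdd, Fin.val_natAdd,
        Fin.val_castSucc]
      rw [if_pos (by omega)]
      rfl
    change Fin.append X Y (Fin.cast h.symm ((Fin.cast h (Fin.natAdd r j)).succAbove _)) =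
      Fin.append X _ (Fin.castAdd s b)
    rw [e, Fin.append_left, Fin.append_left]
  · have e : Fin.cast h.symm ((Fin.cast h (Fin.natAdd r j)).succAbove (Fin.natAdd r b)) =
        Fin.natAdd r (j.succAbove b) := by
      ext
      simp only [Fin.succAbove, Fin.lt_def, Fin.val_cast, Fin.val_natAdd,
        Fin.val_castSucc, Nat.add_lt_add_iff_left]
      split_ifs <;> simp [Nat.add_assoc]
    change Fin.append X Y (Fin.cast h.symm ((Fin.cast h (Fin.natAdd r j)).succAbove _)) =
      Fin.append X _ (Fin.natAdd r b)
    rw [e, Fin.append_right, Fin.append_right]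
    rfl

/-- Evaluation of alternating forms at a family of vectors. -/
def evalLin {B : Type*} [NormedAddCommGroup B] [NormedSpace ℝ B] {N : ℕ} (v : Fin N → V) :
    (V [⋀^Fin N]→L[ℝ] B) →ₗ[ℝ] B where
  toFun f := f v
  map_add' _ _ := rfl
  map_smul' _ _ := rfl

theorem extDeriv_apply_sum {N : ℕ} (η : V → V [⋀^Fin N]→L[ℝ] ℂ) (x : V) (v : Fin (N + 1) → V) :
    extDeriv η x v =
      ∑ i : Fin (N + 1), (-1 : ℝ) ^ (i : ℕ) • fderiv ℝ η x (v i) (i.removeNth v) := by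
  rw [extDeriv, ContinuousAlternatingMap.alternatizeUncurryFin_apply]
  refine Finset.sum_congr rfl fun i _ => ?_
  rw [← Int.cast_smul_eq_zsmul ℝ]
  push_cast
  rfl

theorem fderiv_apply_of_affine {U W : Type*} [NormedAddCommGroup U] [NormedSpace ℝ U]
    [NormedAddCommGroup W] [NormedSpace ℝ W] {f : U → W} {t v : U} {u : W}
    (hf : DifferentiableAt ℝ f t) (h : ∀ s : ℝ, f (t + s • v) = f t + s • u) :
    fderiv ℝ f t v = u := by
  have h1 : HasDerivAt (fun s : ℝ => f (t + s • v)) (fderiv ℝ f t v) 0 := by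
    have h2 : HasDerivAt (fun s : ℝ => t + s • v) v 0 := by
      simpa using ((hasDerivAt_id (0 : ℝ)).smul_const v).const_add t
    have h3 : HasFDerivAt f (fderiv ℝ f t) (t + (0 : ℝ) • v) := by
      rw [zero_smul, add_zero]
      exact hf.hasFDerivAt
    exact h3.comp_hasDerivAt 0 h2
  have h4 : HasDerivAt (fun s : ℝ => f (t + s • v)) u 0 := by
    simp only [h]
    simpa using ((hasDerivAt_id (0 : ℝ)).smul_const u).const_add (f t)
  exact h1.unique h4

end Alternating

/-! ### Tangent vectors of the faces. -/

section Cofaces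

theorem fderiv_coface_succ {r : ℕ} (i : Fin (r + 1)) (t : Fin r → ℝ) (j : Fin r) :
    fderiv ℝ (coface i.succ) t (Pi.single j 1) = Pi.single (i.succAbove j) 1 := by
  refine fderiv_apply_of_affine ((contDiff_coface i.succ).contDiffAt.differentiableAt (by simp))
    fun s => ?_
  rw [coface_succ, coface_succ]
  funext a
  rcases Fin.eq_self_or_eq_succAbove i a with rfl | ⟨b, rfl⟩
  · simp [(Fin.succAbove_ne a j).symm]
  · simp [Pi.single_apply]

/-- The zeroth face is not a coordinate hyperplane: its first coordinate is `1 - ∑ t_i`, whence the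
correction by `Pi.single 0 1`. -/
theorem fderiv_coface_zero {r : ℕ} (t : Fin r → ℝ) (j : Fin r) :
    fderiv ℝ (coface 0) t (Pi.single j 1) =
      (Pi.single j.succ 1 - Pi.single 0 1 : Fin (r + 1) → ℝ) := by
  refine fderiv_apply_of_affine ((contDiff_coface 0).contDiffAt.differentiableAt (by simp))
    fun s => ?_
  rw [coface_zero, coface_zero]
  funext a
  refine Fin.cases ?_ (fun b => ?_) a
  · simp [bary, Finset.sum_add_distrib, Pi.single_apply]
    ring
  · simp [bary, Pi.single_apply]

end Cofaces

open MeasureTheory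

/-! ### Partial derivatives of evaluated forms. -/

section Partial

variable {E F U : Type*} [NormedAddCommGroup E] [NormedSpace ℝ E] [NormedAddCommGroup F]
  [NormedSpace ℝ F] [NormedAddCommGroup U] [NormedSpace ℝ U] [FiniteDimensional ℝ U]
  {N : ℕ} {η : E × F → U [⋀^Fin N]→L[ℝ] ℂ} {t : E} {h : F}

theorem fderiv_eval_fst (hη : DifferentiableAt ℝ η (t, h)) (X : Fin N → U) (v : E) :
    fderiv ℝ (fun t' => η (t', h) X) t v = fderiv ℝ η (t, h) (v, 0) X := by
  have h1 : HasFDerivAt (fun t' => η (t', h))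
      (fderiv ℝ η (t, h) ∘L ContinuousLinearMap.inl ℝ E F) t :=
    hη.hasFDerivAt.comp t (hasFDerivAt_prodMk_left t h)
  have h2 := Ext.fderiv_linear (evalLin (B := ℂ) X) h1.differentiableAt v
  rw [h1.fderiv] at h2
  exact h2

theorem fderiv_eval_snd (hη : DifferentiableAt ℝ η (t, h)) (X : Fin N → U) (y : F) :
    fderiv ℝ (fun h' => η (t, h') X) h y = fderiv ℝ η (t, h) (0, y) X := by
  have h1 : HasFDerivAt (fun h' => η (t, h'))
      (fderiv ℝ η (t, h) ∘L ContinuousLinearMap.inr ℝ E F) h :=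
    hη.hasFDerivAt.comp h (hasFDerivAt_prodMk_right t h)
  have h2 := Ext.fderiv_linear (evalLin (B := ℂ) X) h1.differentiableAt y
  rw [h1.fderiv] at h2
  exact h2

theorem fderiv_sum_smul {ι : Type*} [Fintype ι] (a : ι → ℝ) {G : ι → F → ℂ}
    (hG : ∀ i, DifferentiableAt ℝ (G i) h) (y : F) :
    fderiv ℝ (fun h' => ∑ i, a i • G i h') h y = ∑ i, a i • fderiv ℝ (G i) h y := by
  have h1 : HasFDerivAt (fun h' => ∑ i, a i • G i h') (∑ i, a i • fderiv ℝ (G i) h) h :=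
    HasFDerivAt.fun_sum fun i _ => (hG i).hasFDerivAt.const_smul (a i)
  rw [h1.fderiv, _root_.sum_apply]
  rfl

end Partial

/-! ### Closedness and the face relations, evaluated on vectors. -/

section Closed

variable {n : ℕ}

/-- The coordinate vector fields of the simplex. -/
def tvec (n m r : ℕ) (i : Fin m) : Ambient n m r := (Pi.single i 1, 0)

theorem contract_eq_frame {r s N k : ℕ} (e : r + s = N) (η : Ambient n r k [⋀^Fin N]→L[ℝ] ℂ)
    (v : Fin s → Fin k → Mat n) :
    contract e η v = η (frame e (tvec n r k) fun j => (0, v j)) := rfl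

theorem integralForm_apply {l k s : ℕ} (h : Fin (k + 1) → Mat n)
    (v : Fin s → Fin (k + 1) → Mat n) :
    integralForm n l k s h v = ∑ u : Fin l → Letter k,
      (listSign ((List.ofFn u).filterMap Sum.getLeft?) * coefficient u) •
        (formulaConst l k * wordForm s u h v) := by
  simp only [integralForm, ContinuousAlternatingMap.smul_apply, ContinuousAlternatingMap.sum_apply,
    Finset.smul_sum, smul_eq_mul, mul_smul_comm]

theorem contract_nerveForm_apply {l k s : ℕ} (e : k + 1 + s = 2 * (l + 1)) (t : Fin (k + 1) → ℝ)
    {h : Fin (k + 1) → Mat n} (hh : h ∈ GPow n (k + 1)) (v : Fin s → Fin (k + 1) → Mat n) :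
    contract e (nerveForm n (l + 1) (k + 1) (t, h)) v = ∑ u : Fin l → Letter k,
      (listSign ((List.ofFn u).filterMap Sum.getLeft?) * wordMonomial u t) •
        (formulaConst l k * wordForm s u h v) := by
  rw [contract_nerveForm (x := (t, h)) hh e]
  simp only [ContinuousAlternatingMap.smul_apply, ContinuousAlternatingMap.sum_apply,
    Finset.smul_sum, smul_eq_mul, mul_smul_comm]

/-- Integration over the simplex commutes with differentiation in the direction of the group. -/
theorem integral_fderiv_nerveForm {l k s : ℕ} (e : k + 1 + s = 2 * (l + 1))
    {h : Fin (k + 1) → Mat n} (hh : h ∈ GPow n (k + 1)) (v : Fin s → Fin (k + 1) → Mat n)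
    (y : Fin (k + 1) → Mat n) :
    ∫ t in simplex (k + 1), fderiv ℝ (nerveForm n (l + 1) (k + 1)) (t, h) (0, y)
        (frame e (tvec n (k + 1) (k + 1)) fun j => (0, v j)) =
      fderiv ℝ (integralForm n l k s) h y v := by
  set G : (Fin l → Letter k) → (Fin (k + 1) → Mat n) → ℂ := fun u h' =>
    formulaConst l k * wordForm s u h' v with hG
  have hGd : ∀ u, DifferentiableAt ℝ (G u) h := fun u =>
    ((Ext.contDiffAt_linear (evalLin (B := ℂ) v) (contDiffAt_wordForm s u hh)).differentiableAt
      (by simp)).const_mul _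
  -- By the explicit formula the variables separate into finitely many products of a polynomial in
  -- `t` and a function on the group, so no convergence theorem is needed to differentiate under the
  -- integral.
  have h1 : ∀ t, fderiv ℝ (nerveForm n (l + 1) (k + 1)) (t, h) (0, y)
        (frame e (tvec n (k + 1) (k + 1)) fun j => (0, v j)) = ∑ u : Fin l → Letter k,
      (listSign ((List.ofFn u).filterMap Sum.getLeft?) * wordMonomial u t) •
        fderiv ℝ (G u) h y := by
    intro t
    rw [← fderiv_eval_snd ((contDiffAt_nerveForm (l + 1) (x := (t, h)) hh).differentiableAt
      (by simp)), ← fderiv_sum_smul _ hGd]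
    refine congrArg (fun L : (Fin (k + 1) → Mat n) →L[ℝ] ℂ => L y)
      (Filter.EventuallyEq.fderiv_eq ?_)
    filter_upwards [(isOpen_GPow n (k + 1)).mem_nhds hh] with h' hh'
    rw [← contract_eq_frame, contract_nerveForm_apply e t hh']
  have h2 : fderiv ℝ (integralForm n l k s) h y v = ∑ u : Fin l → Letter k,
      (listSign ((List.ofFn u).filterMap Sum.getLeft?) * coefficient u) •
        fderiv ℝ (G u) h y := by
    rw [← fderiv_sum_smul _ hGd]
    have := Ext.fderiv_linear (evalLin (B := ℂ) v)
      ((contDiffAt_integralForm l k s hh).differentiableAt (by simp)) y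
    refine this.symm.trans ?_
    refine congrArg (fun L : (Fin (k + 1) → Mat n) →L[ℝ] ℂ => L y)
      (congrArg (fun f => fderiv ℝ f h) ?_)
    funext h'
    exact integralForm_apply h' v
  simp only [h1, h2]
  refine (setIntegral_sum_smul_const
    (fun u => continuous_const.mul (contDiff_wordMonomial u).continuous) _).trans ?_
  refine Finset.sum_congr rfl fun u _ => ?_
  simp only [Pi.mul_apply, integral_const_mul]
  rfl

/-- Contraction as a linear map. -/
def contractLin {r k s N : ℕ} (e : r + s = N) :
    (Ambient n r k [⋀^Fin N]→L[ℝ] ℂ) →ₗ[ℝ] (Fin k → Mat n) [⋀^Fin s]→L[ℝ] ℂ where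
  toFun η := contract e η
  map_add' _ _ := rfl
  map_smul' _ _ := rfl

/-- Integrability is borrowed from a continuous `g` because the forms integrated are cut off outside
the simplex and need not be continuous. -/
theorem apply_setIntegral {E : Type*} [NormedAddCommGroup E] [NormedSpace ℝ E]
    [FiniteDimensional ℝ E] (L : E →ₗ[ℝ] ℂ) {r : ℕ} {f g : (Fin r → ℝ) → E} (hg : Continuous g)
    (hfg : ∀ t ∈ simplex r, f t = g t) :
    L (∫ t in simplex r, f t) = ∫ t in simplex r, L (f t) := by
  have : CompleteSpace E := FiniteDimensional.complete ℝ E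
  have hint : IntegrableOn f (simplex r) :=
    (integrableOn_simplex hg).congr_fun (fun t ht => (hfg t ht).symm)
      (isClosed_simplex r).measurableSet
  exact ((LinearMap.toContinuousLinearMap L).integral_comp_comm hint).symm

theorem contDiff_nerveForm_left {p m : ℕ} {h : Fin m → Mat n} (hh : h ∈ GPow n m) :
    ContDiff ℝ ∞ fun t => nerveForm n p m (t, h) := by
  refine contDiff_iff_contDiffAt.2 fun t => ?_
  have h1 : ContDiffAt ℝ ∞ (fun t : Fin m → ℝ => ((t, h) : Ambient n m m)) t :=
    (contDiff_id.prodMk contDiff_const).contDiffAt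
  exact ContDiffAt.comp (g := nerveForm n p m) t (contDiffAt_nerveForm p (x := (t, h)) hh) h1

theorem fiberIntegral_apply {r s p : ℕ} (e : r + s = 2 * p) {y : Fin r → Mat n}
    (hy : y ∈ GPow n r) (v : Fin s → Fin r → Mat n) :
    fiberIntegral s (nerveChernForm n p r) y v =
      ∫ t in simplex r, contract e (nerveChernForm n p r (t, y)) v := by
  rw [fiberIntegral, dif_pos e]
  have hc : Continuous fun t => contract e (nerveForm n p r (t, y)) := by
    refine continuous_iff_continuousAt.2 fun t => ?_
    exact (Ext.contDiffAt_linear (Z := (Fin r → Mat n) [⋀^Fin s]→L[ℝ] ℂ) (contractLin e)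
      (contDiff_nerveForm_left hy).contDiffAt).continuousAt
  refine apply_setIntegral (evalLin (B := ℂ) v) hc fun t ht => ?_
  have hx : ((t, y) : Ambient n r r) ∈ simplexTimes n r r := ⟨ht, hy⟩
  rw [nerveChernForm, Set.indicator_of_mem hx]

/-- The simplicial identity for the Chern character form, evaluated on the coordinate fields and on
vectors tangent to the group. It turns each summand of `d'` into an integral over a face of the
simplex one dimension higher. -/
theorem contract_face {r s p : ℕ} (e : r + s = 2 * p) {h : Fin (r + 1) → Mat n}
    (hh : h ∈ GPow n (r + 1)) (a : Fin (r + 2)) {t : Fin r → ℝ} (ht : t ∈ simplex r)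
    (w : Fin s → Fin (r + 1) → Mat n) :
    contract e (nerveChernForm n p r (t, face n a h)) (fun j => fderiv ℝ (face n a) h (w j)) =
      nerveForm n p (r + 1) (coface a t, h)
        (frame e (fun j => ((fderiv ℝ (coface a) t (Pi.single j 1), 0) : Ambient n (r + 1) (r + 1)))
          fun j => (0, w j)) := by
  have hx : ((t, h) : Ambient n r (r + 1)) ∈ simplexTimes n r (r + 1) := ⟨ht, hh⟩
  have hx' : ((coface a t, h) : Ambient n (r + 1) (r + 1)) ∈ simplexTimes n (r + 1) (r + 1) :=
    ⟨mapsTo_coface a ht, hh⟩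
  have h1 := congrFun (nerveChernForm_simplicial (n := n) p r a) (t, h)
  rw [pullback_apply, pullback_apply, Set.indicator_of_mem hx, Set.indicator_of_mem hx] at h1
  have hd1 : HasFDerivAt (fun x : Ambient n r (r + 1) =>
      ((coface a x.1, x.2) : Ambient n (r + 1) (r + 1)))
      ((fderiv ℝ (coface a) t).prodMap (ContinuousLinearMap.id ℝ _)) ((t, h) : Ambient n r (r + 1)) :=
    HasFDerivAt.prodMap (t, h)
      (((contDiff_coface a).contDiffAt.differentiableAt (by simp)).hasFDerivAt) (hasFDerivAt_id h)
  have hd2 : HasFDerivAt (fun x : Ambient n r (r + 1) => ((x.1, face n a x.2) : Ambient n r r))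
      ((ContinuousLinearMap.id ℝ _).prodMap (fderiv ℝ (face n a) h))
      ((t, h) : Ambient n r (r + 1)) :=
    HasFDerivAt.prodMap (t, h) (hasFDerivAt_id t)
      (((contDiff_face n a).contDiffAt.differentiableAt (by simp)).hasFDerivAt)
  rw [hd1.fderiv, hd2.fderiv] at h1
  have h2 := congrArg (fun g => g (frame e (tvec n r (r + 1)) fun j => (0, w j))) h1
  simp only [ContinuousAlternatingMap.compContinuousLinearMap_apply, Function.comp_def,
    frame_comp] at h2
  rw [nerveChernForm, Set.indicator_of_mem hx'] at h2
  have f1 : ∀ v : Fin r → ℝ, (fderiv ℝ (coface a) t).prodMap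
      (ContinuousLinearMap.id ℝ (Fin (r + 1) → Mat n)) (v, 0) = (fderiv ℝ (coface a) t v, 0) :=
    fun v => rfl
  have f2 : ∀ v : Fin (r + 1) → Mat n, (fderiv ℝ (coface a) t).prodMap
      (ContinuousLinearMap.id ℝ (Fin (r + 1) → Mat n)) (0, v) = (0, v) :=
    fun v => Prod.ext (fderiv ℝ (coface a) t).map_zero rfl
  have f3 : ∀ v : Fin r → ℝ, (ContinuousLinearMap.id ℝ (Fin r → ℝ)).prodMap
      (fderiv ℝ (face n a) h) (v, 0) = (v, 0) := fun v => Prod.ext rfl (fderiv ℝ (face n a) h).map_zero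
  have f4 : ∀ v : Fin (r + 1) → Mat n, (ContinuousLinearMap.id ℝ (Fin r → ℝ)).prodMap
      (fderiv ℝ (face n a) h) (0, v) = (0, fderiv ℝ (face n a) h v) := fun v => rfl
  simp only [tvec, f1, f2, f3, f4] at h2
  exact h2.symm

theorem contDiff_nerveForm_eval {p m : ℕ} {h : Fin m → Mat n} (hh : h ∈ GPow n m)
    (X : Fin (2 * p) → Ambient n m m) : ContDiff ℝ ∞ fun t => nerveForm n p m (t, h) X := by
  exact contDiff_iff_contDiffAt.2 fun t => Ext.contDiffAt_linear (evalLin (B := ℂ) X)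
    (contDiff_nerveForm_left hh).contDiffAt

/-- The equation `dω = 0` on all coordinate fields followed by the vectors `w`: the first sum
differentiates along the simplex, the second along the group, whose arguments come after `r + 1`
others. -/
theorem sum_fderiv_nerveForm {r s p : ℕ} (e : r + 1 + s = 2 * p) (e' : r + (s + 1) = 2 * p)
    (t : Fin (r + 1) → ℝ) {h : Fin (r + 1) → Mat n} (hh : h ∈ GPow n (r + 1))
    (w : Fin (s + 1) → Fin (r + 1) → Mat n) :
    ∑ i : Fin (r + 1), (-1 : ℝ) ^ (i : ℕ) • fderiv ℝ (fun t => nerveForm n p (r + 1) (t, h)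
        (frame e' (i.removeNth (tvec n (r + 1) (r + 1))) fun j => (0, w j))) t (Pi.single i 1) +
      (-1 : ℝ) ^ (r + 1) • ∑ j : Fin (s + 1), (-1 : ℝ) ^ (j : ℕ) •
        fderiv ℝ (nerveForm n p (r + 1)) (t, h) (0, w j)
          (frame e (tvec n (r + 1) (r + 1)) fun a => (0, j.removeNth w a)) = 0 := by
  have hd := (contDiffAt_nerveForm p (x := (t, h)) hh).differentiableAt (by simp)
  have e1 : r + 1 + (s + 1) = 2 * p + 1 := by omega
  have h1 := congrArg (fun g => g (frame e1 (tvec n (r + 1) (r + 1)) fun j => (0, w j)))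
    (extDeriv_nerveForm p (x := (t, h)) hh)
  simp only [extDeriv_apply_sum] at h1
  rw [sum_frame e1] at h1
  rw [Finset.smul_sum]
  refine Eq.trans (congrArg₂ _ (Finset.sum_congr rfl fun i _ => ?_)
    (Finset.sum_congr rfl fun j _ => ?_)) h1
  · rw [fderiv_eval_fst hd, removeNth_frame_left e1 e']
    simp only [frame, Fin.val_cast, Fin.val_castAdd, Fin.cast_cast, Fin.cast_eq_self,
      Fin.append_left]
    rfl
  · rw [removeNth_frame_right e1 e, smul_smul, ← pow_add]
    simp only [frame, Fin.val_cast, Fin.val_natAdd, Fin.cast_cast, Fin.cast_eq_self,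
      Fin.append_right]
    rfl

end Closed

open MeasureTheory

theorem continuousAt_fderiv_eval {E F U : Type*} [NormedAddCommGroup E] [NormedSpace ℝ E]
    [NormedAddCommGroup F] [NormedSpace ℝ F] [NormedAddCommGroup U] [NormedSpace ℝ U]
    [FiniteDimensional ℝ U] {N : ℕ} {η : E × F → U [⋀^Fin N]→L[ℝ] ℂ} {t : E} {h : F}
    (hη : ContDiffAt ℝ ∞ η (t, h)) (y : E × F) (X : Fin N → U) :
    ContinuousAt (fun t => fderiv ℝ η (t, h) y X) t := by
  have h1 : ContDiffAt ℝ ∞ (fderiv ℝ η) (t, h) := hη.fderiv_right (by simp)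
  have h2 : ContDiffAt ℝ ∞ (fun t : E => (t, h)) t :=
    (contDiff_id.prodMk contDiff_const).contDiffAt
  have h3 : ContDiffAt ℝ ∞ (fun t => fderiv ℝ η (t, h) y) t :=
    (ContDiffAt.comp (g := fderiv ℝ η) t h1 h2).clm_apply contDiffAt_const
  exact (Ext.contDiffAt_linear (evalLin (B := ℂ) X) h3).continuousAt

/-! ### The cocycle property. -/

section Cocycle

variable {n : ℕ}

theorem frame_left {α : Type*} {r s N : ℕ} (e : r + s = N) (X : Fin r → α) (Y : Fin s → α)
    (i : Fin r) : frame e X Y (Fin.cast e (Fin.castAdd s i)) = X i := by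
  simp [frame]

theorem frame_right {α : Type*} {r s N : ℕ} (e : r + s = N) (X : Fin r → α) (Y : Fin s → α)
    (j : Fin s) : frame e X Y (Fin.cast e (Fin.natAdd r j)) = Y j := by
  simp [frame]

/-- Contraction of a form with the vectors tangent to the zeroth face of the simplex. -/
theorem eval_coface_zero {r s N : ℕ} (e : r + s = N)
    (η : Ambient n (r + 1) (r + 1) [⋀^Fin N]→L[ℝ] ℂ) (t : Fin r → ℝ)
    (w : Fin s → Fin (r + 1) → Mat n) :
    η (frame e (fun j => ((fderiv ℝ (coface 0) t (Pi.single j 1), 0) : Ambient n (r + 1) (r + 1)))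
        fun j => (0, w j)) =
      ∑ i : Fin (r + 1), (-1 : ℝ) ^ (i : ℕ) •
        η (frame e (i.removeNth (tvec n (r + 1) (r + 1))) fun j => (0, w j)) := by
  have e1 : r + 1 + s = N + 1 := by omega
  -- Here `ε = -dt_0 = dt_1 + ⋯ + dt_{r+1}`, which is `1` on every coordinate field and zero on the
  -- group. Subtracting its multiples of the first field yields the tangent vectors of the zeroth
  -- face.
  set ε : Ambient n (r + 1) (r + 1) →L[ℝ] ℝ := -dbary n (r + 1) (r + 1) 0 with hε
  have hε1 : ∀ i, ε (tvec n (r + 1) (r + 1) i) = 1 := by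
    intro i
    simp [hε, dbary, tvec]
  have hε2 : ∀ y, ε ((0, y) : Ambient n (r + 1) (r + 1)) = 0 := by
    intro y
    simp [hε, dbary]
  set X := frame e1 (tvec n (r + 1) (r + 1)) (fun j => ((0, w j) : Ambient n (r + 1) (r + 1)))
    with hX
  have h00 : Fin.cast e1 (Fin.castAdd s (0 : Fin (r + 1))) = 0 := rfl
  have hX0 : X 0 = tvec n (r + 1) (r + 1) 0 := by rw [← h00, hX, frame_left]
  have hXs : (fun j : Fin N => X j.succ) =
      frame e (fun j => tvec n (r + 1) (r + 1) j.succ) fun j => (0, w j) := by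
    have := removeNth_frame_left e1 e (tvec n (r + 1) (r + 1))
      (fun j => ((0, w j) : Ambient n (r + 1) (r + 1))) 0
    rw [h00, Fin.removeNth_zero, Fin.removeNth_zero] at this
    exact this
  have h1 := map_sub_smul_zero η ε X (by rw [hX0, hε1])
  rw [sum_frame e1] at h1
  simp only [hX, frame_left, frame_right, hε1, hε2, zero_smul, smul_zero, Finset.sum_const_zero,
    add_zero, one_smul, removeNth_frame_left e1 e, Fin.val_cast, Fin.val_castAdd] at h1
  rw [← h1, ← hX, hX0]
  congr 1
  have h2 := frame_comp e (fun j => tvec n (r + 1) (r + 1) j.succ)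
    (fun j => ((0, w j) : Ambient n (r + 1) (r + 1)))
    (fun v => v - ε v • tvec n (r + 1) (r + 1) 0)
  rw [← hXs] at h2
  rw [h2]
  simp only [hε1, hε2, zero_smul, sub_zero, one_smul, fderiv_coface_zero]
  congr 1
  funext j
  simp [tvec]

theorem eval_coface_succ {r s N : ℕ} (e : r + s = N)
    (η : Ambient n (r + 1) (r + 1) [⋀^Fin N]→L[ℝ] ℂ) (i : Fin (r + 1)) (t : Fin r → ℝ)
    (w : Fin s → Fin (r + 1) → Mat n) :
    η (frame e (fun j => ((fderiv ℝ (coface i.succ) t (Pi.single j 1), 0) :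
        Ambient n (r + 1) (r + 1))) fun j => (0, w j)) =
      η (frame e (i.removeNth (tvec n (r + 1) (r + 1))) fun j => (0, w j)) := by
  simp only [fderiv_coface_succ]
  rfl

/-- Stokes' theorem for the integral over the simplex of the Chern character form. -/
theorem sum_faces_eq {r s p : ℕ} (e : r + 1 + s = 2 * p) (e' : r + (s + 1) = 2 * p)
    {h : Fin (r + 1) → Mat n} (hh : h ∈ GPow n (r + 1)) (w : Fin (s + 1) → Fin (r + 1) → Mat n) :
    ∑ a : Fin (r + 2), (-1 : ℝ) ^ (a : ℕ) •
        fiberIntegral (s + 1) (nerveChernForm n p r) (face n a h)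
          (fun j => fderiv ℝ (face n a) h (w j)) +
      (-1 : ℝ) ^ (r + 1) • ∑ j : Fin (s + 1), (-1 : ℝ) ^ (j : ℕ) •
        ∫ t in simplex (r + 1), fderiv ℝ (nerveForm n p (r + 1)) (t, h) (0, w j)
          (frame e (tvec n (r + 1) (r + 1)) fun a => (0, j.removeNth w a)) = 0 := by
  set g : Fin (r + 1) → (Fin (r + 1) → ℝ) → ℂ := fun i t => nerveForm n p (r + 1) (t, h)
        (frame e' (i.removeNth (tvec n (r + 1) (r + 1))) fun j => (0, w j)) with hg
  have hgs : ∀ i, ContDiff ℝ ∞ (g i) := fun i => contDiff_nerveForm_eval hh _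
  have hgc : ∀ i a, Continuous fun t => g i (coface a t) := fun i a =>
    (hgs i).continuous.comp (contDiff_coface a).continuous
  have hdc : ∀ i, Continuous fun t => fderiv ℝ (g i) t (Pi.single i 1) := fun i =>
    ((hgs i).continuous_fderiv (by simp)).clm_apply continuous_const
  have hface : ∀ a : Fin (r + 2), fiberIntegral (s + 1) (nerveChernForm n p r) (face n a h)
      (fun j => fderiv ℝ (face n a) h (w j)) = ∫ t in simplex r,
        nerveForm n p (r + 1) (coface a t, h)
        (frame e' (fun j => ((fderiv ℝ (coface a) t (Pi.single j 1), 0) :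
          Ambient n (r + 1) (r + 1))) fun j => (0, w j)) := by
    intro a
    rw [fiberIntegral_apply e' (mapsTo_face n a hh)]
    exact setIntegral_congr_fun (isClosed_simplex r).measurableSet fun t ht =>
      contract_face e' hh a ht w
  have hface0 : fiberIntegral (s + 1) (nerveChernForm n p r) (face n 0 h)
      (fun j => fderiv ℝ (face n 0) h (w j)) =
        ∑ i : Fin (r + 1), (-1 : ℝ) ^ (i : ℕ) • ∫ t in simplex r, g i (coface 0 t) := by
    rw [hface]
    simp only [eval_coface_zero]
    rw [integral_finsetSum]
    · simp only [integral_smul]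
      rfl
    · exact fun i _ => integrableOn_simplex ((hgc i 0).const_smul ((-1 : ℝ) ^ (i : ℕ)))
  have hfaces : ∀ i : Fin (r + 1), fiberIntegral (s + 1) (nerveChernForm n p r) (face n i.succ h)
      (fun j => fderiv ℝ (face n i.succ) h (w j)) = ∫ t in simplex r, g i (coface i.succ t) := by
    intro i
    rw [hface]
    simp only [eval_coface_succ]
    rfl
  have hsum : ∑ a : Fin (r + 2), (-1 : ℝ) ^ (a : ℕ) •
        fiberIntegral (s + 1) (nerveChernForm n p r) (face n a h)
          (fun j => fderiv ℝ (face n a) h (w j)) =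
      ∑ i : Fin (r + 1), (-1 : ℝ) ^ (i : ℕ) •
        ∫ t in simplex (r + 1), fderiv ℝ (g i) t (Pi.single i 1) := by
    -- The zeroth face contributes one term for each direction `i`. Paired with the face of index `i
    -- + 1`, whose sign is opposite, it is the boundary side of Stokes' theorem in direction `i`.
    rw [Fin.sum_univ_succ, hface0, Fin.val_zero, pow_zero, one_smul, ← Finset.sum_add_distrib]
    refine Finset.sum_congr rfl fun i _ => ?_
    rw [hfaces, setIntegral_simplex_fderiv i ((hgs i).of_le (by simp)), Fin.val_succ, pow_succ,
      mul_neg_one, neg_smul, smul_sub, sub_eq_add_neg]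
  have hη : ∀ j : Fin (s + 1), Continuous fun t => fderiv ℝ (nerveForm n p (r + 1)) (t, h)
      (0, w j) (frame e (tvec n (r + 1) (r + 1)) fun a => (0, j.removeNth w a)) := by
    intro j
    exact continuous_iff_continuousAt.2 fun t =>
      continuousAt_fderiv_eval (contDiffAt_nerveForm p (x := (t, h)) hh) _ _
  rw [hsum]
  -- The pointwise closedness relation, integrated over the simplex.
  have key := setIntegral_congr_fun (μ := volume) (isClosed_simplex (r + 1)).measurableSet
    (fun t (_ : t ∈ simplex (r + 1)) => sum_fderiv_nerveForm e e' t hh w)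
  rw [integral_add, integral_finsetSum, integral_smul, integral_finsetSum, integral_zero] at key
  · simp only [integral_smul] at key
    exact key
  · exact fun j _ => integrableOn_simplex ((hη j).const_smul ((-1 : ℝ) ^ (j : ℕ)))
  · exact fun i _ => integrableOn_simplex ((hdc i).const_smul ((-1 : ℝ) ^ (i : ℕ)))
  · exact integrableOn_simplex (continuous_finsetSum _ fun i _ =>
      (hdc i).const_smul ((-1 : ℝ) ^ (i : ℕ)))
  · exact integrableOn_simplex ((continuous_finsetSum _ fun j _ =>
      (hη j).const_smul ((-1 : ℝ) ^ (j : ℕ))).const_smul ((-1 : ℝ) ^ (r + 1)))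

theorem dPrime_succ_apply (c : DoubleComplex n) (r s : ℕ) {h : Fin (r + 1) → Mat n}
    (hh : h ∈ GPow n (r + 1)) (w : Fin s → Fin (r + 1) → Mat n) :
    (dPrime n (r + 1) s c : (Fin (r + 1) → Mat n) → (Fin (r + 1) → Mat n) [⋀^Fin s]→L[ℝ] ℂ) h w =
      ∑ a : Fin (r + 2), (-1 : ℂ) ^ (a : ℕ) •
        (c r s : (Fin r → Mat n) → (Fin r → Mat n) [⋀^Fin s]→L[ℝ] ℂ) (face n a h)
          fun j => fderiv ℝ (face n a) h (w j) := by
  have h1 : ∀ a : Fin (r + 2), (pullbackForms (GPow n (r + 1)) (GPow n r) (face n a)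
      (contDiff_face n a) (mapsTo_face n a) s (c r s) :
        (Fin (r + 1) → Mat n) → (Fin (r + 1) → Mat n) [⋀^Fin s]→L[ℝ] ℂ) h w =
      (c r s : (Fin r → Mat n) → (Fin r → Mat n) [⋀^Fin s]→L[ℝ] ℂ) (face n a h)
          fun j => fderiv ℝ (face n a) h (w j) := by
    intro a
    change pullback (GPow n (r + 1)) (face n a) s _ h w = _
    rw [pullback_apply, Set.indicator_of_mem hh]
    rfl
  simp only [dPrime, LinearMap.sum_apply, LinearMap.smul_apply, LinearMap.comp_apply,
    Submodule.coe_sum, Submodule.coe_smul, Finset.sum_apply, Pi.smul_apply,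
    ContinuousAlternatingMap.sum_apply, ContinuousAlternatingMap.smul_apply]
  exact Finset.sum_congr rfl fun a _ => congrArg _ (h1 a)

/-- The group set is open, so the cut-off cochain may be replaced by any `η` agreeing with it there,
in particular by the closed formula. -/
theorem dDoublePrime_succ_apply (c : DoubleComplex n) (r s : ℕ) {h : Fin r → Mat n}
    (hh : h ∈ GPow n r) (w : Fin (s + 1) → Fin r → Mat n)
    {η : (Fin r → Mat n) → (Fin r → Mat n) [⋀^Fin s]→L[ℝ] ℂ}
    (hη : Set.EqOn (c r s : (Fin r → Mat n) → (Fin r → Mat n) [⋀^Fin s]→L[ℝ] ℂ) η (GPow n r)) :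
    (dDoublePrime n r (s + 1) c : (Fin r → Mat n) → (Fin r → Mat n) [⋀^Fin (s + 1)]→L[ℝ] ℂ) h w =
      (-1 : ℂ) ^ r • ∑ j : Fin (s + 1), (-1 : ℝ) ^ (j : ℕ) •
        fderiv ℝ η h (w j) (j.removeNth w) := by
  have h1 : (extD (GPow n r) (isOpen_GPow n r).uniqueDiffOn s (c r s) :
      (Fin r → Mat n) → (Fin r → Mat n) [⋀^Fin (s + 1)]→L[ℝ] ℂ) h w = extDeriv η h w := by
    change ((GPow n r).indicator (extDerivWithin
      (c r s : (Fin r → Mat n) → (Fin r → Mat n) [⋀^Fin s]→L[ℝ] ℂ) (GPow n r)) h) w = _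
    rw [Set.indicator_of_mem hh, extDerivWithin, extDeriv, fderivWithin_congr hη (hη hh),
      fderivWithin_of_isOpen (isOpen_GPow n r) hh]
  rw [← extDeriv_apply_sum, ← h1]
  rfl

/-- In the relevant degree this is `sum_faces_eq`, its second sum becoming `d''` once integration
and differentiation are exchanged. In all other bidegrees the components involved vanish, including
those on `NG(0)` and those of form degree zero. -/
theorem totalD_integralCochain (n l : ℕ) : totalD n (integralCochain n l) = 0 := by
  have hz : ∀ r s : ℕ, (¬ ∃ q < l + 1, r = l + 1 - q ∧ s = l + 1 + q) →
      integralCochain n l r s = 0 := fun r s h => integralCochain_eq_zero h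
  funext r s
  change dPrime n r s (integralCochain n l) + dDoublePrime n r s (integralCochain n l) = 0
  have hP : ∀ r s, integralCochain n l r s = 0 → dPrime n (r + 1) s (integralCochain n l) = 0 := by
    intro r s h0
    have hp : proj n r s (integralCochain n l) = 0 := h0
    simp only [dPrime, LinearMap.sum_apply, LinearMap.smul_apply, LinearMap.comp_apply, hp,
      map_zero, smul_zero, Finset.sum_const_zero]
  have hD : ∀ r s, integralCochain n l r s = 0 →
      dDoublePrime n r (s + 1) (integralCochain n l) = 0 := by
    intro r s h0
    have hp : proj n r s (integralCochain n l) = 0 := h0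
    simp only [dDoublePrime, LinearMap.smul_apply, LinearMap.comp_apply, hp, map_zero, smul_zero]
  cases r with
  | zero =>
    cases s with
    | zero => exact add_zero _
    | succ s =>
      rw [hD 0 s (hz 0 s (by omega))]
      exact add_zero _
  | succ r =>
    cases s with
    | zero =>
      rw [hP r 0 (hz r 0 (by omega))]
      exact add_zero _
    | succ s =>
      by_cases e : r + 1 + s = 2 * (l + 1)
      swap
      · rw [hP r (s + 1) (hz _ _ (by omega)), hD (r + 1) s (hz _ _ (by omega)), add_zero]
      refine Subtype.ext (funext fun h => ?_)
      by_cases hh : h ∈ GPow n (r + 1)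
      swap
      · exact (dPrime n (r + 1) (s + 1) (integralCochain n l) +
          dDoublePrime n (r + 1) (s + 1) (integralCochain n l)).2.2 h hh
      ext w
      have hη : Set.EqOn (integralCochain n l (r + 1) s :
          (Fin (r + 1) → Mat n) → (Fin (r + 1) → Mat n) [⋀^Fin s]→L[ℝ] ℂ)
          (integralForm n l r s) (GPow n (r + 1)) := by
        intro y hy
        change fiberIntegral s (nerveChernForm n (l + 1) (r + 1)) y = _
        rw [fiberIntegral_nerveChernForm l r s e, Set.indicator_of_mem hy]
      have h1 := dPrime_succ_apply (integralCochain n l) r (s + 1) hh w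
      have h2 := dDoublePrime_succ_apply (integralCochain n l) (r + 1) s hh w hη
      have key := sum_faces_eq e (by omega) hh w
      simp only [integral_fderiv_nerveForm e hh] at key
      refine (congrArg₂ (· + ·) h1 h2).trans (Eq.trans ?_ key)
      congr 1
      · refine Finset.sum_congr rfl fun a _ => ?_
        rw [Complex.real_smul, smul_eq_mul]
        push_cast
        rfl
      · rw [Complex.real_smul, smul_eq_mul]
        push_cast
        rfl

/-- The cocycle `I_Δ` of the Chern character form. -/
def integralCocycle (n l : ℕ) : cocycles n (2 * (l + 1)) :=
  ⟨integralCochain n l, mem_totalDegree.2 fun _ _ h => integralCochain_eq_zero (by omega),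
    totalD_integralCochain n l⟩

end Cocycle

end BSS

end

/-! ### Assembly of the theorem. -/

theorem theorem3p2 (n p : ℕ) (hp : 1 ≤ p) :
    ∃ c : BSS.cocycles n (2 * p),
      (∀ q k : ℕ, k + 1 = p - q →
        ((c : BSS.DoubleComplex n) (k + 1) (p + q) :
            (Fin (k + 1) → BSS.Mat n) → (Fin (k + 1) → BSS.Mat n) [⋀^Fin (p + q)]→L[ℝ] ℂ) =
          BSS.component n p q k) ∧
      (∀ r s : ℕ, (¬ ∃ q < p, r = p - q ∧ s = p + q) → (c : BSS.DoubleComplex n) r s = 0) ∧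
      (∃ φ : BSS.FormSeq n (2 * p), (∀ ψ, BSS.IsChernCharacterForm n p ψ ↔ ψ = φ) ∧
        BSS.IsIntegralOf (c : BSS.DoubleComplex n) φ) ∧
      (∀ x : BSS.Cohomology n (2 * p),
        BSS.IsChernCharacter n p x ↔ x = BSS.cohomologyClass n (2 * p) c) := by
  obtain ⟨l, rfl⟩ : ∃ l, p = l + 1 := ⟨p - 1, by omega⟩
  refine ⟨BSS.integralCocycle n l, ?_, fun r s h => BSS.integralCochain_eq_zero h,
    ⟨BSS.nerveChernForm n (l + 1), BSS.isChernCharacterForm_iff n (l + 1),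
      BSS.isIntegralOf_integralCochain n l⟩, fun x => ⟨?_, ?_⟩⟩
  · intro q k h
    obtain rfl : l = k + q := by omega
    exact BSS.integralCochain_eq_component q k
  · rintro ⟨φ, c, hφ, hc, rfl⟩
    -- Uniqueness of the form fixes its integral, so the representing cocycle itself, and not only
    -- its class, is determined.
    obtain rfl := (BSS.isChernCharacterForm_iff n (l + 1) φ).1 hφ
    refine congrArg _ (Subtype.ext ?_)
    funext r s
    exact Subtype.ext (hc r s)
  · rintro rfl
    exact ⟨_, _, BSS.isChernCharacterForm_nerveChernForm n (l + 1),
      BSS.isIntegralOf_integralCochain n l, rfl⟩
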